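/- **Theorem (recovery of bounded treewidth concentration graphs).** Let $G=([n],E)$ be a connected graph with treewidth ${\rm tw}(G)\le k$ and maximum degree $\Delta(G)\le d$. Let $\Sigma$ be a positive definite $n\times n$ matrix with $(\Sigma^{-1})_{ij}=0$ for all $i\ne j$ with $ij\notin E$, and let $\Sigma$ be generic: for all $A,B\subseteq[n]$, ${\rm rank}(\Sigma_{A,B})$ is the minimum size of a set $S\subseteq [n]$ that meets every path of $G$ from $A$ to $B$. The entries of $\Sigma$ are accessed through an oracle; the query complexity is the number of entries queried, and the time complexity is the number of steps of a randomized real random access machine with unit-cost arithmetic and zero tests, where an oracle call and a uniform draw from a finite set are one step each. Let the integer $m$ satisfy, for some real $r\ge 11k$, $0<\delta\le \frac1{24}$ and $0<\tau\le\frac13$, $$m\ \ge\ \max\Big(\frac{10r}{\delta^2}\log\frac{8r}{\delta^2},\ \frac{2}{\delta^2}\log\frac2\tau\Big),\qquad m=\mathcal O(k\log k),\ \text{ that is, } m\le L\,(1+k\log k)\ \text{ for a fixed constant } L .$$ Consider the following recursive procedure, where for lists of indices $\Sigma_{AS,BS}$ is the submatrix with rows $A\cup S$ and columns $B\cup S$,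 and $\Sigma_{A,B|S}=\Sigma_{A,B}-\Sigma_{A,S}\Sigma_{S}^{-1}\Sigma_{S,B}$ (with $\Sigma_{S'|S}=\Sigma_{S',S'|S}$). Ranks, inverses and conditional covariances are computed by Gaussian elimination, and $\widehat K$ is stored sparsely. * ${\tt Reconstruct}(V,S)$: if $|V|\le m$, return $\widehat K_V=(\Sigma_{V,V|S})^{-1}$. Otherwise let $(S',C_1,\dots,C_t)={\tt Components}(V,S)$; for each $i$ compute $\widehat K_{C_i}={\tt Reconstruct}(C_i,S\cup S')$ and $\widehat K_{C_i,S'}=-\widehat K_{C_i}\Sigma_{C_i,S'|S}\Sigma_{S'|S}^{-1}$ (and its transpose $\widehat K_{S',C_i}$); then let $\widehat K_{S'}=\big(\mathbb I-\sum_i\widehat K_{S',C_i}\Sigma_{C_i,S'|S}\big)\Sigma_{S'|S}^{-1}$ and return $\widehat K_V$, whose entries between different $C_i$ are zero. * ${\tt Components}(V,S)$: let $S'={\tt Separator}(V,S)$. Go through the vertices $v\in V\setminus S'$, keeping one representative $u$ of each class found so far; put $v$ into the class of $u$ if ${\rm rank}(\Sigma_{uSS',vSS'})=|S|+|S'|+1$,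 and let $v$ start a new class if this holds for no $u$. Return $S'$ and the classes. * ${\tt Separator}(V,S)$: let $W$ be the set of vertices obtained in $m$ independent uniform draws with replacement from $V$. Among all partitions of $W$ into $A,B$ with $|A|,|B|\le\frac23|W|$ find, by exhaustive search, one that minimizes ${\rm rank}(\Sigma_{AS,BS})$ (if there is none, take $A=W$, $B=\emptyset$). Return ${\tt ABSeparator}(V,A,B,S)$. * ${\tt ABSeparator}(V,A,B,S)$: let $\rho={\rm rank}(\Sigma_{AS,BS})$ and let $U$ be the set of all $v\in V$ with ${\rm rank}(\Sigma_{ASv,BSv})=\rho$. If $U=\emptyset$ return $\emptyset$; otherwise start with $C=\{v_0\}$ for some $v_0\in U$, go through the other $u\in U$, adding $u$ to $C$ whenever ${\rm rank}(\Sigma_{ASCu,BSCu})=\rho$, and return $C$. Then every execution of ${\tt Reconstruct}([n],\emptyset)$ that halts returns $K=\Sigma^{-1}$. Moreover, with probability at least $1-\frac1{n^8}$, ${\tt Reconstruct}([n],\emptyset)$ halts and returns $K=\Sigma^{-1}$, with query complexity $$\mathcal O\left((2^{\mathcal O(k\log k)}+dk\log n)\,k^2n\log^3 n\right)$$ and time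 complexity $$\mathcal O\left((2^{\mathcal O(k\log k)}+dk\log n)\,k^3n\log^4 n\right),$$ where the constants in the $\mathcal O$'s depend only on the constant $L$. -/

import Mathlib

namespace CovarianceRecovery

/-! ### Graphs and covariance matrices -/

section Graphs

variable {V : Type*}

/-- A tree decomposition of `G`, whose tree has vertex set `ι`. -/
structure TreeDecomposition (G : SimpleGraph V) (ι : Type) where
  tree : SimpleGraph ι
  isTree : tree.IsTree
  bag : ι → Finset V
  vertex_mem : ∀ v : V, ∃ i, v ∈ bag i
  edge_mem : ∀ u v : V, G.Adj u v → ∃ i, u ∈ bag i ∧ v ∈ bag i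
  mem_of_mem_path : ∀ (v : V) (i j : ι), v ∈ bag i → v ∈ bag j →
    ∀ p : tree.Walk i j, p.IsPath → ∀ l ∈ p.support, v ∈ bag l

/-- The treewidth: the least `w` such that some tree decomposition has all its bags of size at
most `w + 1`. For a finite graph the set is nonempty (one bag containing everything). -/
noncomputable def treewidth (G : SimpleGraph V) : ℕ :=
  sInf {w | ∃ (t : ℕ) (D : TreeDecomposition G (Fin t)), ∀ i, (D.bag i).card ≤ w + 1}

/-- `S` separates `A` and `B` in `G`: every walk from `A` to `B` (possibly of length zero) meets
`S`. -/
def Separates (G : SimpleGraph V) (S A B : Finset V) : Prop :=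
  ∀ a ∈ A, ∀ b ∈ B, ∀ p : G.Walk a b, ∃ v ∈ p.support, v ∈ S

end Graphs

/-- The model `M(G)`: positive definite (symmetric) matrices whose inverse vanishes at all
non-edges of `G`. -/
def Model {n : ℕ} (G : SimpleGraph (Fin n)) : Set (Matrix (Fin n) (Fin n) ℝ) :=
  {Cov | Cov.PosDef ∧ ∀ i j, i ≠ j → ¬ G.Adj i j → Cov⁻¹ i j = 0}

/-- Genericity: for all `A`, `B` the rank of the submatrix with rows `A` and columns `B` is the
minimum size of a separator of `A` and `B` in `G`. -/
def Generic {n : ℕ} (G : SimpleGraph (Fin n)) (Cov : Matrix (Fin n) (Fin n) ℝ) : Prop :=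
  ∀ A B : Finset (Fin n),
    IsLeast {c : ℕ | ∃ S : Finset (Fin n), Separates G S A B ∧ S.card = c}
      (Cov.submatrix (fun i : A => (i : Fin n)) (fun j : B => (j : Fin n))).rank

/-- The lower bound on the sample size `m` coming from the Vapnik-Chervonenkis inequality. -/
def SampleBound (m : ℕ) (r δ τ : ℝ) : Prop :=
  max (10 * r / δ ^ 2 * Real.log (8 * r / δ ^ 2)) (2 / δ ^ 2 * Real.log (2 / τ)) ≤ (m : ℝ)

/-! ### The machine model

A program is a tree of elementary instructions of a randomized real random access machine with a
covariance oracle. The type `R` of real numbers is abstract: a program gets numbers only from the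
oracle (`query`), from integer constants (`const`) and from arithmetic (`arith`), and sees them only
through the test `isZero`. Each of these instructions is one step. `draw N` produces a uniformly
random element of `{0, …, N}` in one step, and `tick` is one step of bookkeeping (a loop iteration,
a comparison of vertices or of small integers, reading or writing one place in memory). -/

inductive Arith
  | add
  | sub
  | mul
  | div

inductive Prog (n : ℕ) (R : Type) (α : Type) : Type
  | pure (a : α) : Prog n R α
  | tick (next : Prog n R α) : Prog n R α
  | query (i j : Fin n) (next : R → Prog n R α) : Prog n R α
  | const (c : ℤ) (next : R → Prog n R α) : Prog n R α
  | arith (op : Arith) (x y : R) (next : R → Prog n R α) : Prog n R α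
  | isZero (x : R) (next : Bool → Prog n R α) : Prog n R α
  | draw (N : ℕ) (next : Fin (N + 1) → Prog n R α) : Prog n R α

namespace Prog

def bind {n : ℕ} {R α β : Type} : Prog n R α → (α → Prog n R β) → Prog n R β
  | .pure a, f => f a
  | .tick p, f => .tick (bind p f)
  | .query i j p, f => .query i j (fun x => bind (p x) f)
  | .const c p, f => .const c (fun x => bind (p x) f)
  | .arith op x y p, f => .arith op x y (fun z => bind (p z) f)
  | .isZero x p, f => .isZero x (fun b => bind (p b) f)
  | .draw N p, f => .draw N (fun i => bind (p i) f)

instance {n : ℕ} {R : Type} : Monad (Prog n R) where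
  pure := Prog.pure
  bind := Prog.bind

end Prog

/-- The outcome of a run: the returned value, the number of oracle queries (counted with
repetitions), and the number of steps. -/
structure Outcome (α : Type) where
  value : α
  queries : ℕ
  time : ℕ

def Outcome.charge {α : Type} (q t : ℕ) (o : Outcome α) : Outcome α :=
  ⟨o.value, o.queries + q, o.time + t⟩

noncomputable def Arith.eval : Arith → ℝ → ℝ → ℝ
  | .add, x, y => x + y
  | .sub, x, y => x - y
  | .mul, x, y => x * y
  | .div, x, y => x / y

/-- The distribution of the outcome of a program run on the covariance matrix `Cov`. -/
noncomputable def run {n : ℕ} {α : Type} (Cov : Matrix (Fin n) (Fin n) ℝ) :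
    Prog n ℝ α → PMF (Outcome α)
  | .pure a => PMF.pure ⟨a, 0, 0⟩
  | .tick p => (run Cov p).map (Outcome.charge 0 1)
  | .query i j p => (run Cov (p (Cov i j))).map (Outcome.charge 1 1)
  | .const c p => (run Cov (p (c : ℝ))).map (Outcome.charge 0 1)
  | .arith op x y p => (run Cov (p (op.eval x y))).map (Outcome.charge 0 1)
  | .isZero x p =>
      open Classical in (run Cov (p (decide (x = 0)))).map (Outcome.charge 0 1)
  | .draw N p =>
      (PMF.uniformOfFintype (Fin (N + 1))).bind
        (fun i => (run Cov (p i)).map (Outcome.charge 0 1))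

/-! ### Loops, lists and elementary instructions

Vertex sets are duplicate-free lists, matrices are lists of rows. Every traversal of a list is
charged one step per entry, on top of the cost of the loop body. -/

section Algorithms

variable {n : ℕ} {R : Type} {α β γ : Type}

/-- One step of bookkeeping. -/
def step : Prog n R Unit := .tick (.pure ())

/-- A loop over a list that updates a state. -/
def forEach : List α → β → (β → α → Prog n R β) → Prog n R β
  | [], b, _ => pure b
  | a :: as, b, f => do
      step
      let c ← f b a
      forEach as c f

/-- A loop over a list that produces a list of results. -/
def mapEach : List α → (α → Prog n R β) → Prog n R (List β)
  | [], _ => pure []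
  | a :: as, f => do
      step
      let b ← f a
      let bs ← mapEach as f
      pure (b :: bs)

/-- A loop over two lists in parallel that produces a list of results. -/
def zipEach : List α → List β → (α → β → Prog n R γ) → Prog n R (List γ)
  | a :: as, b :: bs, f => do
      step
      let c ← f a b
      let cs ← zipEach as bs f
      pure (c :: cs)
  | _, _, _ => pure []

/-- The sublist of the entries that pass a test. -/
def filterEach : List α → (α → Prog n R Bool) → Prog n R (List α)
  | [], _ => pure []
  | a :: as, f => do
      step
      let b ← f a
      let bs ← filterEach as f
      pure (if b then a :: bs else bs)

def size (L : List α) : Prog n R ℕ :=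
  forEach L 0 (fun c _ => pure (c + 1))

def append : List α → List α → Prog n R (List α)
  | [], M => pure M
  | a :: as, M => do
      step
      let bs ← append as M
      pure (a :: bs)

def member (v : Fin n) (L : List (Fin n)) : Prog n R Bool :=
  forEach L false (fun b u => pure (b || decide (u = v)))

def ask (i j : Fin n) : Prog n R R := .query i j .pure

def constant (c : ℤ) : Prog n R R := .const c .pure

def arith (op : Arith) (x y : R) : Prog n R R := .arith op x y .pure

def testZero (x : R) : Prog n R Bool := .isZero x .pure

def uniform (N : ℕ) : Prog n R (Fin (N + 1)) := .draw N .pure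

/-! ### Linear algebra -/

/-- Query the submatrix with rows `A` and columns `B`. -/
def covMatrix (A B : List (Fin n)) : Prog n R (List (List R)) :=
  mapEach A (fun i => mapEach B (fun j => ask i j))

/-- Subtract from `row` the multiple of the pivot row `p :: ps` that makes its first entry vanish,
and drop this entry. -/
def eliminate (p : R) (ps row : List R) : Prog n R (List R) :=
  match row with
  | [] => pure []
  | x :: xs => do
      let c ← arith .div x p
      zipEach xs ps (fun y q => do
        let t ← arith .mul c q
        arith .sub y t)

/-- Search for a row with nonzero first entry; return it (if any) and the list of other rows. -/
def findPivot : List (List R) → Prog n R (Option (R × List R) × List (List R))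
  | [] => pure (none, [])
  | [] :: rows => do
      step
      let res ← findPivot rows
      pure (res.1, [] :: res.2)
  | (x :: xs) :: rows => do
      step
      let z ← testZero x
      if z then
        let res ← findPivot rows
        pure (res.1, (x :: xs) :: res.2)
      else
        pure (some (x, xs), rows)

/-- The rank of a matrix with the given number of columns, by Gaussian elimination. -/
def rankElim : ℕ → List (List R) → Prog n R ℕ
  | 0, _ => pure 0
  | c + 1, rows => do
      step
      let res ← findPivot rows
      match res.1 with
      | none => do
          let rest ← mapEach res.2 (fun row => pure row.tail)
          rankElim c rest
      | some piv => do
          let rest ← mapEach res.2 (fun row => eliminate piv.1 piv.2 row)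
          let r ← rankElim c rest
          pure (r + 1)

/-- The rank of the submatrix of the covariance matrix with rows `A` and columns `B`. -/
def covRank (A B : List (Fin n)) : Prog n R ℕ := do
  let M ← covMatrix A B
  let c ← size B
  rankElim c M

/-- The Schur complement of the leading `c` by `c` block of a matrix (all of whose leading
principal minors up to order `c` are nonzero), by elimination. -/
def schur : ℕ → List (List R) → Prog n R (List (List R))
  | 0, M => pure M
  | _ + 1, [] => pure []
  | _ + 1, [] :: _ => pure []
  | c + 1, (p :: ps) :: rows => do
      step
      let rest ← mapEach rows (fun row => eliminate p ps row)
      schur c rest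

/-- The conditional covariance `Cov_{A,B} - Cov_{A,S} Cov_{S,S}⁻¹ Cov_{S,B}`. -/
def condCov (S A B : List (Fin n)) : Prog n R (List (List R)) := do
  let SA ← append S A
  let SB ← append S B
  let M ← covMatrix SA SB
  let c ← size S
  schur c M

def identity (s : ℕ) : Prog n R (List (List R)) :=
  mapEach (List.range s) (fun i =>
    mapEach (List.range s) (fun j => constant (if i = j then 1 else 0)))

def zeros (s : ℕ) : Prog n R (List R) :=
  mapEach (List.range s) (fun _ => constant 0)

def negate (M : List (List R)) : Prog n R (List (List R)) :=
  mapEach M (fun row => mapEach row (fun x => do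
    let z ← constant 0
    arith .sub z x))

/-- `X * A⁻¹`, computed as the Schur complement of `A` in the block matrix with rows
`[A, 1]` and `[-X, 0]`. -/
def rightDivide (X A : List (List R)) : Prog n R (List (List R)) := do
  let s ← size A
  let I ← identity s
  let top ← zipEach A I (fun a e => append a e)
  let z ← zeros s
  let Y ← negate X
  let bottom ← mapEach Y (fun y => append y z)
  let M ← append top bottom
  schur s M

/-- A sparse matrix: a list of entries `(row, column, value)`. -/
abbrev Sparse (n : ℕ) (R : Type) := List (Fin n × Fin n × R)

/-- The nonzero entries of a matrix with rows `A` and columns `B`. -/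
def entries (A B : List (Fin n)) (M : List (List R)) : Prog n R (Sparse n R) :=
  forEach (A.zip M) [] (fun T ar =>
    forEach (B.zip ar.2) T (fun T bx => do
      let z ← testZero bx.2
      pure (if z then T else (ar.1, bx.1, bx.2) :: T)))

/-- The nonzero entries of a matrix with rows `A` and columns `B`, and of its transpose. -/
def entriesSymm (A B : List (Fin n)) (M : List (List R)) : Prog n R (Sparse n R) :=
  forEach (A.zip M) [] (fun T ar =>
    forEach (B.zip ar.2) T (fun T bx => do
      let z ← testZero bx.2
      pure (if z then T else (ar.1, bx.1, bx.2) :: (bx.1, ar.1, bx.2) :: T)))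

/-- The product of the sparse matrix `T` (rows and columns `C`) and the matrix `M` with rows `C`
and `s` columns. Two arrays indexed by vertices hold the rows of `M` and of the product. -/
def sparseMul (T : Sparse n R) (C : List (Fin n)) (M : List (List R)) (s : ℕ) :
    Prog n R (List (List R)) := do
  let rowOf ← forEach (C.zip M) (fun _ : Fin n => ([] : List R))
    (fun t cr => pure (Function.update t cr.1 cr.2))
  let z ← zeros s
  let P₀ ← forEach C (fun _ : Fin n => ([] : List R)) (fun t c => pure (Function.update t c z))
  let P ← forEach T P₀ (fun t e => do
    let row ← zipEach (t e.1) (rowOf e.2.1) (fun p q => do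
      let y ← arith .mul e.2.2 q
      arith .add p y)
    pure (Function.update t e.1 row))
  mapEach C (fun c => pure (P c))

/-- `acc - Qᵀ * M`. -/
def subTransposeMul (acc Q M : List (List R)) : Prog n R (List (List R)) :=
  forEach (Q.zip M) acc (fun acc qm =>
    zipEach acc qm.1 (fun row x =>
      zipEach row qm.2 (fun a y => do
        let t ← arith .mul x y
        arith .sub a t)))

/-! ### The procedures -/

/-- `ABSeparator(V, A, B, S)`. -/
def abSeparator (V A B S : List (Fin n)) : Prog n R (List (Fin n)) := do
  let AS ← append A S
  let BS ← append B S
  let r ← covRank AS BS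
  let U ← filterEach V (fun v => do
    let q ← covRank (v :: AS) (v :: BS)
    pure (decide (q = r)))
  match U with
  | [] => pure []
  | v₀ :: U₁ =>
      forEach U₁ [v₀] (fun C u => do
        let ASC ← append C AS
        let BSC ← append C BS
        let q ← covRank (u :: ASC) (u :: BSC)
        pure (if q = r then u :: C else C))

/-- The set of the vertices seen in `m` independent uniform draws, with replacement, from `V`. -/
def sample (m : ℕ) (V : List (Fin n)) : Prog n R (List (Fin n)) :=
  match V with
  | [] => pure []
  | v :: vs => do
      let N ← size vs
      forEach (List.range m) [] (fun W _ => do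
        let i ← uniform N
        let w := (v :: vs).getD i v
        let b ← member w W
        pure (if b then W else w :: W))

/-- Exhaustive search through all ways to distribute the remaining vertices over `A` and `B`, for a
pair with `|A|, |B| ≤ 2/3 (|A| + |B|)` that minimizes the rank of the submatrix with rows `A ∪ S`
and columns `B ∪ S`. The last argument is the best pair found so far, with its rank. -/
def searchSplit (S : List (Fin n)) :
    List (Fin n) → List (Fin n) → List (Fin n) →
      Option (ℕ × List (Fin n) × List (Fin n)) →
      Prog n R (Option (ℕ × List (Fin n) × List (Fin n)))
  | [], A, B, best => do
      let a ← size A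
      let b ← size B
      step
      if 3 * a ≤ 2 * (a + b) ∧ 3 * b ≤ 2 * (a + b) then
        let AS ← append A S
        let BS ← append B S
        let q ← covRank AS BS
        match best with
        | none => pure (some (q, A, B))
        | some old => pure (if q < old.1 then some (q, A, B) else some old)
      else
        pure best
  | w :: W, A, B, best => do
      step
      let best₁ ← searchSplit S W (w :: A) B best
      searchSplit S W A (w :: B) best₁

/-- `Separator(V, S)`, with sample size `m`. -/
def separator (m : ℕ) (V S : List (Fin n)) : Prog n R (List (Fin n)) := do
  let W ← sample m V
  let best ← searchSplit S W [] [] none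
  match best with
  | none => abSeparator V W [] S
  | some res => abSeparator V res.2.1 res.2.2 S

/-- Put `v` into the component of each representative `u` for which the rank of the submatrix with
rows `u ∪ SS` and columns `v ∪ SS` is `r + 1`. The Boolean is `true` if there is none. -/
def place (SS : List (Fin n)) (r : ℕ) (v : Fin n) :
    List (Fin n × List (Fin n)) → Prog n R (Bool × List (Fin n × List (Fin n)))
  | [] => pure (true, [])
  | uC :: rest => do
      step
      let q ← covRank (uC.1 :: SS) (v :: SS)
      let res ← place SS r v rest
      pure (if q = r + 1 then (false, (uC.1, v :: uC.2) :: res.2) else (res.1, uC :: res.2))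

/-- `Components(V, S)`: the separator, and the components that are left after its removal. -/
def components (m : ℕ) (V S : List (Fin n)) :
    Prog n R (List (Fin n) × List (List (Fin n))) := do
  let S₁ ← separator m V S
  let SS ← append S₁ S
  let r ← size SS
  let rest ← filterEach V (fun v => do
    let b ← member v S₁
    pure (!b))
  let comps ← forEach rest ([] : List (Fin n × List (Fin n))) (fun cs v => do
    let res ← place SS r v cs
    pure (if res.1 then (v, [v]) :: res.2 else res.2))
  let Cs ← mapEach comps (fun uC => pure uC.2)
  pure (S₁, Cs)

/-- `Reconstruct(V, S)` with threshold and sample size `m`, returning `K̂_V` as a sparse matrix. The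
first argument only cuts off executions that recurse more deeply than it allows: they return `none`;
all others are not affected by it. -/
def reconstruct (m : ℕ) : ℕ → List (Fin n) → List (Fin n) → Prog n R (Option (Sparse n R))
  | 0, _, _ => pure none
  | depth + 1, V, S => do
      let v ← size V
      step
      if v ≤ m then
        let D ← condCov S V V
        let I ← identity v
        let K ← rightDivide I D
        let T ← entries V V K
        pure (some T)
      else
        let res ← components m V S
        let S₁ := res.1
        let SS ← append S₁ S
        let s ← size S₁
        let D ← condCov S S₁ S₁
        let I ← identity s
        let fin ← forEach res.2 (some (([] : Sparse n R), I)) (fun st C =>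
          match st with
          | none => pure none
          | some Tacc => do
              let KC ← reconstruct m depth C SS
              match KC with
              | none => pure none
              | some TC => do
                  let M ← condCov S C S₁
                  let P ← sparseMul TC C M s
                  let NP ← negate P
                  let Q ← rightDivide NP D
                  let TQ ← entriesSymm C S₁ Q
                  let acc ← subTransposeMul Tacc.2 Q M
                  let T₁ ← append TQ Tacc.1
                  let T₂ ← append TC T₁
                  pure (some (T₂, acc)))
        match fin with
        | none => pure none
        | some Tacc => do
            let KS ← rightDivide Tacc.2 D
            let TS ← entries S₁ S₁ KS
            let T ← append TS Tacc.1
            pure (some T)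

end Algorithms

/-- The matrix that a sparse matrix represents. -/
def toMatrix {n : ℕ} (T : Sparse n ℝ) : Matrix (Fin n) (Fin n) ℝ :=
  fun i j => (T.map (fun e => if e.1 = i ∧ e.2.1 = j then e.2.2 else 0)).sum

/-- The distribution of the outcome of `Reconstruct([n], ∅)` on the covariance matrix `Cov`. -/
noncomputable def runReconstruct {n : ℕ} (Cov : Matrix (Fin n) (Fin n) ℝ) (m depth : ℕ) :
    PMF (Outcome (Option (Sparse n ℝ))) :=
  run Cov (reconstruct m depth (List.finRange n) [])

/-- `(2^{C k log k} + d k log n) k² n log³ n`, with `C` also as a factor. -/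
noncomputable def queryBound (C : ℝ) (n k d : ℕ) : ℝ :=
  C * (((2 : ℝ) ^ (C * (k * Real.log k)) + d * k * Real.log n) * (k : ℝ) ^ 2 * n
    * Real.log n ^ 3)

/-- `(2^{C k log k} + d k log n) k³ n log⁴ n`, with `C` also as a factor. -/
noncomputable def timeBound (C : ℝ) (n k d : ℕ) : ℝ :=
  C * (((2 : ℝ) ^ (C * (k * Real.log k)) + d * k * Real.log n) * (k : ℝ) ^ 3 * n
    * Real.log n ^ 4)

end CovarianceRecovery

/-!
The procedure only inverts and multiplies blocks of conditional covariance matrices. Elimination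
with pivots in `S` turns the covariance matrix into the inverse of the principal submatrix of the
concentration matrix `K` outside `S` (`InvOff.elim`). If `V` is a component of the graph without
`S`, then `K` has no nonzero entries between `V` and the other vertices outside `S`, so the
conditional covariance matrix of `V` is the inverse of the block of `K` at `V`
(`Concentration.sum_comp`). For the same reason the rows of `K` at a component `C` of `V` without
`S₁` are supported in `C` and `S₁`, apart from `S`, and each block is recovered by one right
division. Correctness of all halting executions follows by induction (`spec_reconstruct`), and the
same induction bounds the cost, in the form "depth times number of vertices times cost per vertex":
the components of a call are disjoint, and their number is at most `d * |S₁| + 1` because, unless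
there is only one, each of them has a neighbour in `S₁` (`IsComp.length_le`).

What the procedure needs to know about the graph, it learns from ranks, which by genericity are
sizes of minimum separators. A vertex set can be added to both sides without changing the rank if
and only if it extends to a minimum separator (`Generic.setRank_union_eq_iff`), so the greedy search
finds a minimum separator inside `V`, and two vertices are linked outside `S₁ ∪ S` if and only if
the rank with both of them added is `|S₁ ∪ S| + 1`. A tree decomposition has a bag that balances any
given sample (`TreeDecomposition.exists_balanced`), so the separators have at most `k + 1` vertices.

The depth of the recursion depends on how well a sample represents `V`. Suppose that a set `S₁` of
at most `κ` vertices separates the sides of a balanced bipartition of the sample, but leaves a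
component `C` with almost all vertices of `V`. One of the sides misses `C`, so a third of the sample
lies in the small set `V \ C`. Rather than bounding the VC dimension of these sets, a spanning tree
of `V` is cut into `O(κ)` bins, each held together by a center (`ParentTree.exists_pieces`). If `S₁`
avoids the centers, then `V \ C` is determined, up to the few bins that `S₁` hits, by these bins and
by the centers outside `C`; otherwise a center is removed and the argument repeated. This covers all
the sets `V \ C` by a family of `2 ^ O(κ log κ)` small sets (`exists_family`), and for `m` of the
required size a union bound with exponential moments shows that a third of the sample in one of them
is unlikely (`valueEv_sample_bad`). As the draws are made with replacement, samples with many
repetitions are excluded too, by Markov's inequality; hence a sample is good only with constant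
probability.

A good sample shrinks every component by the factor `199 / 200`, so the expectation of `∑ |V| ^ 2`
over the calls at a given depth decreases geometrically with the depth, and after `10000 log n`
levels the probability that a call is left is below `1 / n ^ 8` (`failProb_reconstruct`). Executions
that stay below that depth are unaffected by a larger bound on it (`lessDefined_reconstruct_of_le`).

Programs are analysed through two notions: `Spec` (a postcondition and worst-case costs of all
outcomes) and `ev` (the expectation of a function of the outcome).
-/

namespace CovarianceRecovery

/-! ### Semantics of programs -/

section Semantics

variable {n : ℕ} {α β : Type} {Cov : Matrix (Fin n) (Fin n) ℝ}

theorem charge_charge (o : Outcome α) (q t q' t' : ℕ) :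
    (o.charge q t).charge q' t' = o.charge (q + q') (t + t') := by
  simp [Outcome.charge, add_assoc]

namespace Prog

theorem bind_assoc' {γ : Type} (p : Prog n ℝ α) (f : α → Prog n ℝ β) (g : β → Prog n ℝ γ) :
    (p.bind f).bind g = p.bind fun a => (f a).bind g := by
  induction p with
  | pure a => rfl
  | tick p ih => simp only [Prog.bind, ih]
  | query i j p ih => simp only [Prog.bind, ih]
  | const c p ih => simp only [Prog.bind, ih]
  | arith op x y p ih => simp only [Prog.bind, ih]
  | isZero x p ih => simp only [Prog.bind, ih]
  | draw N p ih => simp only [Prog.bind, ih]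

theorem bind_def (p : Prog n ℝ α) (f : α → Prog n ℝ β) : p >>= f = p.bind f := rfl

theorem assoc {γ : Type} (p : Prog n ℝ α) (f : α → Prog n ℝ β) (g : β → Prog n ℝ γ) :
    (p >>= f) >>= g = p >>= fun a => f a >>= g := bind_assoc' p f g

end Prog

/-- Every possible outcome of `p` on the covariance matrix `Cov` has a value satisfying `Q`, uses at
most `q` queries and takes at most `t` steps. -/
def Spec (Cov : Matrix (Fin n) (Fin n) ℝ) (p : Prog n ℝ α) (Q : α → Prop) (q t : ℕ) : Prop :=
  ∀ o ∈ (run Cov p).support, Q o.value ∧ o.queries ≤ q ∧ o.time ≤ t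

theorem Spec.mono {p : Prog n ℝ α} {Q R : α → Prop} {q t q' t' : ℕ} (h : Spec Cov p Q q t)
    (hQ : ∀ a, Q a → R a) (hq : q ≤ q') (ht : t ≤ t') : Spec Cov p R q' t' := fun o ho =>
  ⟨hQ _ (h o ho).1, (h o ho).2.1.trans hq, (h o ho).2.2.trans ht⟩

theorem Spec.le {p : Prog n ℝ α} {Q : α → Prop} {q t q' t' : ℕ} (h : Spec Cov p Q q t)
    (hq : q ≤ q') (ht : t ≤ t') : Spec Cov p Q q' t' := h.mono (fun _ h => h) hq ht

theorem spec_pure {a : α} {Q : α → Prop} (h : Q a) : Spec Cov (pure a) Q 0 0 := by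
  intro o ho
  have : o = ⟨a, 0, 0⟩ := by
    change o ∈ (run Cov (Prog.pure a)).support at ho
    simpa [run] using ho
  subst this
  exact ⟨h, le_rfl, le_rfl⟩

theorem spec_pure_le {a : α} {Q : α → Prop} {q t : ℕ} (h : Q a) : Spec Cov (pure a) Q q t :=
  (spec_pure h).le q.zero_le t.zero_le

theorem spec_map_charge {P : PMF (Outcome α)} {Q : α → Prop} {q t a b : ℕ}
    (h : ∀ o ∈ P.support, Q o.value ∧ o.queries ≤ q ∧ o.time ≤ t) :
    ∀ o ∈ (P.map (Outcome.charge a b)).support,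
      Q o.value ∧ o.queries ≤ q + a ∧ o.time ≤ t + b := by
  intro o ho
  rw [PMF.mem_support_map_iff] at ho
  obtain ⟨o', ho', rfl⟩ := ho
  obtain ⟨h1, h2, h3⟩ := h o' ho'
  exact ⟨h1, Nat.add_le_add_right h2 a, Nat.add_le_add_right h3 b⟩

theorem spec_tick {p : Prog n ℝ α} {Q : α → Prop} {q t : ℕ} (h : Spec Cov p Q q t) :
    Spec Cov (.tick p) Q q (t + 1) := by
  intro o ho
  rw [run] at ho
  exact spec_map_charge h o ho

theorem spec_query {i j : Fin n} {p : ℝ → Prog n ℝ α} {Q : α → Prop} {q t : ℕ}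
    (h : Spec Cov (p (Cov i j)) Q q t) : Spec Cov (.query i j p) Q (q + 1) (t + 1) := by
  intro o ho
  rw [run] at ho
  exact spec_map_charge h o ho

theorem spec_const {c : ℤ} {p : ℝ → Prog n ℝ α} {Q : α → Prop} {q t : ℕ}
    (h : Spec Cov (p c) Q q t) : Spec Cov (.const c p) Q q (t + 1) := by
  intro o ho
  rw [run] at ho
  exact spec_map_charge h o ho

theorem spec_arith {op : Arith} {x y : ℝ} {p : ℝ → Prog n ℝ α} {Q : α → Prop} {q t : ℕ}
    (h : Spec Cov (p (op.eval x y)) Q q t) : Spec Cov (.arith op x y p) Q q (t + 1) := by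
  intro o ho
  rw [run] at ho
  exact spec_map_charge h o ho

open Classical in
theorem spec_isZero {x : ℝ} {p : Bool → Prog n ℝ α} {Q : α → Prop} {q t : ℕ}
    (h : Spec Cov (p (decide (x = 0))) Q q t) : Spec Cov (.isZero x p) Q q (t + 1) := by
  intro o ho
  rw [run] at ho
  exact spec_map_charge h o ho

theorem spec_draw {N : ℕ} {p : Fin (N + 1) → Prog n ℝ α} {Q : α → Prop} {q t : ℕ}
    (h : ∀ i, Spec Cov (p i) Q q t) : Spec Cov (.draw N p) Q q (t + 1) := by
  intro o ho
  rw [run, PMF.mem_support_bind_iff] at ho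
  obtain ⟨i, -, hi⟩ := ho
  exact spec_map_charge (h i) o hi

/-- The outcome distribution of a sequential composition. -/
theorem run_bind (p : Prog n ℝ α) (f : α → Prog n ℝ β) :
    run Cov (p >>= f) = (run Cov p).bind fun o =>
      (run Cov (f o.value)).map (Outcome.charge o.queries o.time) := by
  have key : ∀ (P : PMF (Outcome α)) (a b : ℕ),
      (P.bind fun o => (run Cov (f o.value)).map (Outcome.charge o.queries o.time)).map
        (Outcome.charge a b) = (P.map (Outcome.charge a b)).bind fun o =>
          (run Cov (f o.value)).map (Outcome.charge o.queries o.time) := by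
    intro P a b
    rw [PMF.map_bind, PMF.bind_map]
    congr 1
    funext o
    rw [PMF.map_comp]
    congr 1
    funext o'
    simp [Outcome.charge, add_assoc]
  rw [Prog.bind_def]
  induction p with
  | pure a =>
    have : (Outcome.charge 0 0 : Outcome β → Outcome β) = id := rfl
    simp [run, Prog.bind, this, PMF.map_id]
  | tick p ih => simp only [Prog.bind, run, ih, key]
  | query i j p ih => simp only [Prog.bind, run, ih, key]
  | const c p ih => simp only [Prog.bind, run, ih, key]
  | arith op x y p ih => simp only [Prog.bind, run, ih, key]
  | isZero x p ih => simp only [Prog.bind, run, ih, key]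
  | draw N p ih => simp only [Prog.bind, run, ih, key, PMF.bind_bind]

theorem spec_bind {p : Prog n ℝ α} {f : α → Prog n ℝ β} {Q : α → Prop} {R : β → Prop}
    {q₁ t₁ q₂ t₂ : ℕ} (hp : Spec Cov p Q q₁ t₁) (hf : ∀ a, Q a → Spec Cov (f a) R q₂ t₂) :
    Spec Cov (p >>= f) R (q₁ + q₂) (t₁ + t₂) := by
  intro o ho
  rw [run_bind, PMF.mem_support_bind_iff] at ho
  obtain ⟨o₁, h₁, ho⟩ := ho
  rw [PMF.mem_support_map_iff] at ho
  obtain ⟨o₂, h₂, rfl⟩ := ho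
  obtain ⟨a1, a2, a3⟩ := hp o₁ h₁
  obtain ⟨b1, b2, b3⟩ := hf _ a1 o₂ h₂
  refine ⟨b1, ?_, ?_⟩
  · change o₂.queries + o₁.queries ≤ _
    omega
  · change o₂.time + o₁.time ≤ _
    omega

/-- The expectation of `Φ` over the outcomes of a program. -/
noncomputable def ev (Cov : Matrix (Fin n) (Fin n) ℝ) : Prog n ℝ α → (Outcome α → ℝ) → ℝ
  | .pure a, Φ => Φ ⟨a, 0, 0⟩
  | .tick p, Φ => ev Cov p fun o => Φ (o.charge 0 1)
  | .query i j p, Φ => ev Cov (p (Cov i j)) fun o => Φ (o.charge 1 1)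
  | .const c p, Φ => ev Cov (p c) fun o => Φ (o.charge 0 1)
  | .arith op x y p, Φ => ev Cov (p (op.eval x y)) fun o => Φ (o.charge 0 1)
  | .isZero x p, Φ => open Classical in ev Cov (p (decide (x = 0))) fun o => Φ (o.charge 0 1)
  | .draw N p, Φ => (∑ i, ev Cov (p i) fun o => Φ (o.charge 0 1)) / ((N : ℝ) + 1)

theorem ev_bind (p : Prog n ℝ α) (f : α → Prog n ℝ β) (Φ : Outcome β → ℝ) :
    ev Cov (p >>= f) Φ = ev Cov p fun o =>
      ev Cov (f o.value) fun o' => Φ (o'.charge o.queries o.time) := by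
  rw [Prog.bind_def]
  induction p generalizing Φ with
  | pure a => rfl
  | tick p ih => simp only [Prog.bind, ev, ih, charge_charge]; rfl
  | query i j p ih => simp only [Prog.bind, ev, ih, charge_charge]; rfl
  | const c p ih => simp only [Prog.bind, ev, ih, charge_charge]; rfl
  | arith op x y p ih => simp only [Prog.bind, ev, ih, charge_charge]; rfl
  | isZero x p ih => simp only [Prog.bind, ev, ih, charge_charge]; rfl
  | draw N p ih => simp only [Prog.bind, ev, ih, charge_charge]; rfl

/-- For events, the expectation of the indicator is the probability. -/
theorem toOuterMeasure_run (p : Prog n ℝ α) (s : Set (Outcome α)) :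
    (run Cov p).toOuterMeasure s = ENNReal.ofReal (ev Cov p (s.indicator 1)) := by
  have key : ∀ (P : PMF (Outcome α)) (s : Set (Outcome α)) (a b : ℕ),
      (P.map (Outcome.charge a b)).toOuterMeasure s =
        P.toOuterMeasure {o | o.charge a b ∈ s} := by
    intro P s a b
    rw [PMF.toOuterMeasure_map_apply]
    rfl
  have ind : ∀ (s : Set (Outcome α)) (a b : ℕ),
      (fun o : Outcome α => s.indicator (1 : Outcome α → ℝ) (o.charge a b)) =
        Set.indicator {o | o.charge a b ∈ s} 1 := by
    intro s a b
    rfl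
  have nonneg : ∀ (p : Prog n ℝ α) (Φ : Outcome α → ℝ), (∀ o, 0 ≤ Φ o) → 0 ≤ ev Cov p Φ := by
    intro p
    induction p with
    | pure a => intro Φ h; exact h _
    | tick p ih => intro Φ h; exact ih _ fun o => h _
    | query i j p ih => intro Φ h; exact ih _ _ fun o => h _
    | const c p ih => intro Φ h; exact ih _ _ fun o => h _
    | arith op x y p ih => intro Φ h; exact ih _ _ fun o => h _
    | isZero x p ih => intro Φ h; exact ih _ _ fun o => h _
    | draw N p ih =>
      intro Φ h
      exact div_nonneg (Finset.sum_nonneg fun i _ => ih _ _ fun o => h _) (by positivity)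
  induction p generalizing s with
  | pure a =>
    simp only [run, ev, PMF.toOuterMeasure_pure_apply]
    by_cases h : (⟨a, 0, 0⟩ : Outcome α) ∈ s <;> simp [h]
  | tick p ih => simp only [run, ev, key, ih, ind]
  | query i j p ih => simp only [run, ev, key, ih, ind]
  | const c p ih => simp only [run, ev, key, ih, ind]
  | arith op x y p ih => simp only [run, ev, key, ih, ind]
  | isZero x p ih => simp only [run, ev, key, ih, ind]
  | draw N p ih =>
    have h0 : ∀ i, 0 ≤ ev Cov (p i) (Set.indicator {o | o.charge 0 1 ∈ s} 1) := fun i =>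
      nonneg _ _ fun o => Set.indicator_nonneg (fun _ _ => zero_le_one) _
    simp only [run, ev, ind, PMF.toOuterMeasure_bind_apply, key, ih, tsum_fintype,
      PMF.uniformOfFintype_apply, Fintype.card_fin]
    rw [div_eq_inv_mul, ENNReal.ofReal_mul (by positivity),
      ENNReal.ofReal_sum_of_nonneg fun i _ => h0 i, Finset.mul_sum,
      ENNReal.ofReal_inv_of_pos (by positivity)]
    congr 1
    funext i
    congr 2
    rw [ENNReal.ofReal_add (by positivity) zero_le_one]
    simp

/-- Only the outcomes that can occur matter for an expectation. -/
theorem ev_mono {p : Prog n ℝ α} {Q : α → Prop} {q t : ℕ} (h : Spec Cov p Q q t)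
    {Φ Ψ : Outcome α → ℝ} (hΦ : ∀ o, Q o.value → o.queries ≤ q → o.time ≤ t → Φ o ≤ Ψ o) :
    ev Cov p Φ ≤ ev Cov p Ψ := by
  have key : ∀ (p : Prog n ℝ α) (Φ Ψ : Outcome α → ℝ),
      (∀ o ∈ (run Cov p).support, Φ o ≤ Ψ o) → ev Cov p Φ ≤ ev Cov p Ψ := by
    intro p
    have aux : ∀ {P : PMF (Outcome α)} {a b : ℕ} {Φ Ψ : Outcome α → ℝ},
        (∀ o ∈ (P.map (Outcome.charge a b)).support, Φ o ≤ Ψ o) →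
          ∀ o ∈ P.support, Φ (o.charge a b) ≤ Ψ (o.charge a b) := fun h o ho =>
      h _ ((PMF.mem_support_map_iff _ _ _).2 ⟨o, ho, rfl⟩)
    induction p with
    | pure a => intro Φ Ψ h; exact h _ (by simp [run])
    | tick p ih => intro Φ Ψ h; rw [run] at h; exact ih _ _ (aux h)
    | query i j p ih => intro Φ Ψ h; rw [run] at h; exact ih _ _ _ (aux h)
    | const c p ih => intro Φ Ψ h; rw [run] at h; exact ih _ _ _ (aux h)
    | arith op x y p ih => intro Φ Ψ h; rw [run] at h; exact ih _ _ _ (aux h)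
    | isZero x p ih => intro Φ Ψ h; rw [run] at h; exact ih _ _ _ (aux h)
    | draw N p ih =>
      intro Φ Ψ h
      simp only [ev]
      refine div_le_div_of_nonneg_right (Finset.sum_le_sum fun i _ => ih _ _ _ ?_) (by positivity)
      refine aux fun o ho => h o ?_
      rw [run, PMF.mem_support_bind_iff]
      exact ⟨i, by simp, ho⟩
  exact key p Φ Ψ fun o ho => hΦ o (h o ho).1 (h o ho).2.1 (h o ho).2.2

theorem ev_le_ev (p : Prog n ℝ α) :
    ∀ Φ Ψ : Outcome α → ℝ, (∀ o, Φ o ≤ Ψ o) → ev Cov p Φ ≤ ev Cov p Ψ := by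
  induction p with
  | pure a => intro Φ Ψ h; exact h _
  | tick p ih => intro Φ Ψ h; exact ih _ _ fun o => h _
  | query i j p ih => intro Φ Ψ h; exact ih _ _ _ fun o => h _
  | const c p ih => intro Φ Ψ h; exact ih _ _ _ fun o => h _
  | arith op x y p ih => intro Φ Ψ h; exact ih _ _ _ fun o => h _
  | isZero x p ih => intro Φ Ψ h; exact ih _ _ _ fun o => h _
  | draw N p ih =>
    intro Φ Ψ h
    exact div_le_div_of_nonneg_right (Finset.sum_le_sum fun i _ => ih _ _ _ fun o => h _)
      (by positivity)

theorem ev_const (p : Prog n ℝ α) (c : ℝ) : ev Cov p (fun _ => c) = c := by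
  induction p with
  | pure a => rfl
  | draw N p ih =>
    simp only [ev, ih, Finset.sum_const, Finset.card_univ, Fintype.card_fin, nsmul_eq_mul]
    field_simp
    push_cast
    ring
  | isZero x p ih => simp only [ev, ih]
  | _ => simp_all [ev]

theorem ev_add (p : Prog n ℝ α) (Φ Ψ : Outcome α → ℝ) :
    ev Cov p (fun o => Φ o + Ψ o) = ev Cov p Φ + ev Cov p Ψ := by
  induction p generalizing Φ Ψ with
  | pure a => rfl
  | draw N p ih => simp only [ev, ih, Finset.sum_add_distrib, add_div]
  | isZero x p ih => simp only [ev, ih]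
  | _ => simp_all [ev]

theorem ev_mul (p : Prog n ℝ α) (c : ℝ) (Φ : Outcome α → ℝ) :
    ev Cov p (fun o => c * Φ o) = c * ev Cov p Φ := by
  induction p generalizing Φ with
  | pure a => rfl
  | draw N p ih => simp only [ev, ih, ← Finset.mul_sum, mul_div_assoc]
  | isZero x p ih => simp only [ev, ih]
  | _ => simp_all [ev]

theorem ev_sum {ι : Type*} (p : Prog n ℝ α) (s : Finset ι) (Φ : ι → Outcome α → ℝ) :
    ev Cov p (fun o => ∑ i ∈ s, Φ i o) = ∑ i ∈ s, ev Cov p (Φ i) := by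
  classical
  induction s using Finset.induction_on with
  | empty => simpa using ev_const p 0
  | insert a s ha ih => simp only [Finset.sum_insert ha, ev_add, ih]

end Semantics

/-! ### Loops and lists -/

section Loops

variable {n : ℕ} {α β γ : Type} {Cov : Matrix (Fin n) (Fin n) ℝ}

theorem spec_step_bind {p : Unit → Prog n ℝ β} {Q : β → Prop} {q t : ℕ}
    (h : Spec Cov (p ()) Q q t) : Spec Cov (step >>= p) Q q (t + 1) := spec_tick h

theorem spec_ask (i j : Fin n) : Spec Cov (ask i j) (· = Cov i j) 1 1 :=
  spec_query (spec_pure (Cov := Cov) rfl)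

theorem spec_constant (c : ℤ) : Spec Cov (constant c) (· = (c : ℝ)) 0 1 :=
  spec_const (spec_pure (Cov := Cov) rfl)

theorem spec_arithOp (op : Arith) (x y : ℝ) : Spec Cov (arith op x y) (· = op.eval x y) 0 1 :=
  spec_arith (spec_pure (Cov := Cov) rfl)

open Classical in
theorem spec_testZero (x : ℝ) : Spec Cov (testZero x) (· = decide (x = 0)) 0 1 :=
  spec_isZero (spec_pure (Cov := Cov) rfl)

/-- A loop whose invariant `I` may mention the list of the entries processed so far. -/
theorem spec_forEach {L : List α} {b : β} {f : β → α → Prog n ℝ β} (I : List α → β → Prop)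
    (q t : α → ℕ) (h0 : I [] b)
    (h : ∀ done a rest b, L = done ++ a :: rest → I done b →
      Spec Cov (f b a) (I (done ++ [a])) (q a) (t a)) :
    Spec Cov (forEach L b f) (I L) (L.map q).sum ((L.map t).sum + L.length) := by
  have key : ∀ (rest done : List α) (b : β), L = done ++ rest → I done b →
      Spec Cov (forEach rest b f) (I L) (rest.map q).sum ((rest.map t).sum + rest.length) := by
    intro rest
    induction rest with
    | nil =>
      intro done b hL hI
      rw [List.append_nil] at hL
      subst hL
      exact spec_pure hI
    | cons a as ih =>
      intro done b hL hI
      have h1 := h done a as b hL hI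
      refine Spec.le (spec_step_bind (spec_bind h1 fun c hc =>
        ih (done ++ [a]) c (by simpa using hL) hc)) ?_ ?_
      · simp
      · simp; omega
  exact key L [] b rfl h0

theorem spec_forEach_uniform {L : List α} {b : β} {f : β → α → Prog n ℝ β}
    (I : List α → β → Prop) (q t : ℕ) (h0 : I [] b)
    (h : ∀ done a rest b, L = done ++ a :: rest → I done b →
      Spec Cov (f b a) (I (done ++ [a])) q t) :
    Spec Cov (forEach L b f) (I L) (L.length * q) (L.length * (t + 1)) :=
  (spec_forEach I (fun _ => q) (fun _ => t) h0 h).le (by simp) (by simp [mul_add])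

theorem spec_mapEach {L : List α} {f : α → Prog n ℝ β} (g : α → β) (q t : ℕ)
    (h : ∀ a ∈ L, Spec Cov (f a) (· = g a) q t) :
    Spec Cov (mapEach L f) (· = L.map g) (L.length * q) (L.length * (t + 1)) := by
  induction L with
  | nil => exact spec_pure_le rfl
  | cons a L ih =>
    refine Spec.le (spec_step_bind (spec_bind (h a (by simp)) fun b hb => spec_bind
      (ih fun a ha => h a (by simp [ha])) fun bs hbs => spec_pure ?_)) ?_ ?_
    · subst hb hbs; rfl
    · simp; ring_nf; omega
    · simp; ring_nf; omega

theorem spec_zipEach {L : List α} {M : List β} {f : α → β → Prog n ℝ γ} (g : α → β → γ) (t : ℕ)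
    (h : ∀ a ∈ L, ∀ b ∈ M, Spec Cov (f a b) (· = g a b) 0 t) :
    Spec Cov (zipEach L M f) (· = List.zipWith g L M) 0 (M.length * (t + 1)) := by
  induction L generalizing M with
  | nil => exact spec_pure_le (by simp)
  | cons a L ih =>
    cases M with
    | nil => exact spec_pure_le (by simp)
    | cons b M =>
      refine Spec.le (spec_step_bind (spec_bind (h a (by simp) b (by simp)) fun c hc => spec_bind
        (ih fun a ha b hb => h a (by simp [ha]) b (by simp [hb])) fun bs hbs =>
          spec_pure ?_)) ?_ ?_
      · subst hc hbs; rfl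
      · simp
      · simp; ring_nf; omega

theorem spec_filterEach {L : List α} {f : α → Prog n ℝ Bool} (g : α → Bool) (q t : ℕ)
    (h : ∀ a ∈ L, Spec Cov (f a) (· = g a) q t) :
    Spec Cov (filterEach L f) (· = L.filter g) (L.length * q) (L.length * (t + 1)) := by
  induction L with
  | nil => exact spec_pure_le rfl
  | cons a L ih =>
    refine Spec.le (spec_step_bind (spec_bind (h a (by simp)) fun b hb => spec_bind
      (ih fun a ha => h a (by simp [ha])) fun bs hbs => spec_pure ?_)) ?_ ?_
    · subst hb hbs; simp [List.filter_cons]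
    · simp; ring_nf; omega
    · simp; ring_nf; omega

theorem spec_size (L : List α) : Spec Cov (size L) (· = L.length) 0 L.length := by
  have := spec_forEach_uniform (Cov := Cov) (L := L) (b := 0) (f := fun c _ => pure (c + 1))
    (fun done c => c = done.length) 0 0 rfl (fun done a rest b _ hb => spec_pure (by simp [hb]))
  exact this.le (by simp) (by simp)

theorem spec_append (L M : List α) : Spec Cov (append L M) (· = L ++ M) 0 L.length := by
  induction L with
  | nil => exact spec_pure rfl
  | cons a L ih =>
    refine Spec.le (spec_step_bind (spec_bind ih fun bs hbs => spec_pure ?_)) ?_ ?_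
    · subst hbs; rfl
    · simp
    · simp

theorem spec_member (v : Fin n) (L : List (Fin n)) :
    Spec Cov (member v L) (· = decide (v ∈ L)) 0 L.length := by
  have := spec_forEach_uniform (Cov := Cov) (L := L) (b := false)
    (f := fun b u => pure (b || decide (u = v)))
    (fun done b => b = decide (v ∈ done)) 0 0 (by simp) (fun done a rest b _ hb => spec_pure (by
      subst hb; by_cases h : v ∈ done <;> simp [h, eq_comm]))
  exact this.le (by simp) (by simp)

/-- The list of rows of the matrix `F` with rows listed by `A` and columns listed by `B`. -/
def rowsOf {ρ κ : Type} (F : ρ → κ → ℝ) (A : List ρ) (B : List κ) : List (List ℝ) :=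
  A.map fun i => B.map (F i)

theorem spec_covMatrix (A B : List (Fin n)) :
    Spec Cov (covMatrix A B) (· = rowsOf Cov A B) (A.length * B.length)
      (A.length * (2 * B.length + 1)) :=
  (spec_mapEach (fun i => B.map (Cov i)) (B.length * 1) (B.length * (1 + 1))
    (fun i _ => spec_mapEach (Cov i) 1 1 fun j _ => spec_ask i j)).le (by simp)
      (by rw [mul_comm 2])

/-! ### Rank by Gaussian elimination -/

/-- The row that `eliminate` computes. -/
noncomputable def elimRow (p : ℝ) (ps : List ℝ) : List ℝ → List ℝ
  | [] => []
  | x :: xs => List.zipWith (fun y q => y - x / p * q) xs ps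

theorem spec_eliminate (p : ℝ) (ps row : List ℝ) :
    Spec Cov (eliminate p ps row) (· = elimRow p ps row) 0 (3 * ps.length + 1) := by
  cases row with
  | nil => exact spec_pure_le rfl
  | cons x xs =>
    refine Spec.le (spec_bind (spec_arithOp _ _ _) fun c hc =>
      spec_zipEach (M := ps) (fun y q => y - x / p * q) 2 fun y _ q _ =>
        spec_bind (spec_arithOp _ _ _) fun s hs => (spec_arithOp _ _ _).mono ?_ le_rfl le_rfl)
        (by simp) (by omega)
    subst hc hs
    rintro _ rfl
    rfl

/-- The vector of length `c` whose coordinates are the entries of a list. -/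
def toVec (c : ℕ) (row : List ℝ) : Fin c → ℝ := fun i => row.getD i 0

/-- The dimension of the span of a list of rows. -/
noncomputable def rowRank (c : ℕ) (rows : List (List ℝ)) : ℕ :=
  Module.finrank ℝ (Submodule.span ℝ {x | ∃ r ∈ rows, toVec c r = x})

/-- Either all rows start with zero, or a row with a nonzero head is split off. -/
theorem spec_findPivot {c : ℕ} (rows : List (List ℝ)) (hlen : ∀ r ∈ rows, r.length = c + 1) :
    Spec Cov (findPivot rows) (fun res =>
      (res.1 = none ∧ res.2 = rows ∧ ∀ r ∈ rows, ∃ xs, r = 0 :: xs) ∨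
      ∃ x xs, x ≠ 0 ∧ res.1 = some (x, xs) ∧ ((x :: xs) :: res.2).Perm rows) 0
      (2 * rows.length) := by
  induction rows with
  | nil => exact spec_pure (Or.inl ⟨rfl, rfl, by simp⟩)
  | cons r rows ih =>
    have ih := ih fun r hr => hlen r (by simp [hr])
    cases r with
    | nil => simpa using hlen [] (by simp)
    | cons x xs =>
      refine Spec.le (spec_step_bind (spec_bind (spec_testZero x)
        (q₂ := 0) (t₂ := 2 * rows.length) fun z hz => ?_)) (by simp) (by simp; omega)
      subst hz
      by_cases hx : x = 0
      · subst hx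
        simp only [decide_true, if_true]
        refine Spec.le (spec_bind ih fun res hres => spec_pure ?_) (by simp) (by simp)
        rcases hres with ⟨h1, h2, h3⟩ | ⟨y, ys, hy, h1, h2⟩
        · exact Or.inl ⟨h1, by simp [h2], by simpa using h3⟩
        · refine Or.inr ⟨y, ys, hy, h1, ?_⟩
          exact (List.Perm.swap _ _ _).trans (h2.cons _)
      · simp only [hx, decide_false]
        exact spec_pure_le (Or.inr ⟨x, xs, hx, rfl, List.Perm.refl _⟩)

theorem toVec_cons (c : ℕ) (x : ℝ) (xs : List ℝ) :
    toVec (c + 1) (x :: xs) = Fin.cons x (toVec c xs) := by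
  funext i
  refine Fin.cases ?_ (fun j => ?_) i <;> simp [toVec]

/-- Prepending a zero, as a linear map. -/
def consZero (c : ℕ) : (Fin c → ℝ) →ₗ[ℝ] (Fin (c + 1) → ℝ) where
  toFun x := Fin.cons 0 x
  map_add' x y := by
    funext i; refine Fin.cases ?_ (fun j => ?_) i <;> simp
  map_smul' a x := by
    funext i; refine Fin.cases ?_ (fun j => ?_) i <;> simp

theorem consZero_injective (c : ℕ) : Function.Injective (consZero c) := fun _ _ h =>
  (Fin.cons_injective2 (α := fun _ => ℝ) h).2

theorem rowRank_of_head_zero (c : ℕ) (rows : List (List ℝ)) (h : ∀ r ∈ rows, ∃ xs, r = 0 :: xs) :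
    rowRank (c + 1) rows = rowRank c (rows.map List.tail) := by
  have : {x | ∃ r ∈ rows, toVec (c + 1) r = x} =
      consZero c '' {x | ∃ r ∈ rows.map List.tail, toVec c r = x} := by
    ext x
    constructor
    · rintro ⟨r, hr, rfl⟩
      obtain ⟨xs, rfl⟩ := h r hr
      exact ⟨toVec c xs, ⟨xs, List.mem_map.2 ⟨_, hr, rfl⟩, rfl⟩, (toVec_cons c 0 xs).symm⟩
    · rintro ⟨_, ⟨r, hr, rfl⟩, rfl⟩
      obtain ⟨r', hr', rfl⟩ := List.mem_map.1 hr
      obtain ⟨xs, rfl⟩ := h r' hr'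
      exact ⟨_, hr', toVec_cons c 0 xs⟩
  rw [rowRank, rowRank, this, Submodule.span_image]
  exact (Submodule.equivMapOfInjective _ (consZero_injective c) _).finrank_eq.symm

/-- A row is a multiple of the pivot row plus what elimination leaves of it. -/
theorem toVec_elimRow (c : ℕ) (p x : ℝ) (ps xs : List ℝ) (hp : p ≠ 0) (hps : ps.length = c)
    (hxs : xs.length = c) :
    toVec (c + 1) (x :: xs) = (x / p) • toVec (c + 1) (p :: ps) +
      consZero c (toVec c (elimRow p ps (x :: xs))) := by
  funext i
  refine Fin.cases ?_ (fun j => ?_) i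
  · simp [toVec, consZero]
    field_simp
  · have h1 : (j : ℕ) < xs.length := hxs ▸ j.2
    have h2 : (j : ℕ) < ps.length := hps ▸ j.2
    simp [toVec, consZero, elimRow, h1, h2]

/-- The pivot row and the eliminated rows span complementary subspaces. -/
theorem rowRank_elim (c : ℕ) (p : ℝ) (ps : List ℝ) (rows : List (List ℝ)) (hp : p ≠ 0)
    (hps : ps.length = c) (hlen : ∀ r ∈ rows, r.length = c + 1) :
    rowRank (c + 1) ((p :: ps) :: rows) = rowRank c (rows.map (elimRow p ps)) + 1 := by
  set W : Submodule ℝ (Fin c → ℝ) :=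
    Submodule.span ℝ {x | ∃ r ∈ rows.map (elimRow p ps), toVec c r = x} with hW
  set v := toVec (c + 1) (p :: ps) with hv
  have hv0 : v 0 = p := by simp [hv, toVec]
  have hspan : Submodule.span ℝ {x | ∃ r ∈ (p :: ps) :: rows, toVec (c + 1) r = x} =
      Submodule.span ℝ {v} ⊔ W.map (consZero c) := by
    have hvm : v ∈ Submodule.span ℝ {x | ∃ r ∈ (p :: ps) :: rows, toVec (c + 1) r = x} :=
      Submodule.subset_span ⟨p :: ps, by simp, rfl⟩
    apply le_antisymm
    · rw [Submodule.span_le]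
      rintro _ ⟨r, hr, rfl⟩
      rcases List.mem_cons.1 hr with rfl | hr
      · exact Submodule.mem_sup_left (Submodule.mem_span_singleton_self _)
      · obtain ⟨x, xs, rfl⟩ := List.exists_cons_of_length_eq_add_one (hlen r hr)
        have hx := hlen _ hr
        simp only [List.length_cons, add_left_inj] at hx
        rw [SetLike.mem_coe, toVec_elimRow c p x ps xs hp hps hx]
        refine Submodule.add_mem _ (Submodule.mem_sup_left (Submodule.smul_mem _ _
          (Submodule.mem_span_singleton_self _))) (Submodule.mem_sup_right ?_)
        exact Submodule.mem_map_of_mem (Submodule.subset_span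
          ⟨_, List.mem_map.2 ⟨_, hr, rfl⟩, rfl⟩)
    · rw [sup_le_iff, Submodule.span_singleton_le_iff_mem, hW, Submodule.map_span,
        Submodule.span_le]
      refine ⟨hvm, ?_⟩
      rintro _ ⟨_, ⟨r, hr, rfl⟩, rfl⟩
      obtain ⟨r', hr', rfl⟩ := List.mem_map.1 hr
      obtain ⟨x, xs, rfl⟩ := List.exists_cons_of_length_eq_add_one (hlen r' hr')
      have hx := hlen _ hr'
      simp only [List.length_cons, add_left_inj] at hx
      have := toVec_elimRow c p x ps xs hp hps hx
      rw [SetLike.mem_coe, ← sub_eq_iff_eq_add'.2 this]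
      exact Submodule.sub_mem _ (Submodule.subset_span ⟨_, by simp [hr'], rfl⟩)
        (Submodule.smul_mem _ _ hvm)
  have hdisj : Disjoint (Submodule.span ℝ {v}) (W.map (consZero c)) := by
    rw [Submodule.disjoint_def]
    intro x hx hx'
    obtain ⟨a, rfl⟩ := Submodule.mem_span_singleton.1 hx
    obtain ⟨y, -, hy⟩ := Submodule.mem_map.1 hx'
    have h0 : (a • v) 0 = 0 := by rw [← hy]; rfl
    have ha : a = 0 := by
      simpa [hv0, hp] using h0
    simp [ha]
  have h1 := Submodule.finrank_sup_add_finrank_inf_eq (Submodule.span ℝ {v}) (W.map (consZero c))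
  rw [hdisj.eq_bot, finrank_bot, add_zero, finrank_span_singleton (by
    intro h; apply hp; rw [← hv0, h]; rfl),
    ← (Submodule.equivMapOfInjective _ (consZero_injective c) W).finrank_eq] at h1
  rw [rowRank, hspan, h1, rowRank, add_comm]

theorem rowRank_perm (c : ℕ) {rows rows' : List (List ℝ)} (h : rows.Perm rows') :
    rowRank c rows = rowRank c rows' := by
  have : {x | ∃ r ∈ rows, toVec c r = x} = {x | ∃ r ∈ rows', toVec c r = x} := by
    ext x
    simp only [Set.mem_ofPred_eq, h.mem_iff]
  rw [rowRank, this, rowRank]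

/-- Gaussian elimination computes the rank, in cubic time. -/
theorem spec_rankElim (c : ℕ) (rows : List (List ℝ)) (hlen : ∀ r ∈ rows, r.length = c) :
    Spec Cov (rankElim c rows) (· = rowRank c rows) 0
      (c * (1 + 4 * rows.length + 3 * c * rows.length)) := by
  induction c generalizing rows with
  | zero =>
    refine spec_pure_le ?_
    exact (Module.finrank_zero_of_subsingleton).symm
  | succ c ih =>
    set N := rows.length with hN
    have harith : 2 * N + (N * (3 * c + 2) + c * (1 + 4 * N + 3 * c * N)) + 1 ≤
        (c + 1) * (1 + 4 * N + 3 * (c + 1) * N) := by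
      ring_nf
      nlinarith [Nat.zero_le (c * N)]
    refine Spec.le (spec_step_bind (spec_bind (spec_findPivot rows hlen)
      (q₂ := 0) (t₂ := N * (3 * c + 2) + c * (1 + 4 * N + 3 * c * N)) fun res hres => ?_))
      (by simp) harith
    have ih' : ∀ rest : List (List ℝ), (∀ r ∈ rest, r.length = c) → rest.length ≤ N →
        Spec Cov (rankElim c rest) (· = rowRank c rest) 0 (c * (1 + 4 * N + 3 * c * N)) :=
      fun rest h1 h2 => (ih rest h1).le le_rfl (by gcongr)
    rcases hres with ⟨h1, h2, h3⟩ | ⟨x, xs, hx, h1, h2⟩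
    · rw [h1, h2]
      refine Spec.le (spec_bind (spec_mapEach (L := rows) List.tail 0 0 fun row _ =>
        spec_pure rfl) fun rest hrest => (ih' rest ?_ ?_).mono ?_ le_rfl le_rfl) (by simp) ?_
      · subst hrest
        intro r hr
        obtain ⟨r', hr', rfl⟩ := List.mem_map.1 hr
        simp [hlen r' hr']
      · simp [hrest, hN]
      · subst hrest
        rintro _ rfl
        exact (rowRank_of_head_zero c rows h3).symm
      · rw [← hN]
        gcongr
        · omega
        · omega
    · rw [h1]
      have hl := h2.length_eq
      have hxs : (x :: xs).length = c + 1 := hlen _ (h2.subset (by simp))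
      have hl2 : ∀ r ∈ res.2, r.length = c + 1 := fun r hr => hlen _ (h2.subset (by simp [hr]))
      simp only [List.length_cons, add_left_inj] at hxs hl
      refine Spec.le (spec_bind (spec_mapEach (L := res.2) (elimRow x xs) 0 (3 * xs.length + 1)
        fun row _ => spec_eliminate _ _ _) fun rest hrest => spec_bind
          (ih' rest ?_ ?_) fun r hr => spec_pure ?_) (by simp) ?_
      · subst hrest
        intro r hr
        obtain ⟨r', hr', rfl⟩ := List.mem_map.1 hr
        obtain ⟨y, ys, rfl⟩ := List.exists_cons_of_length_eq_add_one (hl2 r' hr')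
        have := hl2 _ hr'
        simp only [List.length_cons, add_left_inj] at this
        simp [elimRow, this, hxs]
      · simp [hrest]; omega
      · subst hrest
        rw [hr, ← rowRank_perm _ h2, rowRank_elim c x xs res.2 hx hxs hl2]
      · rw [hxs, add_zero]
        gcongr
        omega

end Loops

/-! ### Ranks of submatrices of the covariance matrix -/

section Rank

variable {n : ℕ} {Cov : Matrix (Fin n) (Fin n) ℝ}

/-- The rank of the submatrix with rows `A` and columns `B`. -/
noncomputable def setRank (Cov : Matrix (Fin n) (Fin n) ℝ) (A B : Finset (Fin n)) : ℕ :=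
  (Cov.submatrix (fun i : A => (i : Fin n)) (fun j : B => (j : Fin n))).rank

/-- Repeating or permuting rows and columns does not change the rank. -/
theorem rank_submatrix_of_surjective {ρ κ ρ' κ' : Type} [Fintype κ] [Fintype κ'] [Fintype ρ]
    [Fintype ρ'] (M : Matrix ρ κ ℝ) {f : ρ' → ρ} {g : κ' → κ} (hf : Function.Surjective f)
    (hg : Function.Surjective g) : (M.submatrix f g).rank = M.rank := by
  have cols : ∀ {ρ κ κ' : Type} [Fintype κ] [Fintype κ'] (M : Matrix ρ κ ℝ) {g : κ' → κ},
      Function.Surjective g → (M.submatrix id g).rank = M.rank := by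
    intro ρ κ κ' _ _ M g hg
    rw [Matrix.rank_eq_finrank_span_cols, Matrix.rank_eq_finrank_span_cols]
    have : Set.range (M.submatrix id g).col = Set.range M.col := by
      have h : (M.submatrix id g).col = M.col ∘ g := rfl
      rw [h, hg.range_comp]
    rw [this]
  calc (M.submatrix f g).rank = ((M.submatrix f id).submatrix id g).rank := rfl
    _ = (M.submatrix f id).rank := cols _ hg
    _ = ((M.submatrix f id).transpose).rank := (Matrix.rank_transpose _).symm
    _ = (M.transpose.submatrix id f).rank := rfl
    _ = M.transpose.rank := cols _ hf
    _ = M.rank := Matrix.rank_transpose _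

theorem rowRank_rowsOf (A B : List (Fin n)) :
    rowRank B.length (rowsOf Cov A B) = setRank Cov A.toFinset B.toFinset := by
  have hf : Function.Surjective (fun i : Fin A.length =>
      (⟨A.get i, by simp⟩ : A.toFinset)) := by
    rintro ⟨a, ha⟩
    obtain ⟨i, hi⟩ := List.mem_iff_get.1 (List.mem_toFinset.1 ha)
    exact ⟨i, Subtype.ext hi⟩
  have hg : Function.Surjective (fun i : Fin B.length =>
      (⟨B.get i, by simp⟩ : B.toFinset)) := by
    rintro ⟨a, ha⟩
    obtain ⟨i, hi⟩ := List.mem_iff_get.1 (List.mem_toFinset.1 ha)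
    exact ⟨i, Subtype.ext hi⟩
  have hset : {x | ∃ r ∈ rowsOf Cov A B, toVec B.length r = x} = Set.range
      ((Cov.submatrix (fun i : A.toFinset => (i : Fin n)) fun j : B.toFinset => (j : Fin n)).submatrix
        (fun i : Fin A.length => (⟨A.get i, by simp⟩ : A.toFinset))
        (fun i : Fin B.length => (⟨B.get i, by simp⟩ : B.toFinset))).row := by
    ext x
    constructor
    · rintro ⟨r, hr, rfl⟩
      obtain ⟨a, ha, rfl⟩ := List.mem_map.1 hr
      obtain ⟨i, rfl⟩ := List.mem_iff_get.1 ha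
      refine ⟨i, ?_⟩
      funext j
      simp [toVec, Matrix.row]
    · rintro ⟨i, rfl⟩
      refine ⟨_, List.mem_map.2 ⟨A.get i, List.get_mem _ _, rfl⟩, ?_⟩
      funext j
      simp [toVec, Matrix.row]
  rw [setRank, ← rank_submatrix_of_surjective _ hf hg, Matrix.rank_eq_finrank_span_row, rowRank,
    hset]

theorem spec_covRank (A B : List (Fin n)) {s : ℕ} (hs : 1 ≤ s) (hA : A.length ≤ s)
    (hB : B.length ≤ s) :
    Spec Cov (covRank A B) (· = setRank Cov A.toFinset B.toFinset) (s ^ 2) (12 * s ^ 3) := by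
  refine Spec.le (spec_bind (spec_covMatrix A B) fun M hM => spec_bind (spec_size B)
    (t₂ := B.length * (1 + 4 * A.length + 3 * B.length * A.length)) fun c hc =>
      Spec.mono (spec_rankElim c M ?_) ?_ le_rfl ?_) ?_ ?_
  · subst hM hc
    intro r hr
    obtain ⟨a, ha, rfl⟩ := List.mem_map.1 hr
    simp
  · subst hM hc
    rintro _ rfl
    exact rowRank_rowsOf A B
  · subst hM hc
    simp [rowsOf]
  · nlinarith
  · have h1 : A.length * (2 * B.length + 1) ≤ s * (2 * s + 1) := by gcongr
    have h2 : B.length * (1 + 4 * A.length + 3 * B.length * A.length) ≤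
        s * (1 + 4 * s + 3 * s * s) := by gcongr
    have h3 : s ≤ s ^ 2 := by nlinarith
    have h4 : s ^ 2 ≤ s ^ 3 := by nlinarith
    nlinarith

end Rank

/-! ### Schur complements by elimination -/

section Elim

variable {n : ℕ} {ρ κ : Type} {Cov : Matrix (Fin n) (Fin n) ℝ}

/-- One elimination step with the pivot in row `s` and column `t`. -/
noncomputable def pivotStep (s : ρ) (t : κ) (F : ρ → κ → ℝ) : ρ → κ → ℝ :=
  fun i j => F i j - F i t / F s t * F s j

/-- Successive elimination with pivots in the rows and columns of the two lists. -/
noncomputable def elim : List ρ → List κ → (ρ → κ → ℝ) → ρ → κ → ℝ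
  | s :: S, t :: T, F => elim S T (pivotStep s t F)
  | _, _, F => F

/-- All the pivots that `elim` divides by are nonzero. -/
def Pivots : List ρ → List κ → (ρ → κ → ℝ) → Prop
  | s :: S, t :: T, F => F s t ≠ 0 ∧ Pivots S T (pivotStep s t F)
  | _, _, _ => True

theorem zipWith_map_map {α : Type} (g : ℝ → ℝ → ℝ) (a b : α → ℝ) (L : List α) :
    List.zipWith g (L.map a) (L.map b) = L.map fun x => g (a x) (b x) := by
  induction L <;> simp_all

/-- The list program `schur` performs the steps of `elim` on the rows and columns that are listed;
the pivots come first in both lists. -/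
theorem spec_schur (S : List ρ) (T : List κ) (hST : S.length = T.length) (A : List ρ)
    (B : List κ) (F : ρ → κ → ℝ) {x y : ℕ} (hx : S.length + A.length ≤ x)
    (hy : T.length + B.length ≤ y) :
    Spec Cov (schur S.length (rowsOf F (S ++ A) (T ++ B))) (· = rowsOf (elim S T F) A B) 0
      (S.length * (1 + x * (3 * y + 2))) := by
  induction S generalizing T F with
  | nil =>
    cases T with
    | nil => exact spec_pure_le rfl
    | cons t T => simp at hST
  | cons s S ih =>
    cases T with
    | nil => simp at hST
    | cons t T =>
      simp only [List.length_cons, add_left_inj] at hST hx hy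
      have hrow : rowsOf F (s :: S ++ A) (t :: T ++ B) =
          (F s t :: (T ++ B).map (F s)) :: rowsOf F (S ++ A) (t :: T ++ B) := rfl
      rw [hrow, List.length_cons, schur]
      refine Spec.le (spec_step_bind (spec_bind (q₂ := 0) (t₂ := S.length * (1 + x * (3 * y + 2)))
        (spec_mapEach
        (elimRow (F s t) ((T ++ B).map (F s))) 0 (3 * ((T ++ B).map (F s)).length + 1)
        fun row _ => spec_eliminate _ _ _) fun rest hrest => ?_))
        (by simp) ?_
      · have : rest = rowsOf (pivotStep s t F) (S ++ A) (T ++ B) := by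
          rw [hrest, rowsOf, rowsOf, List.map_map]
          refine List.map_congr_left fun i _ => ?_
          exact zipWith_map_map _ _ _ _
        rw [this]
        exact ih T hST _ (by omega) (by omega)
      · have h1 : (rowsOf F (S ++ A) (t :: T ++ B)).length ≤ x := by
          simp [rowsOf]; omega
        have h2 : ((T ++ B).map (F s)).length ≤ y := by simp; omega
        have : (rowsOf F (S ++ A) (t :: T ++ B)).length *
            (3 * ((T ++ B).map (F s)).length + 1 + 1) ≤ x * (3 * y + 2) :=
          Nat.mul_le_mul h1 (by omega)
        nlinarith

theorem pivots_map {ρ' κ' : Type} (f : ρ' → ρ) (g : κ' → κ) (S : List ρ') (T : List κ')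
    (F : ρ → κ → ℝ) (h : Pivots S T fun i j => F (f i) (g j)) :
    Pivots (S.map f) (T.map g) F := by
  induction S generalizing T F with
  | nil => trivial
  | cons s S ih =>
    cases T with
    | nil => trivial
    | cons t T => exact ⟨h.1, ih T _ h.2⟩

/-- A linear functional that vanishes on the pivot rows is preserved by elimination. -/
theorem elim_functional (φ : (κ → ℝ) →ₗ[ℝ] ℝ) (S : List ρ) (T : List κ) (F : ρ → κ → ℝ)
    (h : ∀ s ∈ S, φ (F s) = 0) (i : ρ) : φ (elim S T F i) = φ (F i) := by
  induction S generalizing T F with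
  | nil => rfl
  | cons s S ih =>
    cases T with
    | nil => rfl
    | cons t T =>
      have key : ∀ i, φ (pivotStep s t F i) = φ (F i) := by
        intro i
        have : pivotStep s t F i = F i - (F i t / F s t) • F s := by
          funext j; simp [pivotStep]
        rw [this, map_sub, map_smul, h s (by simp), smul_zero, sub_zero]
      rw [elim, ih, key]
      intro s' hs'
      rw [key, h s' (by simp [hs'])]

theorem elim_eq_zero_of_col (S : List ρ) (T : List κ) (F : ρ → κ → ℝ) (j : κ)
    (h : ∀ i, F i j = 0) (i : ρ) : elim S T F i j = 0 := by
  induction S generalizing T F with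
  | nil => exact h i
  | cons s S ih =>
    cases T with
    | nil => exact h i
    | cons t T => exact ih T _ fun i => by simp [pivotStep, h]

/-- Pivot columns are cleared. -/
theorem elim_pivot_col (S : List ρ) (T : List κ) (hST : S.length = T.length) (F : ρ → κ → ℝ)
    (hp : Pivots S T F) (j : κ) (hj : j ∈ T) (i : ρ) : elim S T F i j = 0 := by
  induction S generalizing T F with
  | nil =>
    cases T with
    | nil => simp at hj
    | cons t T => simp at hST
  | cons s S ih =>
    cases T with
    | nil => simp at hj
    | cons t T =>
      rcases List.mem_cons.1 hj with rfl | hj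
      · refine elim_eq_zero_of_col S T (pivotStep s j F) j (fun i => ?_) i
        have := hp.1
        simp [pivotStep]
        field_simp
        ring
      · exact ih T (by simpa using hST) _ hp.2 hj

/-- `F` is positive definite on the vectors supported in `R`. -/
def PosOn (R : Set (Fin n)) (F : Fin n → Fin n → ℝ) : Prop :=
  ∀ x : Fin n → ℝ, (∀ i ∉ R, x i = 0) → x ≠ 0 → 0 < ∑ i, ∑ j, x i * F i j * x j

theorem PosOn.diag_pos {R : Set (Fin n)} {F : Fin n → Fin n → ℝ} (h : PosOn R F) {s : Fin n}
    (hs : s ∈ R) : 0 < F s s := by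
  have := h (Pi.single s 1) (fun i hi => Pi.single_eq_of_ne (by rintro rfl; exact hi hs) _)
    (by simp)
  simpa [Pi.single_apply] using this

theorem PosOn.mono {R R' : Set (Fin n)} {F : Fin n → Fin n → ℝ} (h : PosOn R F) (hR : R' ⊆ R) :
    PosOn R' F := fun x hx => h x fun i hi => hx i fun h => hi (hR h)

theorem pivotStep_symm {F : Fin n → Fin n → ℝ} (hF : ∀ i j, F i j = F j i) (s i j : Fin n) :
    pivotStep s s F i j = pivotStep s s F j i := by
  simp only [pivotStep, hF i j, hF i s, hF s j]
  ring

/-- Completing the square: a Schur complement of a positive definite matrix is positive definite. -/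
theorem PosOn.pivotStep {R : Set (Fin n)} {F : Fin n → Fin n → ℝ} (h : PosOn R F)
    (hF : ∀ i j, F i j = F j i) {s : Fin n} (hs : s ∈ R) :
    PosOn (R \ {s}) (pivotStep s s F) := by
  intro x hx hx0
  have hd := h.diag_pos hs
  set b := ∑ j, F s j * x j with hb
  set y : Fin n → ℝ := x - (b / F s s) • Pi.single s 1 with hy
  have hxs : x s = 0 := hx s (by simp)
  have hy0 : y ≠ 0 := by
    intro hy0
    apply hx0
    funext i
    by_cases his : i = s
    · rw [his, hxs]; rfl
    · have := congrFun hy0 i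
      simpa [hy, his] using this
  have hyR : ∀ i ∉ R, y i = 0 := by
    intro i hi
    have his : i ≠ s := fun e => hi (e ▸ hs)
    simp [hy, his, hx i fun h => hi h.1]
  have e1 : ∑ i, ∑ j, y i * F i j * y j =
      ∑ i, ∑ j, x i * F i j * x j - b ^ 2 / F s s := by
    have hi : ∀ i, ∑ j, F i j * y j = (∑ j, F i j * x j) - b / F s s * F i s := by
      intro i
      simp only [hy, Pi.sub_apply, Pi.smul_apply, smul_eq_mul, mul_sub, Finset.sum_sub_distrib,
        Pi.single_apply]
      simp [mul_comm]
    have h2 : ∑ i, x i * F i s = b := by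
      rw [hb]
      exact Finset.sum_congr rfl fun i _ => by rw [hF i s, mul_comm]
    calc ∑ i, ∑ j, y i * F i j * y j = ∑ i, y i * ∑ j, F i j * y j := by
          simp only [Finset.mul_sum, mul_assoc]
      _ = ∑ i, (x i * ((∑ j, F i j * x j) - b / F s s * F i s) -
            b / F s s * (Pi.single s (1 : ℝ) : Fin n → ℝ) i *
              ((∑ j, F i j * x j) - b / F s s * F i s)) := by
          refine Finset.sum_congr rfl fun i _ => ?_
          rw [hi]
          simp only [hy, Pi.sub_apply, Pi.smul_apply, smul_eq_mul]
          ring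
      _ = ∑ i, x i * (∑ j, F i j * x j) - b / F s s * (∑ i, x i * F i s) -
            b / F s s * (b - b / F s s * F s s) := by
          rw [Finset.sum_sub_distrib]
          congr 1
          · simp only [mul_sub, Finset.sum_sub_distrib, Finset.mul_sum]
            congr 1
            exact Finset.sum_congr rfl fun i _ => by ring
          · simp [Pi.single_apply, hb]
      _ = _ := by
          rw [h2]
          simp only [Finset.mul_sum, mul_assoc]
          field_simp
          ring
  have e2 : ∑ i, ∑ j, x i * CovarianceRecovery.pivotStep s s F i j * x j =
      ∑ i, ∑ j, x i * F i j * x j - b ^ 2 / F s s := by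
    have h2 : ∑ i, x i * F i s = b := by
      rw [hb]
      exact Finset.sum_congr rfl fun i _ => by rw [hF i s, mul_comm]
    have h3 : b ^ 2 / F s s = ∑ i, ∑ j, x i * (F i s / F s s * F s j) * x j := by
      rw [pow_two, div_eq_mul_inv]
      nth_rw 1 [← h2]
      rw [hb, Finset.sum_mul_sum, Finset.sum_mul]
      refine Finset.sum_congr rfl fun i _ => ?_
      rw [Finset.sum_mul]
      exact Finset.sum_congr rfl fun j _ => by rw [div_eq_mul_inv]; ring
    rw [h3, ← Finset.sum_sub_distrib]
    refine Finset.sum_congr rfl fun i _ => ?_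
    rw [← Finset.sum_sub_distrib]
    exact Finset.sum_congr rfl fun j _ => by simp only [CovarianceRecovery.pivotStep]; ring
  rw [e2, ← e1]
  exact h y hyR hy0

theorem PosOn.elim {R : Set (Fin n)} {F : Fin n → Fin n → ℝ} (h : PosOn R F)
    (hF : ∀ i j, F i j = F j i) (S : List (Fin n)) (hS : S.Nodup) (hSR : ∀ s ∈ S, s ∈ R) :
    Pivots S S F ∧ PosOn (R \ {s | s ∈ S}) (elim S S F) ∧
      ∀ i j, CovarianceRecovery.elim S S F i j = CovarianceRecovery.elim S S F j i := by
  induction S generalizing R F with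
  | nil => exact ⟨trivial, h.mono Set.sdiff_subset, hF⟩
  | cons s S ih =>
    have hs := hSR s (by simp)
    obtain ⟨hsS, hS⟩ := List.nodup_cons.1 hS
    obtain ⟨h1, h2, h3⟩ := ih (h.pivotStep hF hs) (pivotStep_symm hF s) hS fun s' hs' =>
      ⟨hSR s' (by simp [hs']), fun e => hsS (e ▸ hs')⟩
    refine ⟨⟨(h.diag_pos hs).ne', h1⟩, h2.mono ?_, h3⟩
    intro i hi
    have := hi.2
    simp only [List.mem_cons, Set.mem_ofPred_eq, not_or] at this
    exact ⟨⟨hi.1, this.1⟩, this.2⟩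

/-- The matrix `D` is the inverse of the principal submatrix of `K` outside `S`, and vanishes
elsewhere. -/
structure InvOff (K : Fin n → Fin n → ℝ) (S : Set (Fin n)) (D : Fin n → Fin n → ℝ) : Prop where
  symm : ∀ i j, D i j = D j i
  zero : ∀ i ∈ S, ∀ j, D i j = 0
  mul : ∀ i ∉ S, ∀ j ∉ S, ∑ u, K i u * D u j = if i = j then 1 else 0

theorem InvOff.pivotStep {K D : Fin n → Fin n → ℝ} {S : Set (Fin n)} (h : InvOff K S D)
    {s : Fin n} (hs : s ∉ S) (hd : D s s ≠ 0) : InvOff K (insert s S) (pivotStep s s D) := by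
  refine ⟨pivotStep_symm h.symm s, ?_, ?_⟩
  · intro i hi j
    rcases Set.mem_insert_iff.1 hi with rfl | hi
    · simp only [CovarianceRecovery.pivotStep]
      field_simp
      ring
    · simp [CovarianceRecovery.pivotStep, h.zero i hi]
  · intro i hi j hj
    simp only [Set.mem_insert_iff, not_or] at hi hj
    have h1 := h.mul i hi.2 j hj.2
    have h2 := h.mul i hi.2 s hs
    rw [if_neg hi.1] at h2
    rw [← h1]
    have : ∑ u, K i u * CovarianceRecovery.pivotStep s s D u j =
        ∑ u, K i u * D u j - (∑ u, K i u * D u s) * (D s j / D s s) := by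
      rw [Finset.sum_mul, ← Finset.sum_sub_distrib]
      exact Finset.sum_congr rfl fun u _ => by
        simp only [CovarianceRecovery.pivotStep]; ring
    rw [this, h2]
    ring

/-- Conditioning on `S` inverts the principal submatrix of `K` outside `S`. -/
theorem InvOff.elim {K D : Fin n → Fin n → ℝ} {S₀ : Set (Fin n)} (h : InvOff K S₀ D)
    (hpos : PosOn S₀ᶜ D) (S : List (Fin n)) (hS : S.Nodup) (hd : ∀ s ∈ S, s ∉ S₀) :
    InvOff K (S₀ ∪ {s | s ∈ S}) (elim S S D) := by
  induction S generalizing S₀ D with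
  | nil => simpa [CovarianceRecovery.elim] using h
  | cons s S ih =>
    obtain ⟨hsS, hS⟩ := List.nodup_cons.1 hS
    have hs : s ∉ S₀ := hd s (by simp)
    have h' := ih (h.pivotStep hs (hpos.diag_pos hs).ne') ((hpos.pivotStep h.symm hs).mono (by
      intro i hi
      simp only [Set.mem_compl_iff, Set.mem_insert_iff, not_or] at hi
      exact ⟨hi.2, hi.1⟩)) hS (fun s' hs' => by
        rw [Set.mem_insert_iff, not_or]
        exact ⟨fun e => hsS (e ▸ hs'), hd s' (by simp [hs'])⟩)
    have e : S₀ ∪ {i | i ∈ s :: S} = insert s S₀ ∪ {i | i ∈ S} := by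
      ext i
      simp only [Set.mem_union, Set.mem_ofPred_eq, List.mem_cons, Set.mem_insert_iff]
      tauto
    rw [e]
    exact h'

/-- The conditional covariance matrix given `S` is what elimination with the pivots in `S` leaves of
`Cov`. -/
theorem spec_condCov (S A B : List (Fin n)) {x y : ℕ} (hx : S.length + A.length ≤ x)
    (hy : S.length + B.length ≤ y) :
    Spec Cov (condCov S A B) (· = rowsOf (elim S S Cov) A B) (x * y)
      (5 * ((S.length + 1) * (x + 1) * (y + 1))) := by
  refine Spec.le (spec_bind (spec_append S A) fun SA hSA => spec_bind (spec_append S B)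
    fun SB hSB => spec_bind (q₁ := x * y) (t₁ := x * (2 * y + 1)) ((spec_covMatrix SA SB).mono
      (fun _ h => h) ?_ ?_) fun M hM => spec_bind (spec_size S)
        (q₂ := 0) (t₂ := S.length * (1 + x * (3 * y + 2))) fun c hc => ?_) ?_ ?_
  · subst hSA hSB
    simp only [List.length_append]
    gcongr
  · subst hSA hSB
    simp only [List.length_append]
    gcongr
  · subst hSA hSB hM hc
    exact spec_schur S S rfl A B _ hx hy
  · simp
  · have : S.length ≤ x := by omega
    nlinarith [Nat.zero_le (S.length * x * y), Nat.zero_le (x * y),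
      Nat.zero_le (S.length * x), Nat.zero_le (S.length * y)]

end Elim

/-! ### Matrix programs -/

section MatrixPrograms

variable {n : ℕ} {ρ κ α β : Type} {Cov : Matrix (Fin n) (Fin n) ℝ}

theorem rowsOf_congr {F F' : ρ → κ → ℝ} {A : List ρ} {B : List κ}
    (h : ∀ i ∈ A, ∀ j ∈ B, F i j = F' i j) : rowsOf F A B = rowsOf F' A B :=
  List.map_congr_left fun i hi => List.map_congr_left fun j hj => h i hi j hj

theorem rowsOf_map {ρ' κ' : Type} (f : ρ' → ρ) (g : κ' → κ) (F : ρ → κ → ℝ) (A : List ρ')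
    (B : List κ') : rowsOf F (A.map f) (B.map g) = rowsOf (fun i j => F (f i) (g j)) A B := by
  simp [rowsOf, Function.comp_def]

theorem length_rowsOf (F : ρ → κ → ℝ) (A : List ρ) (B : List κ) :
    (rowsOf F A B).length = A.length := by simp [rowsOf]

theorem range_rowsOf_one (P : List (Fin n)) (hP : P.Nodup) :
    rowsOf (fun i j : ℕ => if i = j then (1 : ℝ) else 0) (List.range P.length)
      (List.range P.length) = rowsOf (fun i j => if i = j then 1 else 0) P P := by
  have hget : P = (List.finRange P.length).map P.get := by
    simp
  have hrange : List.range P.length = (List.finRange P.length).map Fin.val := by simp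
  conv_rhs => rw [hget]
  rw [hrange, rowsOf_map, rowsOf_map]
  refine rowsOf_congr fun i _ j _ => ?_
  simp only [hP.injective_get.eq_iff, Fin.val_inj]

theorem spec_identity (P : List (Fin n)) (hP : P.Nodup) :
    Spec Cov (identity P.length) (· = rowsOf (fun i j => if i = j then 1 else 0) P P) 0
      (P.length * (2 * P.length + 1)) := by
  refine Spec.mono (spec_mapEach (fun i => (List.range P.length).map fun j =>
    if i = j then (1 : ℝ) else 0) 0 (P.length * 2) fun i _ => ((spec_mapEach
      (fun j => if i = j then (1 : ℝ) else 0) 0 1 fun j _ => (spec_constant _).mono ?_ le_rfl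
        le_rfl).le (by simp) (by simp))) ?_ (by simp) ?_
  · rintro _ rfl
    split_ifs <;> simp
  · rintro _ rfl
    exact range_rowsOf_one P hP
  · simp; ring_nf; omega

theorem spec_zeros (P : List (Fin n)) :
    Spec Cov (zeros P.length) (· = P.map fun _ => (0 : ℝ)) 0 (2 * P.length) := by
  refine Spec.mono (spec_mapEach (fun _ => (0 : ℝ)) 0 1 fun i _ => (spec_constant _).mono ?_
    le_rfl le_rfl) ?_ (by simp) (by simp; omega)
  · rintro _ rfl
    simp
  · rintro _ rfl
    simp

theorem spec_negate (F : ρ → κ → ℝ) (A : List ρ) (B : List κ) :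
    Spec Cov (negate (rowsOf F A B)) (· = rowsOf (fun i j => -F i j) A B) 0
      (A.length * (3 * B.length + 1)) := by
  refine Spec.mono (spec_mapEach (fun row => row.map fun x => -x) 0 (B.length * 3)
    fun row hrow => ?_) ?_ (by simp) ?_
  · obtain ⟨i, -, rfl⟩ := List.mem_map.1 hrow
    refine Spec.le (spec_mapEach (fun x : ℝ => -x) 0 2 fun x _ => spec_bind
      (spec_constant _) fun z hz => (spec_arithOp _ _ _).mono ?_ le_rfl le_rfl) (by simp) (by simp)
    subst hz
    rintro _ rfl
    simp [Arith.eval]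
  · rintro _ rfl
    simp [rowsOf, Function.comp_def]
  · simp [rowsOf]; ring_nf; omega

/-- The block matrix with rows `[A, 1]` and `[-X, 0]`. -/
noncomputable def blockMatrix (A : Fin n → Fin n → ℝ) (X : ρ → Fin n → ℝ) :
    Fin n ⊕ ρ → Fin n ⊕ Fin n → ℝ
  | .inl i, .inl j => A i j
  | .inl i, .inr j => if i = j then 1 else 0
  | .inr a, .inl j => -X a j
  | .inr _, .inr _ => 0

/-- The quotient that `rightDivide` computes. -/
noncomputable def quotient (P : List (Fin n)) (A : Fin n → Fin n → ℝ) (X : ρ → Fin n → ℝ) :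
    ρ → Fin n → ℝ :=
  fun a j => elim (P.map (Sum.inl : Fin n → Fin n ⊕ ρ)) (P.map Sum.inl) (blockMatrix A X) (.inr a)
    (.inr j)

/-- For a row `r` of the block matrix, let `φ r` be its left part minus the product of its right
part with `A`. This functional vanishes on the rows `[A, 1]` and equals `-X` on the others;
elimination preserves it and clears the left part, so that the right part becomes `X A⁻¹`. -/
theorem quotient_mul {P : List (Fin n)} {A : Fin n → Fin n → ℝ}
    (X : ρ → Fin n → ℝ) (hA : Pivots P P A) (a : ρ) {j : Fin n} (hj : j ∈ P) :
    ∑ b ∈ P.toFinset, quotient P A X a b * A b j = X a j := by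
  let φ : (Fin n ⊕ Fin n → ℝ) →ₗ[ℝ] ℝ :=
    { toFun := fun r => r (.inl j) - ∑ b ∈ P.toFinset, r (.inr b) * A b j
      map_add' := fun r r' => by
        simp only [Pi.add_apply, add_mul, Finset.sum_add_distrib]; ring
      map_smul' := fun c r => by
        simp only [Pi.smul_apply, smul_eq_mul, RingHom.id_apply, mul_sub, Finset.mul_sum,
          mul_assoc] }
  have hφ : ∀ r, φ r = r (.inl j) - ∑ b ∈ P.toFinset, r (.inr b) * A b j := fun r => rfl
  have h1 := elim_functional φ (P.map (Sum.inl : Fin n → Fin n ⊕ ρ)) (P.map Sum.inl)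
    (blockMatrix A X) (by
    intro s hs
    obtain ⟨i, hi, rfl⟩ := List.mem_map.1 hs
    rw [hφ]
    simp [blockMatrix, hi]) (.inr a)
  have h2 := elim_pivot_col (P.map (Sum.inl : Fin n → Fin n ⊕ ρ))
    (P.map (Sum.inl : Fin n → Fin n ⊕ Fin n)) (by simp) (blockMatrix A X)
    (pivots_map _ _ _ _ _ hA) (.inl j) (List.mem_map_of_mem hj) (.inr a)
  rw [hφ, hφ, h2] at h1
  simp only [blockMatrix, zero_mul, Finset.sum_const_zero, sub_zero, zero_sub, neg_inj] at h1
  exact h1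

/-- Right division is elimination in the block matrix. -/
theorem spec_rightDivide {P : List (Fin n)} (hP : P.Nodup) (A : Fin n → Fin n → ℝ) (B : List ρ)
    (X : ρ → Fin n → ℝ) :
    Spec Cov (rightDivide (rowsOf X B P) (rowsOf A P P)) (· = rowsOf (quotient P A X) B P) 0
      (20 * ((P.length + 1) ^ 2 * (P.length + B.length + 1))) := by
  obtain ⟨s, hs⟩ : ∃ s, P.length = s := ⟨_, rfl⟩
  obtain ⟨b, hb⟩ : ∃ b, B.length = b := ⟨_, rfl⟩
  have hzip : List.zipWith (fun a e => a ++ e) (rowsOf A P P)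
      (rowsOf (fun i j => if i = j then 1 else 0) P P) =
        rowsOf (blockMatrix A X) (P.map Sum.inl) (P.map Sum.inl ++ P.map Sum.inr) := by
    have : ∀ L : List (Fin n), List.zipWith (fun a e => a ++ e) (rowsOf A L P)
        (rowsOf (fun i j => if i = j then 1 else 0) L P) =
          rowsOf (blockMatrix A X) (L.map Sum.inl) (P.map Sum.inl ++ P.map Sum.inr) := by
      intro L
      induction L with
      | nil => rfl
      | cons i L ih =>
        simp only [rowsOf, List.map_cons, List.zipWith_cons_cons] at ih ⊢
        rw [ih]
        congr 1
        simp [Function.comp_def, blockMatrix]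
    exact this P
  have hbot : (rowsOf (fun i j => -X i j) B P).map (fun y => y ++ P.map fun _ => (0 : ℝ)) =
      rowsOf (blockMatrix A X) (B.map Sum.inr) (P.map Sum.inl ++ P.map Sum.inr) := by
    simp [rowsOf, Function.comp_def, blockMatrix]
  have hsize := spec_size (Cov := Cov) (rowsOf A P P)
  rw [length_rowsOf] at hsize
  refine Spec.le (spec_bind hsize (q₂ := 0) (t₂ := s * (2 * s + 1) + (s * (s + 1) + (2 * s +
    (b * (3 * s + 1) + (b * (s + 1) + (s + s * (1 + (s + b) * (3 * (2 * s) + 2))))))))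
      fun c hc => ?_) (by simp) ?_
  · subst hc
    refine Spec.le (spec_bind (spec_identity P hP) (q₂ := 0) (t₂ := s * (s + 1) + (2 * s +
      (b * (3 * s + 1) + (b * (s + 1) + (s + s * (1 + (s + b) * (3 * (2 * s) + 2)))))))
        fun I hI => ?_) le_rfl (by rw [hs])
    refine Spec.le (spec_bind (spec_zipEach (M := I) (fun a e => a ++ e) s fun a ha e _ =>
      (spec_append a e).le le_rfl ?_) (q₂ := 0) (t₂ := 2 * s + (b * (3 * s + 1) + (b * (s + 1) +
        (s + s * (1 + (s + b) * (3 * (2 * s) + 2)))))) fun top htop => ?_) le_rfl ?_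
    · obtain ⟨i, -, rfl⟩ := List.mem_map.1 ha
      simp [hs]
    · refine Spec.le (spec_bind (spec_zeros P) (q₂ := 0) (t₂ := b * (3 * s + 1) + (b * (s + 1) +
        (s + s * (1 + (s + b) * (3 * (2 * s) + 2))))) fun z hz => ?_) le_rfl (by rw [hs])
      refine Spec.le (spec_bind (spec_negate X B P) (q₂ := 0) (t₂ := b * (s + 1) +
        (s + s * (1 + (s + b) * (3 * (2 * s) + 2)))) fun Y hY => ?_) le_rfl (by rw [hs, hb])
      refine Spec.le (spec_bind (spec_mapEach (fun y => y ++ z) 0 s fun y hy =>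
        (spec_append y z).le le_rfl ?_) (q₂ := 0)
          (t₂ := s + s * (1 + (s + b) * (3 * (2 * s) + 2))) fun bottom hbottom => ?_) ?_ ?_
      · subst hY
        obtain ⟨i, -, rfl⟩ := List.mem_map.1 hy
        simp [hs]
      · subst hI hz hY htop hbottom
        rw [hzip, hbot]
        refine Spec.le (spec_bind (spec_append _ _) (q₂ := 0)
          (t₂ := s * (1 + (s + b) * (3 * (2 * s) + 2))) fun M hM => ?_) le_rfl ?_
        · subst hM
          have h1 := spec_schur (Cov := Cov) (P.map (Sum.inl : Fin n → Fin n ⊕ ρ))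
            (P.map (Sum.inl : Fin n → Fin n ⊕ Fin n)) (by simp) (B.map Sum.inr)
            (P.map Sum.inr) (blockMatrix A X) (x := s + b)
            (y := 2 * s) (by simp [hs, hb]) (by simp [hs, two_mul])
          rw [List.length_map, rowsOf_map, hs, rowsOf, List.map_append] at h1
          rw [hs]
          exact h1
        · simp [length_rowsOf, hs]
      · simp
      · subst hY
        rw [length_rowsOf, hb]
    · subst hI
      rw [length_rowsOf, hs]
  · rw [hs]
    nlinarith [Nat.zero_le (s * s * b), Nat.zero_le (s * b), Nat.zero_le (s * s),
      Nat.zero_le (s ^ 3)]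

/-! ### Sparse matrices -/

/-- `T` lists, without repetition, the nonzero entries of `K` at the positions in `R`. -/
def Holds (K : Fin n → Fin n → ℝ) (R : Fin n → Fin n → Prop) (T : Sparse n ℝ) : Prop :=
  T.Nodup ∧ ∀ e, e ∈ T ↔ R e.1 e.2.1 ∧ e.2.2 = K e.1 e.2.1 ∧ e.2.2 ≠ 0

theorem Holds.congr {K : Fin n → Fin n → ℝ} {R R' : Fin n → Fin n → Prop} {T : Sparse n ℝ}
    (h : Holds K R T) (hR : ∀ i j, K i j ≠ 0 → (R i j ↔ R' i j)) : Holds K R' T := by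
  refine ⟨h.1, fun e => ?_⟩
  rw [h.2]
  constructor
  · rintro ⟨h1, h2, h3⟩
    exact ⟨(hR _ _ (h2 ▸ h3)).1 h1, h2, h3⟩
  · rintro ⟨h1, h2, h3⟩
    exact ⟨(hR _ _ (h2 ▸ h3)).2 h1, h2, h3⟩

theorem Holds.nil (K : Fin n → Fin n → ℝ) : Holds K (fun _ _ => False) [] := by
  simp [Holds]

theorem Holds.append {K : Fin n → Fin n → ℝ} {R R' : Fin n → Fin n → Prop} {T T' : Sparse n ℝ}
    (h : Holds K R T) (h' : Holds K R' T') (hd : ∀ i j, R i j → ¬ R' i j) :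
    Holds K (fun i j => R i j ∨ R' i j) (T ++ T') := by
  refine ⟨List.nodup_append'.2 ⟨h.1, h'.1, ?_⟩, fun e => ?_⟩
  · intro e he he'
    exact hd _ _ ((h.2 e).1 he).1 ((h'.2 e).1 he').1
  · rw [List.mem_append, h.2, h'.2]
    tauto

theorem Holds.cons {K : Fin n → Fin n → ℝ} {R : Fin n → Fin n → Prop} {T : Sparse n ℝ}
    (h : Holds K R T) {i j : Fin n} {x : ℝ} (hx : x = K i j) (hx0 : x ≠ 0) (hR : ¬ R i j) :
    Holds K (fun i' j' => R i' j' ∨ (i' = i ∧ j' = j)) ((i, j, x) :: T) := by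
  refine ⟨List.nodup_cons.2 ⟨fun hm => hR ((h.2 _).1 hm).1, h.1⟩, ?_⟩
  rintro ⟨i', j', y⟩
  rw [List.mem_cons, h.2]
  simp only [Prod.mk.injEq]
  constructor
  · rintro (⟨rfl, rfl, rfl⟩ | ⟨h1, h2, h3⟩)
    · exact ⟨Or.inr ⟨rfl, rfl⟩, hx, hx0⟩
    · exact ⟨Or.inl h1, h2, h3⟩
  · rintro ⟨h1 | ⟨rfl, rfl⟩, h2, h3⟩
    · exact Or.inr ⟨h1, h2, h3⟩
    · exact Or.inl ⟨rfl, rfl, h2.trans hx.symm⟩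

open Classical in
/-- Summing over the entries of a sparse matrix is summing over the positions that it covers, as the
omitted entries are zero. -/
theorem Holds.sum_map {K : Fin n → Fin n → ℝ} {R : Fin n → Fin n → Prop} {T : Sparse n ℝ}
    (h : Holds K R T) (f : Fin n → Fin n → ℝ → ℝ) (hf : ∀ i j, f i j 0 = 0) :
    (T.map fun e => f e.1 e.2.1 e.2.2).sum = ∑ i, ∑ j, if R i j then f i j (K i j) else 0 := by
  have himage : T.toFinset = ((Finset.univ : Finset (Fin n × Fin n)).filter fun p =>
      R p.1 p.2 ∧ K p.1 p.2 ≠ 0).image fun p => (p.1, p.2, K p.1 p.2) := by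
    ext ⟨i, j, x⟩
    simp only [List.mem_toFinset, h.2, Finset.mem_image, Finset.mem_filter, Finset.mem_univ,
      true_and, Prod.mk.injEq, Prod.exists]
    constructor
    · rintro ⟨h1, rfl, h3⟩
      exact ⟨i, j, ⟨h1, h3⟩, rfl, rfl, rfl⟩
    · rintro ⟨i, j, ⟨h1, h3⟩, rfl, rfl, rfl⟩
      exact ⟨h1, rfl, h3⟩
  rw [← List.sum_toFinset _ h.1, himage, Finset.sum_image (by
    rintro ⟨i, j⟩ _ ⟨i', j'⟩ _ hp
    simp only [Prod.mk.injEq] at hp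
    exact Prod.ext hp.1 hp.2.1), Finset.sum_filter, ← Finset.univ_product_univ,
    Finset.sum_product]
  refine Finset.sum_congr rfl fun i _ => Finset.sum_congr rfl fun j _ => ?_
  by_cases h1 : R i j <;> by_cases h2 : K i j = 0 <;> simp [h1, h2, hf]

theorem Holds.toMatrix {K : Matrix (Fin n) (Fin n) ℝ} {T : Sparse n ℝ}
    (h : Holds K (fun _ _ => True) T) : toMatrix T = K := by
  funext i j
  have := h.sum_map (fun a b x => if a = i ∧ b = j then x else 0) (by simp)
  rw [CovarianceRecovery.toMatrix, this]
  simp only [if_true, ite_and]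
  simp

theorem Holds.length_le {K : Fin n → Fin n → ℝ} {V : List (Fin n)} {T : Sparse n ℝ}
    {R : Fin n → Fin n → Prop}
    (h : Holds K R T) (hR : ∀ i j, R i j → i ∈ V) (G : SimpleGraph (Fin n)) [DecidableRel G.Adj]
    {d : ℕ} (hd : G.maxDegree ≤ d) (hK : ∀ i j, i ≠ j → ¬ G.Adj i j → K i j = 0) :
    T.length ≤ V.length * (d + 1) := by
  rw [← List.toFinset_card_of_nodup h.1]
  have hsub : T.toFinset ⊆ (V.toFinset.sigma fun i => insert i (G.neighborFinset i)).image
      (fun p : (_ : Fin n) × Fin n => (p.1, p.2, K p.1 p.2)) := by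
    rintro ⟨i, j, x⟩ he
    obtain ⟨h1, h2, h3⟩ := (h.2 _).1 (List.mem_toFinset.1 he)
    dsimp only at h1 h2 h3
    refine Finset.mem_image.2 ⟨⟨i, j⟩, ?_, by simp [h2]⟩
    simp only [Finset.mem_sigma, List.mem_toFinset, Finset.mem_insert,
      SimpleGraph.mem_neighborFinset]
    refine ⟨hR _ _ h1, ?_⟩
    by_contra hcon
    rw [not_or] at hcon
    exact h3 (h2.trans (hK i j (fun e => hcon.1 e.symm) hcon.2))
  refine (Finset.card_le_card hsub).trans (Finset.card_image_le.trans ?_)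
  rw [Finset.card_sigma]
  calc ∑ i ∈ V.toFinset, (insert i (G.neighborFinset i)).card
      ≤ ∑ i ∈ V.toFinset, (d + 1) := Finset.sum_le_sum fun i _ =>
        (Finset.card_insert_le _ _).trans (Nat.add_le_add_right
          ((G.degree_le_maxDegree i).trans hd) 1)
    _ ≤ V.length * (d + 1) := by
      rw [Finset.sum_const, smul_eq_mul]
      exact Nat.mul_le_mul_right _ (List.toFinset_card_le V)

theorem forEach_map (g : α → ρ) (L : List α) (b : β) (f : β → ρ → Prog n ℝ β) :
    forEach (L.map g) b f = forEach L b fun b a => f b (g a) := by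
  induction L generalizing b with
  | nil => rfl
  | cons a L ih => simp only [List.map_cons, forEach, ih]

theorem zip_map_self {δ : Type} (L : List α) (g : α → δ) :
    L.zip (L.map g) = L.map fun a => (a, g a) := by
  induction L <;> simp_all

theorem spec_entries {F : Fin n → Fin n → ℝ} {A B : List (Fin n)} (hA : A.Nodup)
    (hB : B.Nodup) :
    Spec Cov (entries A B (rowsOf F A B)) (Holds F fun i j => i ∈ A ∧ j ∈ B) 0
      (A.length * (2 * B.length + 1)) := by
  rw [entries, rowsOf, zip_map_self, forEach_map]
  refine Spec.mono (spec_forEach_uniform (fun done T => Holds F (fun i j => i ∈ done ∧ j ∈ B) T) 0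
    (2 * B.length) ?_ fun done a rest T hL hT => ?_) (fun _ h => h) (by simp) le_rfl
  · simpa using Holds.nil F
  · have ha : a ∉ done := by
      intro h
      rw [hL] at hA
      exact (List.nodup_append'.1 hA).2.2 h (by simp)
    dsimp only
    rw [zip_map_self, forEach_map]
    refine Spec.mono (spec_forEach_uniform (fun done' T => Holds F (fun i j =>
      (i ∈ done ∧ j ∈ B) ∨ (i = a ∧ j ∈ done')) T) 0 1 (by simpa using hT)
        fun done' b rest' T' hL' hT' => ?_) ?_ (by simp) (by simp [mul_comm])
    · refine Spec.le (spec_bind (spec_testZero _) fun z hz => spec_pure ?_) le_rfl le_rfl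
      subst hz
      have hb : b ∉ done' := by
        intro h
        rw [hL'] at hB
        exact (List.nodup_append'.1 hB).2.2 h (by simp)
      dsimp only
      by_cases h0 : F a b = 0
      · simp only [h0, decide_true, if_true]
        refine hT'.congr fun i j hij => ?_
        have : ¬ (i = a ∧ j = b) := by rintro ⟨rfl, rfl⟩; exact hij h0
        simp only [List.mem_append, List.mem_singleton]
        tauto
      · simp only [h0, decide_false]
        refine (hT'.cons rfl h0 (by tauto)).congr fun i j _ => ?_
        simp only [List.mem_append, List.mem_singleton]
        tauto
    · intro T' hT'
      refine hT'.congr fun i j _ => ?_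
      simp only [List.mem_append, List.mem_singleton]
      tauto

/-- The entries of a rectangular block and of its transpose are listed together. -/
theorem spec_entriesSymm {F K : Fin n → Fin n → ℝ} {A B : List (Fin n)} (hA : A.Nodup)
    (hB : B.Nodup) (hAB : ∀ i ∈ A, i ∉ B) (hF : ∀ i ∈ A, ∀ j ∈ B, F i j = K i j ∧ F i j = K j i) :
    Spec Cov (entriesSymm A B (rowsOf F A B))
      (Holds K fun i j => (i ∈ A ∧ j ∈ B) ∨ (i ∈ B ∧ j ∈ A)) 0
      (A.length * (2 * B.length + 1)) := by
  rw [entriesSymm, rowsOf, zip_map_self, forEach_map]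
  refine Spec.mono (spec_forEach_uniform (fun done T => Holds K (fun i j =>
    (i ∈ done ∧ j ∈ B) ∨ (i ∈ B ∧ j ∈ done)) T) 0
    (2 * B.length) ?_ fun done a rest T hL hT => ?_) (fun _ h => h) (by simp) le_rfl
  · simpa using Holds.nil K
  · have ha : a ∉ done := by
      intro h
      rw [hL] at hA
      exact (List.nodup_append'.1 hA).2.2 h (by simp)
    have haA : a ∈ A := by simp [hL]
    have haB := hAB a haA
    have hdB : ∀ i ∈ done, i ∉ B := fun i hi => hAB i (by simp [hL, hi])
    dsimp only
    rw [zip_map_self, forEach_map]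
    refine Spec.mono (spec_forEach_uniform (fun done' T => Holds K (fun i j =>
      ((i ∈ done ∧ j ∈ B) ∨ (i ∈ B ∧ j ∈ done)) ∨ (i = a ∧ j ∈ done') ∨ (i ∈ done' ∧ j = a)) T)
        0 1 (by simpa using hT)
        fun done' b rest' T' hL' hT' => ?_) ?_ (by simp) (by simp [mul_comm])
    · refine Spec.le (spec_bind (spec_testZero _) fun z hz => spec_pure ?_) le_rfl le_rfl
      subst hz
      have hb : b ∉ done' := by
        intro h
        rw [hL'] at hB
        exact (List.nodup_append'.1 hB).2.2 h (by simp)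
      have hbB : b ∈ B := by simp [hL']
      have hab : a ≠ b := fun e => haB (e ▸ hbB)
      have hd' : a ∉ done' := fun h => haB (by simp [hL', h])
      obtain ⟨hK1, hK2⟩ := hF a haA b hbB
      dsimp only
      by_cases h0 : F a b = 0
      · simp only [h0, decide_true, if_true]
        refine hT'.congr fun i j hij => ?_
        have h1 : ¬ (i = a ∧ j = b) := by rintro ⟨rfl, rfl⟩; exact hij (hK1 ▸ h0)
        have h2 : ¬ (i = b ∧ j = a) := by rintro ⟨rfl, rfl⟩; exact hij (hK2 ▸ h0)
        simp only [List.mem_append, List.mem_singleton]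
        grind
      · simp only [h0, decide_false]
        have hbd : b ∉ done := fun h => hdB b h hbB
        refine ((hT'.cons (i := b) (j := a) hK2 h0 ?_).cons (i := a) (j := b) hK1 h0 ?_).congr
          fun i j _ => ?_
        · rintro ((⟨h1, h2⟩ | ⟨h1, h2⟩) | ⟨h1, h2⟩ | ⟨h1, h2⟩)
          · exact hbd h1
          · exact ha h2
          · exact hab h1.symm
          · exact hb h1
        · rintro (((⟨h1, h2⟩ | ⟨h1, h2⟩) | ⟨h1, h2⟩ | ⟨h1, h2⟩) | ⟨h1, h2⟩)
          · exact ha h1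
          · exact haB h1
          · exact hb h2
          · exact hd' h1
          · exact hab h1
        · simp only [List.mem_append, List.mem_singleton]
          grind
    · intro T' hT'
      refine hT'.congr fun i j _ => ?_
      simp only [List.mem_append, List.mem_singleton]
      grind

theorem spec_subTransposeMul (Acc : ρ → κ → ℝ) (Q : α → ρ → ℝ) (M : α → κ → ℝ) (A : List ρ)
    (B : List κ) (C : List α) :
    Spec Cov (subTransposeMul (rowsOf Acc A B) (rowsOf Q C A) (rowsOf M C B))
      (· = rowsOf (fun i j => Acc i j - (C.map fun c => Q c i * M c j).sum) A B) 0
      (C.length * (A.length * (3 * B.length + 1) + 1)) := by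
  have hz : (rowsOf Q C A).zip (rowsOf M C B) = C.map fun c => (A.map (Q c), B.map (M c)) := by
    induction C with
    | nil => rfl
    | cons c C ih => simpa [rowsOf] using ih
  rw [subTransposeMul, hz, forEach_map]
  refine Spec.mono (spec_forEach_uniform (fun done X => X = rowsOf (fun i j => Acc i j -
    (done.map fun c => Q c i * M c j).sum) A B) 0 (A.length * (3 * B.length + 1)) (by simp)
      fun done c rest X hL hX => ?_) (fun _ h => h) (by simp) le_rfl
  subst hX
  refine Spec.mono (spec_zipEach (M := A.map (Q c)) (fun row x => List.zipWith
    (fun a y => a - x * y) row (B.map (M c))) (3 * B.length) fun row _ x _ => Spec.mono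
      (spec_zipEach (fun a y => a - x * y) 2 fun a _ y _ => spec_bind (spec_arithOp _ _ _)
        fun t ht => Spec.mono (spec_arithOp _ _ _) ?_ le_rfl le_rfl) (fun _ h => h) le_rfl
        (by simp [mul_comm])) ?_ le_rfl (by simp)
  · subst ht
    rintro _ rfl
    rfl
  · rintro _ rfl
    have : ∀ L : List ρ, List.zipWith (fun row x => List.zipWith (fun a y => a - x * y) row
        (B.map (M c))) (rowsOf (fun i j => Acc i j - (done.map fun c => Q c i * M c j).sum) L B)
        (L.map (Q c)) = rowsOf (fun i j => Acc i j -
          ((done ++ [c]).map fun c => Q c i * M c j).sum) L B := by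
      intro L
      induction L with
      | nil => rfl
      | cons i L ih =>
        simp only [rowsOf, List.map_cons, List.zipWith_cons_cons] at ih ⊢
        rw [ih, zipWith_map_map]
        congr 1
        refine List.map_congr_left fun j _ => ?_
        simp only [List.map_append, List.map_cons, List.map_nil, List.sum_append, List.sum_cons,
          List.sum_nil]
        ring
    exact this A

theorem spec_sparseMul (T : Sparse n ℝ) (C P : List (Fin n)) (D : Fin n → Fin n → ℝ)
    (hT : ∀ e ∈ T, e.1 ∈ C ∧ e.2.1 ∈ C) :
    Spec Cov (sparseMul T C (rowsOf D C P) P.length)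
      (· = rowsOf (fun c j => (T.map fun e => if e.1 = c then e.2.2 * D e.2.1 j else 0).sum) C P) 0
      (3 * C.length + 2 * P.length + T.length * (3 * P.length + 1)) := by
  rw [sparseMul, rowsOf, zip_map_self, forEach_map]
  refine Spec.le (spec_bind (spec_forEach_uniform (fun done (t : Fin n → List ℝ) =>
    ∀ c ∈ done, t c = P.map (D c)) 0 0 (by simp) ?_) fun rowOf hrow => spec_bind (spec_zeros P)
      fun z hz => spec_bind (spec_forEach_uniform (fun done (t : Fin n → List ℝ) =>
        ∀ c ∈ done, t c = z) 0 0 (by simp) ?_) fun P₀ hP₀ => spec_bind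
          (spec_forEach_uniform (fun done (t : Fin n → List ℝ) => ∀ c ∈ C, t c = P.map fun j =>
            (done.map fun e => if e.1 = c then e.2.2 * D e.2.1 j else 0).sum) 0 (3 * P.length)
            ?_ ?_) fun P' hP' => Spec.mono (spec_mapEach P' 0 0 fun c _ => spec_pure rfl) ?_
              le_rfl le_rfl) (by simp) (by simp; ring_nf; omega)
  · intro done a rest t hL ht
    refine spec_pure fun c hc => ?_
    by_cases hca : c = a
    · simp [hca]
    · have : c ∈ done := by simpa [hca] using hc
      simp [Function.update_of_ne hca, ht c this]
  · intro done a rest t hL ht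
    refine spec_pure fun c hc => ?_
    by_cases hca : c = a
    · simp [hca]
    · have : c ∈ done := by simpa [hca] using hc
      simp [Function.update_of_ne hca, ht c this]
  · intro c hc
    rw [hP₀ c hc, hz]
    simp
  · intro done e rest t hL ht
    obtain ⟨h1, h2⟩ := hT e (by simp [hL])
    refine Spec.le (spec_bind (spec_zipEach (fun p q => p + e.2.2 * q) 2 fun p _ q _ =>
      spec_bind (spec_arithOp _ _ _) fun y hy => Spec.mono (spec_arithOp _ _ _) ?_ le_rfl le_rfl)
        fun row hr => spec_pure ?_) (by simp) ?_
    · subst hy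
      rintro _ rfl
      rfl
    · intro c hc
      subst hr
      rw [hrow _ h2, ht _ h1, zipWith_map_map]
      by_cases hce : c = e.1
      · subst hce
        simp
      · rw [Function.update_of_ne hce, ht c hc]
        simp [Ne.symm hce]
    · rw [hrow _ h2]
      simp [mul_comm]
  · rintro _ rfl
    exact List.map_congr_left fun c hc => hP' c hc

end MatrixPrograms

/-! ### Separators and ranks -/

section Separators

variable {V : Type*} {G : SimpleGraph V}

/-- The vertices `u` and `v` are connected by a walk that avoids `T`. -/
def Linked (G : SimpleGraph V) (T : Finset V) (u v : V) : Prop :=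
  ∃ p : G.Walk u v, ∀ x ∈ p.support, x ∉ T

variable {T T' : Finset V} {u v w : V}

theorem Linked.refl (h : u ∉ T) : Linked G T u u := ⟨.nil, by simpa using h⟩

theorem Linked.symm (h : Linked G T u v) : Linked G T v u := by
  obtain ⟨p, hp⟩ := h
  exact ⟨p.reverse, by simpa using hp⟩

theorem Linked.trans (h : Linked G T u v) (h' : Linked G T v w) : Linked G T u w := by
  obtain ⟨p, hp⟩ := h
  obtain ⟨q, hq⟩ := h'
  refine ⟨p.append q, fun x hx => ?_⟩
  rcases (SimpleGraph.Walk.mem_support_append_iff _ _).1 hx with hx | hx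
  exacts [hp x hx, hq x hx]

theorem Linked.mono (h : Linked G T u v) (hT : T' ⊆ T) : Linked G T' u v := by
  obtain ⟨p, hp⟩ := h
  exact ⟨p, fun x hx hxT => hp x hx (hT hxT)⟩

theorem Linked.right_notMem (h : Linked G T u v) : v ∉ T := by
  obtain ⟨p, hp⟩ := h
  exact hp v p.end_mem_support

theorem Linked.left_notMem (h : Linked G T u v) : u ∉ T := h.symm.right_notMem

theorem Linked.of_adj (h : G.Adj u v) (hu : u ∉ T) (hv : v ∉ T) : Linked G T u v :=
  ⟨h.toWalk, by simp [hu, hv]⟩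

theorem Linked.of_mem_support [DecidableEq V] (p : G.Walk u v) (hp : ∀ x ∈ p.support, x ∉ T)
    (hw : w ∈ p.support) : Linked G T u w :=
  ⟨p.takeUntil w hw, fun x hx => hp x (p.support_takeUntil_subset_support hw hx)⟩

/-- A vertex set that the reachable set of `u` does not meet can be avoided as well. -/
theorem Linked.union [DecidableEq V] {X : Finset V} (h : Linked G T u v)
    (hX : ∀ x ∈ X, ¬ Linked G T u x) : Linked G (T ∪ X) u v := by
  obtain ⟨p, hp⟩ := h
  refine ⟨p, fun x hx hxT => ?_⟩
  rcases Finset.mem_union.1 hxT with h | h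
  · exact hp x hx h
  · exact hX x h (Linked.of_mem_support p hp hx)

theorem separates_iff {S A B : Finset V} :
    Separates G S A B ↔ ∀ a ∈ A, ∀ b ∈ B, ¬ Linked G S a b := by
  constructor
  · rintro h a ha b hb ⟨p, hp⟩
    obtain ⟨v, hv, hvS⟩ := h a ha b hb p
    exact hp v hv hvS
  · intro h a ha b hb p
    by_contra hcon
    push Not at hcon
    exact h a ha b hb ⟨p, hcon⟩

/-- On the way from `u` to a vertex of `X` there is a first edge into `X`. -/
theorem Linked.exists_adj [DecidableEq V] {X : Finset V} {s : V} (h : Linked G T u s)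
    (hs : s ∈ X) (hu : u ∉ X) : ∃ x y, Linked G (X ∪ T) u x ∧ G.Adj x y ∧ y ∈ X := by
  obtain ⟨p, hp⟩ := h
  induction p with
  | nil => exact absurd hs hu
  | @cons u w s hadj p ih =>
    have hu' : u ∉ X ∪ T := by simp [hu, hp u (by simp)]
    by_cases hw : w ∈ X
    · exact ⟨u, w, Linked.refl hu', hadj, hw⟩
    · obtain ⟨x, y, h1, h2, h3⟩ := ih hs hw fun x hx => hp x (by simp [hx])
      exact ⟨x, y, (Linked.of_adj hadj hu' h1.left_notMem).trans h1, h2, h3⟩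

/-- `C` is the vertex set of a connected component of the graph without `S`. -/
def IsComp (G : SimpleGraph V) (S C : Finset V) : Prop :=
  C.Nonempty ∧ ∀ v ∈ C, ∀ w, w ∈ C ↔ Linked G S v w

theorem IsComp.notMem {S C : Finset V} (h : IsComp G S C) (hv : v ∈ C) : v ∉ S :=
  ((h.2 v hv v).1 hv).left_notMem

theorem IsComp.linked {S C : Finset V} (h : IsComp G S C) (hv : v ∈ C) (hw : w ∈ C) :
    Linked G S v w := (h.2 v hv w).1 hw

theorem IsComp.not_adj {S C : Finset V} (h : IsComp G S C) (hv : v ∈ C) (hw : w ∉ C)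
    (hS : w ∉ S) : ¬ G.Adj v w := fun hadj =>
  hw ((h.2 v hv w).2 (Linked.of_adj hadj (h.notMem hv) hS))

end Separators

section Generic

variable {n : ℕ} {G : SimpleGraph (Fin n)} {Cov : Matrix (Fin n) (Fin n) ℝ}

theorem Generic.exists_separates (h : Generic G Cov) (A B : Finset (Fin n)) :
    ∃ X, Separates G X A B ∧ X.card = setRank Cov A B := (h A B).1

theorem Generic.setRank_le (h : Generic G Cov) {A B X : Finset (Fin n)}
    (hX : Separates G X A B) : setRank Cov A B ≤ X.card := (h A B).2 ⟨X, hX, rfl⟩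

theorem Separates.subset {V : Type*} {G : SimpleGraph V} {S A B A' B' : Finset V}
    (h : Separates G S A B) (hA : A' ⊆ A) (hB : B' ⊆ B) : Separates G S A' B' :=
  fun a ha b hb => h a (hA ha) b (hB hb)

theorem Generic.setRank_mono (h : Generic G Cov) {A B A' B' : Finset (Fin n)} (hA : A' ⊆ A)
    (hB : B' ⊆ B) : setRank Cov A' B' ≤ setRank Cov A B := by
  obtain ⟨X, hX, hc⟩ := h.exists_separates A B
  rw [← hc]
  exact h.setRank_le (hX.subset hA hB)

theorem Separates.subset_of_union {V : Type*} [DecidableEq V] {G : SimpleGraph V}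
    {X A B T : Finset V} (h : Separates G X (A ∪ T) (B ∪ T)) : T ⊆ X := by
  intro t ht
  obtain ⟨v, hv, hvX⟩ := h t (by simp [ht]) t (by simp [ht]) .nil
  simp only [SimpleGraph.Walk.support_nil, List.mem_singleton] at hv
  exact hv ▸ hvX

theorem Separates.union {V : Type*} [DecidableEq V] {G : SimpleGraph V}
    {X A B T : Finset V} (h : Separates G X A B) (hT : T ⊆ X) :
    Separates G X (A ∪ T) (B ∪ T) := by
  rw [separates_iff] at h ⊢
  intro a ha b hb hl
  have ha' : a ∉ T := fun h => hl.left_notMem (hT h)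
  have hb' : b ∉ T := fun h => hl.right_notMem (hT h)
  simp only [Finset.mem_union, ha', hb', or_false] at ha hb
  exact h a ha b hb hl

/-- The rank test that decides whether two vertices lie in the same component. -/
theorem Generic.setRank_insert_eq_iff (h : Generic G Cov) {T : Finset (Fin n)} {u v : Fin n}
    (hu : u ∉ T) : setRank Cov (insert u T) (insert v T) = T.card + 1 ↔ Linked G T u v := by
  have e : ∀ x : Fin n, insert x T = {x} ∪ T := fun x => rfl
  constructor
  · intro hr
    by_contra hcon
    have hs : Separates G T ({u} ∪ T) ({v} ∪ T) := Separates.union (by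
      rw [separates_iff]
      intro a ha b hb
      rw [Finset.mem_singleton] at ha hb
      subst ha hb
      exact hcon) subset_rfl
    have := h.setRank_le hs
    rw [← e, ← e, hr] at this
    omega
  · intro hl
    apply le_antisymm
    · have hs : Separates G (insert u T) ({u} ∪ T) ({v} ∪ T) := by
        rw [separates_iff]
        intro a ha b _ hab
        exact hab.left_notMem (by simpa using ha)
      have := h.setRank_le hs
      rwa [← e, ← e, Finset.card_insert_of_notMem hu] at this
    · obtain ⟨X, hX, hc⟩ := h.exists_separates (insert u T) (insert v T)
      rw [← hc]
      have hTX : T ⊆ X := Separates.subset_of_union (A := {u}) (B := {v}) hX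
      by_contra hcon
      have hXT : T = X := Finset.eq_of_subset_of_card_le hTX (by omega)
      rw [separates_iff, ← hXT] at hX
      exact hX u (by simp) v (by simp) hl

/-- Adding `T` to both sides keeps the rank if and only if `T` extends to a minimum separator. -/
theorem Generic.setRank_union_eq_iff (h : Generic G Cov) {A B S T : Finset (Fin n)}
    (hST : S ⊆ T) : setRank Cov (A ∪ T) (B ∪ T) = setRank Cov (A ∪ S) (B ∪ S) ↔
      ∃ X, T ⊆ X ∧ X.card = setRank Cov (A ∪ S) (B ∪ S) ∧ Separates G X (A ∪ S) (B ∪ S) := by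
  have hA := Finset.union_subset_union_right (s := A) hST
  have hB := Finset.union_subset_union_right (s := B) hST
  constructor
  · intro he
    obtain ⟨X, hX, hc⟩ := h.exists_separates (A ∪ T) (B ∪ T)
    exact ⟨X, hX.subset_of_union, hc.trans he, hX.subset hA hB⟩
  · rintro ⟨X, hTX, hc, hX⟩
    refine le_antisymm ?_ (h.setRank_mono hA hB)
    rw [← hc]
    exact h.setRank_le ((hX.subset Finset.subset_union_left Finset.subset_union_left).union hTX)

/-- A set that extends to a minimum separator, but to no larger part of one by a vertex of the
component `V`, is itself a minimum separator. -/
theorem Generic.separates_of_maximal (h : Generic G Cov) {V S A B C : Finset (Fin n)}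
    (hV : IsComp G S V) (hA : A ⊆ V) (hCV : C ⊆ V)
    (hC : setRank Cov (A ∪ (C ∪ S)) (B ∪ (C ∪ S)) = setRank Cov (A ∪ S) (B ∪ S))
    (hmax : ∀ u ∈ V, setRank Cov (A ∪ insert u S) (B ∪ insert u S) =
      setRank Cov (A ∪ S) (B ∪ S) → u ∈ C ∨ setRank Cov (A ∪ insert u (C ∪ S))
        (B ∪ insert u (C ∪ S)) ≠ setRank Cov (A ∪ S) (B ∪ S)) :
    Separates G (C ∪ S) A B ∧ C.card + S.card = setRank Cov (A ∪ S) (B ∪ S) := by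
  obtain ⟨X, hCX, hcard, hX⟩ := (h.setRank_union_eq_iff Finset.subset_union_right).1 hC
  have hSX : S ⊆ X := Finset.subset_union_right.trans hCX
  have hXV : ∀ x ∈ X, x ∈ V → x ∈ C := by
    intro x hx hxV
    have h1 : insert x S ⊆ X := Finset.insert_subset hx hSX
    have h2 : insert x (C ∪ S) ⊆ X := Finset.insert_subset hx hCX
    rcases hmax x hxV ((h.setRank_union_eq_iff (Finset.subset_insert _ _)).2
      ⟨X, h1, hcard, hX⟩) with h3 | h3
    · exact h3
    · exact absurd ((h.setRank_union_eq_iff (Finset.subset_union_right.trans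
        (Finset.subset_insert _ _))).2 ⟨X, h2, hcard, hX⟩) h3
  have hsep : Separates G (C ∪ S) A B := by
    rw [separates_iff]
    intro a ha b hb hab
    rw [separates_iff] at hX
    apply hX a (by simp [ha]) b (by simp [hb])
    have h1 := hab.union (X := X) fun x hx hl => by
      have hxV : x ∈ V := (hV.2 a (hA ha) x).2 (hl.mono Finset.subset_union_right)
      exact hl.right_notMem (by simp [hXV x hx hxV])
    exact h1.mono Finset.subset_union_right
  refine ⟨hsep, ?_⟩
  have hdisj : Disjoint C S := Finset.disjoint_left.2 fun x hx => hV.notMem (hCV hx)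
  rw [← Finset.card_union_of_disjoint hdisj]
  refine le_antisymm ?_ (h.setRank_le (hsep.union Finset.subset_union_right))
  rw [← hcard]
  exact Finset.card_le_card hCX

/-- A family of pairwise separated vertices of a component `V` of the graph without `S`, after
removal of the vertices in `X`, is no larger than the number of edges at `X`, or has one element. -/
theorem IsComp.length_le [DecidableRel G.Adj] {V S X : Finset (Fin n)} (hV : IsComp G S V)
    {d : ℕ} (hd : G.maxDegree ≤ d) (hX : X ⊆ V) {L : List (Fin n)}
    (hL : ∀ u ∈ L, u ∈ V ∧ u ∉ X) (hpair : L.Pairwise fun u v => ¬ Linked G (X ∪ S) u v) :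
    L.length ≤ d * X.card + 1 := by
  rcases X.eq_empty_or_nonempty with rfl | ⟨s, hs⟩
  · match L, hpair, hL with
    | [], _, _ => simp
    | [_], _, _ => simp
    | u :: v :: L, hpair, hL =>
      exfalso
      have := (List.pairwise_cons.1 hpair).1 v (by simp)
      rw [Finset.empty_union] at this
      exact this (hV.linked (hL u (by simp)).1 (hL v (by simp)).1)
  · have key : ∀ u ∈ L, ∃ x, Linked G (X ∪ S) u x ∧ x ∈ X.biUnion fun y => G.neighborFinset y := by
      intro u hu
      obtain ⟨x, y, h1, h2, h3⟩ := (hV.linked (hL u hu).1 (hX hs)).exists_adj hs (hL u hu).2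
      exact ⟨x, h1, Finset.mem_biUnion.2 ⟨y, h3, by simpa using h2.symm⟩⟩
    choose! f hf1 hf2 using key
    have hnodup : (L.map f).Nodup := by
      rw [List.Nodup, List.pairwise_map]
      refine List.Pairwise.imp_of_mem ?_ hpair
      intro u v hu hv huv he
      exact huv ((hf1 u hu).trans (he ▸ (hf1 v hv).symm))
    have h1 : (L.map f).toFinset ⊆ X.biUnion fun y => G.neighborFinset y := by
      intro x hx
      obtain ⟨u, hu, rfl⟩ := List.mem_map.1 (List.mem_toFinset.1 hx)
      exact hf2 u hu
    have h2 := Finset.card_le_card h1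
    rw [List.toFinset_card_of_nodup hnodup, List.length_map] at h2
    refine h2.trans (Finset.card_biUnion_le.trans ?_)
    calc ∑ x ∈ X, (G.neighborFinset x).card ≤ ∑ x ∈ X, d :=
          Finset.sum_le_sum fun x _ => (G.degree_le_maxDegree x).trans hd
      _ ≤ d * X.card + 1 := by rw [Finset.sum_const, smul_eq_mul, mul_comm]; omega

end Generic

/-! ### Separators found by rank queries -/

section Procedures

variable {n : ℕ} {G : SimpleGraph (Fin n)} {Cov : Matrix (Fin n) (Fin n) ℝ}

/-- What `abSeparator` guarantees: a separator of `A` and `B` inside the component `V`, of minimum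
size. -/
def SepOutput (G : SimpleGraph (Fin n)) (Cov : Matrix (Fin n) (Fin n) ℝ)
    (V A B S C : List (Fin n)) : Prop :=
  C.Nodup ∧ (∀ c ∈ C, c ∈ V) ∧ Separates G (C.toFinset ∪ S.toFinset) A.toFinset B.toFinset ∧
    C.length + S.length = setRank Cov (A ++ S).toFinset (B ++ S).toFinset

/-- The set `C` is enlarged greedily as long as the rank does not exceed `r`, that is, as long as `C
∪ S` is contained in a minimum separator; it contains at most `κ` vertices at any time, so that all
ranks are those of matrices with at most `P` rows and columns. -/
theorem spec_abSeparator (hgen : Generic G Cov) {V A B S : List (Fin n)} (hVn : V.Nodup)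
    (hSn : S.Nodup) (hV : IsComp G S.toFinset V.toFinset) (hA : ∀ a ∈ A, a ∈ V) {P κ : ℕ}
    (hr : setRank Cov (A ++ S).toFinset (B ++ S).toFinset ≤ S.length + κ)
    (hPA : A.length + S.length + κ + 1 ≤ P) (hPB : B.length + S.length + κ + 1 ≤ P) :
    Spec Cov (abSeparator V A B S) (SepOutput G Cov V A B S) (P ^ 2 * (2 * V.length + 1))
      (40 * (P ^ 3 * (V.length + 1))) := by
  have hP1 : 1 ≤ P := by omega
  have hcP : ∀ (L M : List (Fin n)), L.length ≤ P → M.length ≤ P →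
      Spec Cov (covRank L M) (· = setRank Cov L.toFinset M.toFinset) (P ^ 2) (12 * P ^ 3) :=
    fun L M h1 h2 => spec_covRank L M hP1 h1 h2
  set r := setRank Cov (A ++ S).toFinset (B ++ S).toFinset with hrdef
  have hAS : (A ++ S).toFinset = A.toFinset ∪ S.toFinset := List.toFinset_append
  have hBS : (B ++ S).toFinset = B.toFinset ∪ S.toFinset := List.toFinset_append
  have hins : ∀ (X : List (Fin n)) (v : Fin n) (Z : List (Fin n)),
      (v :: (X ++ Z)).toFinset = X.toFinset ∪ insert v Z.toFinset := by
    intro X v Z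
    rw [List.toFinset_cons, List.toFinset_append, Finset.union_insert]
  have hins' : ∀ (X : List (Fin n)) (v : Fin n) (C : List (Fin n)),
      (v :: (C ++ (X ++ S))).toFinset = X.toFinset ∪ insert v (C.toFinset ∪ S.toFinset) := by
    intro X v C
    ext x
    simp only [List.mem_toFinset, List.mem_cons, List.mem_append, Finset.mem_union,
      Finset.mem_insert]
    tauto
  have hAV : A.toFinset ⊆ V.toFinset := fun a ha => by
    simpa using hA a (by simpa using ha)
  have hP3 : P ≤ P ^ 3 := Nat.le_self_pow (by norm_num) P
  -- the final set cannot be enlarged by a vertex that keeps the rank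
  have hfin : ∀ C : List (Fin n), C.Nodup → (∀ c ∈ C, c ∈ V) →
      setRank Cov (A.toFinset ∪ (C.toFinset ∪ S.toFinset))
        (B.toFinset ∪ (C.toFinset ∪ S.toFinset)) = r →
      (∀ u ∈ V, setRank Cov (A.toFinset ∪ insert u S.toFinset) (B.toFinset ∪ insert u S.toFinset)
        = r → u ∈ C ∨ setRank Cov (A.toFinset ∪ insert u (C.toFinset ∪ S.toFinset))
          (B.toFinset ∪ insert u (C.toFinset ∪ S.toFinset)) ≠ r) →
      SepOutput G Cov V A B S C := by
    intro C hCn hCV hC hmax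
    rw [hrdef, hAS, hBS] at hC hmax
    have := hgen.separates_of_maximal hV hAV (C := C.toFinset)
      (fun c hc => by simpa using hCV c (by simpa using hc)) hC
      (fun u hu h => by simpa using hmax u (by simpa using hu) h)
    refine ⟨hCn, hCV, this.1, ?_⟩
    rw [hAS, hBS, ← this.2, List.toFinset_card_of_nodup hCn, List.toFinset_card_of_nodup hSn]
  refine Spec.le (spec_bind (spec_append A S) (q₂ := P ^ 2 * (2 * V.length + 1))
    (t₂ := P + (12 * P ^ 3 + (V.length * (12 * P ^ 3 + 1) +
      V.length * (2 * P + 12 * P ^ 3 + 1)))) fun AS hASl => ?_) (by simp) ?_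
  swap
  · have : A.length ≤ P := by omega
    nlinarith [Nat.zero_le (V.length * P ^ 3), Nat.mul_le_mul_left V.length hP3,
      Nat.mul_le_mul_left V.length hP1]
  subst hASl
  refine Spec.le (spec_bind (spec_append B S) (q₂ := P ^ 2 * (2 * V.length + 1))
    (t₂ := 12 * P ^ 3 + (V.length * (12 * P ^ 3 + 1) +
      V.length * (2 * P + 12 * P ^ 3 + 1))) fun BS hBSl => ?_) (by simp) (by omega)
  subst hBSl
  refine Spec.le (spec_bind (hcP (A ++ S) (B ++ S) (by simp; omega) (by simp; omega))
    (q₂ := 2 * (V.length * P ^ 2)) (t₂ := V.length * (12 * P ^ 3 + 1) +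
      V.length * (2 * P + 12 * P ^ 3 + 1)) fun r' hr' => ?_) (by ring_nf; omega) (by omega)
  rw [← hrdef] at hr'
  subst r'
  refine Spec.le (spec_bind (spec_filterEach (L := V) (fun v => decide (setRank Cov
    (v :: (A ++ S)).toFinset (v :: (B ++ S)).toFinset = r)) (P ^ 2) (12 * P ^ 3) fun v _ =>
      ((spec_bind (hcP (v :: (A ++ S)) (v :: (B ++ S)) (by simp; omega) (by simp; omega))
        (q₂ := 0) (t₂ := 0) fun q hq => spec_pure (by rw [hq])))) (q₂ := V.length * P ^ 2)
        (t₂ := V.length * (2 * P + 12 * P ^ 3 + 1)) fun U hU => ?_) (by omega) (by omega)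
  have hUmem : ∀ u, u ∈ U ↔ u ∈ V ∧ setRank Cov (A.toFinset ∪ insert u S.toFinset)
      (B.toFinset ∪ insert u S.toFinset) = r := by
    intro u
    rw [hU, List.mem_filter, hins, hins, decide_eq_true_eq]
  have hUn : U.Nodup := hU ▸ hVn.filter _
  have hUl : U.length ≤ V.length := hU ▸ List.length_filter_le _ _
  cases U with
  | nil =>
    refine spec_pure_le (hfin [] List.nodup_nil (by simp) ?_ ?_)
    · simp [hrdef, hAS, hBS]
    · intro u hu h
      exact absurd ((hUmem u).2 ⟨hu, h⟩) (by simp)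
  | cons v₀ U₁ =>
    obtain ⟨hv0, hU1n⟩ := List.nodup_cons.1 hUn
    -- Invariant: the rank is still `r`, and it would increase with any vertex rejected so far. A
    -- rejected vertex never becomes admissible again, as ranks are monotone in the sets.
    refine Spec.mono (spec_forEach_uniform (fun done C => C.Nodup ∧
      (∀ c ∈ C, c ∈ v₀ :: done) ∧ setRank Cov (A.toFinset ∪ (C.toFinset ∪ S.toFinset))
        (B.toFinset ∪ (C.toFinset ∪ S.toFinset)) = r ∧ ∀ u ∈ v₀ :: done, u ∈ C ∨
          setRank Cov (A.toFinset ∪ insert u (C.toFinset ∪ S.toFinset))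
          (B.toFinset ∪ insert u (C.toFinset ∪ S.toFinset)) ≠ r) (P ^ 2) (2 * P + 12 * P ^ 3)
          ?_ ?_) ?_ ?_ ?_
    · refine ⟨List.nodup_singleton _, by simp, ?_, by simp⟩
      have := ((hUmem v₀).1 (by simp)).2
      simpa [Finset.singleton_union] using this
    · rintro done u rest C hL ⟨hCn, hCd, hCr, hCm⟩
      have hCV : ∀ c ∈ C, c ∈ V := fun c hc => ((hUmem c).1 (by
        rcases List.mem_cons.1 (hCd c hc) with rfl | h
        · simp
        · simp [hL, h])).1
      have hu : u ∉ C := by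
        intro hu
        rcases List.mem_cons.1 (hCd u hu) with rfl | h
        · exact hv0 (by simp [hL])
        · rw [hL] at hU1n
          exact (List.nodup_append'.1 hU1n).2.2 h (by simp)
      -- `C` and `S` are disjoint subsets of a minimum separator
      have hClen : C.length ≤ κ := by
        rw [hrdef, hAS, hBS] at hCr
        obtain ⟨X, hCX, hXc, -⟩ := (hgen.setRank_union_eq_iff Finset.subset_union_right).1 hCr
        have h1 := Finset.card_le_card hCX
        rw [Finset.card_union_of_disjoint (Finset.disjoint_left.2 fun x hx =>
          hV.notMem (by simpa using hCV x (by simpa using hx))),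
          List.toFinset_card_of_nodup hCn, List.toFinset_card_of_nodup hSn, hXc, ← hAS, ← hBS,
          ← hrdef] at h1
        omega
      refine Spec.le (spec_bind (spec_append C (A ++ S)) (q₂ := P ^ 2) (t₂ := P + 12 * P ^ 3)
        fun ASC hASC => ?_) (by simp) (by omega)
      refine Spec.le (spec_bind (spec_append C (B ++ S)) (q₂ := P ^ 2) (t₂ := 12 * P ^ 3)
        fun BSC hBSC => ?_) (by simp) (by omega)
      subst hASC hBSC
      refine Spec.le (spec_bind (hcP (u :: (C ++ (A ++ S))) (u :: (C ++ (B ++ S)))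
        (by simp; omega) (by simp; omega)) (q₂ := 0) (t₂ := 0) fun q hq => spec_pure ?_)
        le_rfl le_rfl
      rw [hins', hins'] at hq
      by_cases hqr : q = r
      · rw [if_pos hqr]
        have hmono : ∀ w X, setRank Cov (X ∪ insert w (C.toFinset ∪ S.toFinset))
            (B.toFinset ∪ insert w (C.toFinset ∪ S.toFinset)) ≤
              setRank Cov (X ∪ insert w ((u :: C).toFinset ∪ S.toFinset))
            (B.toFinset ∪ insert w ((u :: C).toFinset ∪ S.toFinset)) := by
          intro w X
          have : insert w (C.toFinset ∪ S.toFinset) ⊆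
              insert w ((u :: C).toFinset ∪ S.toFinset) := by
            intro x
            simp only [Finset.mem_insert, Finset.mem_union, List.mem_toFinset, List.mem_cons]
            tauto
          exact hgen.setRank_mono (Finset.union_subset_union_right this)
            (Finset.union_subset_union_right this)
        have hr0 : ∀ w, r ≤ setRank Cov (A.toFinset ∪ insert w (C.toFinset ∪ S.toFinset))
            (B.toFinset ∪ insert w (C.toFinset ∪ S.toFinset)) := by
          intro w
          rw [← hCr]
          exact hgen.setRank_mono (Finset.union_subset_union_right (Finset.subset_insert _ _))
            (Finset.union_subset_union_right (Finset.subset_insert _ _))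
        refine ⟨List.nodup_cons.2 ⟨hu, hCn⟩, ?_, ?_, ?_⟩
        · intro c hc
          rcases List.mem_cons.1 hc with rfl | hc
          · simp
          · rcases List.mem_cons.1 (hCd c hc) with rfl | h
            · simp
            · simp [h]
        · rw [List.toFinset_cons, Finset.insert_union, ← hq, hqr]
        · intro w hw
          by_cases hwu : w = u
          · exact Or.inl (by simp [hwu])
          · have hw' : w ∈ v₀ :: done := by
              simp only [List.mem_cons, List.mem_append, List.not_mem_nil, or_false] at hw ⊢
              tauto
            rcases hCm w hw' with h | h
            · exact Or.inl (by simp [h])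
            · refine Or.inr fun he => h (le_antisymm ?_ (hr0 w))
              rw [← he]
              exact hmono w _
      · rw [if_neg hqr]
        refine ⟨hCn, fun c hc => ?_, hCr, fun w hw => ?_⟩
        · rcases List.mem_cons.1 (hCd c hc) with rfl | h
          · simp
          · simp [h]
        · by_cases hwu : w = u
          · exact Or.inr (hwu ▸ hq ▸ hqr)
          · refine hCm w ?_
            simp only [List.mem_cons, List.mem_append, List.not_mem_nil, or_false] at hw ⊢
            tauto
    · rintro C ⟨hCn, hCd, hCr, hCm⟩
      refine hfin C hCn (fun c hc => ((hUmem c).1 (hCd c hc)).1) hCr fun u hu h => ?_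
      exact hCm u ((hUmem u).2 ⟨hu, h⟩)
    · have : U₁.length ≤ V.length := by simp at hUl; omega
      gcongr
    · have : U₁.length ≤ V.length := by simp at hUl; omega
      gcongr

/-- The two parts have at most two thirds of the elements each. -/
def Balanced (A B : List (Fin n)) : Prop :=
  3 * A.length ≤ 2 * (A.length + B.length) ∧ 3 * B.length ≤ 2 * (A.length + B.length)

/-- The exhaustive search distributes the vertices of `W` in all ways over the two sides `A` and
`B`, and returns a balanced bipartition of smallest rank, or `best` if that is at least as good. -/
theorem spec_searchSplit (S : List (Fin n)) {P : ℕ} (W A B : List (Fin n))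
    (best : Option (ℕ × List (Fin n) × List (Fin n)))
    (hPA : W.length + A.length + S.length + 1 ≤ P) (hPB : W.length + B.length + S.length + 1 ≤ P) :
    Spec Cov (searchSplit S W A B best) (fun res =>
      (res = best ∨ ∃ A' B', (A' ++ B').Perm (W ++ (A ++ B)) ∧ Balanced A' B' ∧
        res = some (setRank Cov (A' ++ S).toFinset (B' ++ S).toFinset, A', B')) ∧
      (∀ old, best = some old → ∃ new, res = some new ∧ new.1 ≤ old.1) ∧
      ∀ p : Fin n → Bool, Balanced ((W.filter p) ++ A) ((W.filter fun v => !p v) ++ B) →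
        ∃ new, res = some new ∧ new.1 ≤ setRank Cov (W.filter p ++ A ++ S).toFinset
          ((W.filter fun v => !p v) ++ B ++ S).toFinset)
      (2 ^ W.length * P ^ 2) (2 ^ W.length * (20 * P ^ 3) - 1) := by
  have hP1 : 1 ≤ P := by omega
  have hP3 : P ≤ P ^ 3 := Nat.le_self_pow (by norm_num) P
  induction W generalizing A B best with
  | nil =>
    simp only [List.length_nil, zero_add, pow_zero, one_mul] at hPA hPB ⊢
    refine Spec.le (spec_bind (spec_size A) (q₂ := P ^ 2) (t₂ := P + (2 * P + 12 * P ^ 3 + 1))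
      fun a ha => ?_) (by simp) (by omega)
    refine Spec.le (spec_bind (spec_size B) (q₂ := P ^ 2) (t₂ := 2 * P + 12 * P ^ 3 + 1)
      fun b hb => ?_) (by simp) (by omega)
    subst ha hb
    refine spec_step_bind ?_
    split_ifs with hbal
    · refine Spec.le (spec_bind (spec_append A S) (q₂ := P ^ 2) (t₂ := P + 12 * P ^ 3)
        fun AS hAS => ?_) (by simp) (by omega)
      refine Spec.le (spec_bind (spec_append B S) (q₂ := P ^ 2) (t₂ := 12 * P ^ 3)
        fun BS hBS => ?_) (by simp) (by omega)
      subst hAS hBS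
      refine Spec.le (spec_bind (spec_covRank (A ++ S) (B ++ S) hP1 (by simp; omega)
        (by simp; omega)) (q₂ := 0) (t₂ := 0) fun q hq => ?_) le_rfl le_rfl
      cases best with
      | none =>
        refine spec_pure ⟨Or.inr ⟨A, B, by simp, hbal, by rw [hq]⟩, by simp, fun p _ => ?_⟩
        exact ⟨_, rfl, by simp [hq]⟩
      | some old =>
        dsimp only
        by_cases hlt : q < old.1
        · rw [if_pos hlt]
          refine spec_pure ⟨Or.inr ⟨A, B, by simp, hbal, by rw [hq]⟩, ?_, fun p _ => ?_⟩
          · intro old' h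
            rw [Option.some.injEq] at h
            exact ⟨_, rfl, h ▸ hlt.le⟩
          · exact ⟨_, rfl, by simp [hq]⟩
        · rw [if_neg hlt]
          refine spec_pure ⟨Or.inl rfl, ?_, fun p _ => ?_⟩
          · intro old' h
            rw [Option.some.injEq] at h
            exact ⟨_, rfl, h ▸ le_rfl⟩
          · refine ⟨_, rfl, ?_⟩
            have := not_lt.1 hlt
            rw [hq] at this
            simpa using this
    · refine spec_pure_le ⟨Or.inl rfl, fun old h => ⟨old, h, le_rfl⟩, fun p hp => ?_⟩
      exact absurd (by simpa [Balanced] using hp) hbal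
  | cons w W ih =>
    simp only [List.length_cons] at hPA hPB
    have hpow : 1 ≤ 2 ^ W.length * (20 * P ^ 3) :=
      Nat.mul_pos (by positivity) (by positivity)
    refine Spec.le (spec_step_bind (spec_bind (ih (w :: A) B best (by simp; omega)
      (by simp; omega)) fun best₁ h₁ => Spec.mono (ih A (w :: B) best₁ (by simp; omega)
        (by simp; omega)) (fun res h₂ => ?_) le_rfl le_rfl)) ?_ ?_
    · obtain ⟨a1, a2, a3⟩ := h₁
      obtain ⟨b1, b2, b3⟩ := h₂
      refine ⟨?_, ?_, ?_⟩
      · rcases b1 with b1 | ⟨A', B', hp, hb, hr⟩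
        · rcases a1 with a1 | ⟨A', B', hp, hb, hr⟩
          · exact Or.inl (b1.trans a1)
          · refine Or.inr ⟨A', B', hp.trans ?_, hb, b1.trans hr⟩
            rw [List.cons_append]
            exact List.perm_middle
        · refine Or.inr ⟨A', B', hp.trans ?_, hb, hr⟩
          refine (List.Perm.append_left W List.perm_middle).trans ?_
          exact List.perm_middle
      · intro old hold
        obtain ⟨n1, h1, h1'⟩ := a2 old hold
        obtain ⟨n2, h2, h2'⟩ := b2 n1 h1
        exact ⟨n2, h2, h2'.trans h1'⟩
      · intro p hp
        cases hw : p w with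
        | true =>
          simp only [List.filter_cons, hw, if_true, Bool.not_true, Bool.false_eq_true,
            if_false] at hp ⊢
          obtain ⟨n1, h1, h1'⟩ := a3 p
            (by simpa [Balanced, add_assoc, add_comm, add_left_comm] using hp)
          obtain ⟨n2, h2, h2'⟩ := b2 n1 h1
          refine ⟨n2, h2, h2'.trans (h1'.trans (le_of_eq ?_))⟩
          congr 1
          ext x
          simp only [List.mem_toFinset, List.mem_append, List.mem_cons]
          tauto
        | false =>
          simp only [List.filter_cons, hw, if_true, Bool.not_false, Bool.false_eq_true,
            if_false] at hp ⊢
          obtain ⟨n2, h2, h2'⟩ := b3 p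
            (by simpa [Balanced, add_assoc, add_comm, add_left_comm] using hp)
          refine ⟨n2, h2, h2'.trans (le_of_eq ?_)⟩
          congr 1
          ext x
          simp only [List.mem_toFinset, List.mem_append, List.mem_cons]
          tauto
    · rw [List.length_cons, pow_succ 2 W.length, mul_right_comm]
      omega
    · rw [List.length_cons, pow_succ 2 W.length, mul_right_comm]
      omega

end Procedures

/-! ### Splitting off components -/

section Components

variable {n : ℕ} {G : SimpleGraph (Fin n)} {Cov : Matrix (Fin n) (Fin n) ℝ}

/-- The part of `separator` that follows the sampling. -/
def separatorOf (V S W : List (Fin n)) : Prog n ℝ (List (Fin n)) := do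
  let best ← searchSplit S W [] [] none
  match best with
  | none => abSeparator V W [] S
  | some res => abSeparator V res.2.1 res.2.2 S

/-- The part of `components` that follows the choice of the separator. -/
def componentsOf (V S S₁ : List (Fin n)) : Prog n ℝ (List (Fin n) × List (List (Fin n))) := do
  let SS ← append S₁ S
  let r ← size SS
  let rest ← filterEach V (fun v => do
    let b ← member v S₁
    pure (!b))
  let comps ← forEach rest ([] : List (Fin n × List (Fin n))) (fun cs v => do
    let res ← place SS r v cs
    pure (if res.1 then (v, [v]) :: res.2 else res.2))
  let Cs ← mapEach comps (fun uC => pure uC.2)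
  pure (S₁, Cs)

theorem components_eq (m : ℕ) (V S : List (Fin n)) :
    (components m V S : Prog n ℝ _) =
      sample m V >>= fun W => separatorOf V S W >>= componentsOf V S := by
  rw [← Prog.assoc]
  rfl

/-- Every large enough set of vertices has a balanced bipartition with a separator of size at most
`κ`. -/
def HasBalancedSeparators (G : SimpleGraph (Fin n)) (κ : ℕ) : Prop :=
  ∀ W : List (Fin n), W.Nodup → 2 ≤ W.length → ∃ p : Fin n → Bool,
    Balanced (W.filter p) (W.filter fun v => !p v) ∧ ∃ X : Finset (Fin n), X.card ≤ κ ∧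
      Separates G X (W.filter p).toFinset (W.filter fun v => !p v).toFinset

theorem Generic.setRank_append_le (hgen : Generic G Cov) {A B S : List (Fin n)}
    {X : Finset (Fin n)} (hX : Separates G X A.toFinset B.toFinset) :
    setRank Cov (A ++ S).toFinset (B ++ S).toFinset ≤ S.length + X.card := by
  rw [List.toFinset_append, List.toFinset_append]
  have h1 : Separates G (X ∪ S.toFinset) A.toFinset B.toFinset := fun a ha b hb p => by
    obtain ⟨v, hv, hvX⟩ := hX a ha b hb p
    exact ⟨v, hv, Finset.mem_union_left _ hvX⟩
  refine (hgen.setRank_le (h1.union Finset.subset_union_right)).trans ?_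
  refine (Finset.card_union_le _ _).trans ?_
  have := S.toFinset_card_le
  omega

/-- The separator has at most `κ` vertices, whether or not a balanced bipartition of the sample
exists; a sample of at least two vertices has one, and then its sides are separated. -/
theorem spec_separatorOf (hgen : Generic G Cov) {κ : ℕ} (hbal : HasBalancedSeparators G κ)
    {V S W : List (Fin n)} (hVn : V.Nodup) (hSn : S.Nodup)
    (hV : IsComp G S.toFinset V.toFinset) (hWn : W.Nodup) (hWV : ∀ w ∈ W, w ∈ V) {m P : ℕ}
    (hWm : W.length ≤ m) (hP : m + S.length + κ + 1 ≤ P) :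
    Spec Cov (separatorOf V S W) (fun C => C.Nodup ∧ (∀ c ∈ C, c ∈ V) ∧ C.length ≤ κ ∧
      (2 ≤ W.length → ∃ A B, (A ++ B).Perm W ∧ Balanced A B ∧
        Separates G (C.toFinset ∪ S.toFinset) A.toFinset B.toFinset))
      (2 ^ m * P ^ 2 + P ^ 2 * (2 * V.length + 1))
      (2 ^ m * (20 * P ^ 3) + 40 * (P ^ 3 * (V.length + 1))) := by
  have hpow : 2 ^ W.length ≤ 2 ^ m := Nat.pow_le_pow_right (by norm_num) hWm
  refine Spec.le (spec_bind (spec_searchSplit S W [] [] none (P := P) (by simp; omega)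
    (by simp; omega)) (q₂ := P ^ 2 * (2 * V.length + 1)) (t₂ := 40 * (P ^ 3 * (V.length + 1)))
      fun best hbest => ?_) ?_ ?_
  · obtain ⟨h1, -, h3⟩ := hbest
    cases best with
    | none =>
      have hr : setRank Cov (W ++ S).toFinset (([] : List (Fin n)) ++ S).toFinset ≤
          S.length + 0 := by
        simpa using hgen.setRank_append_le (A := W) (B := []) (S := S) (X := ∅)
          (by simp [Separates])
      refine Spec.mono (spec_abSeparator hgen hVn hSn hV hWV (hr.trans (by omega)) (κ := κ)
        (by omega) (by simp; omega)) ?_ le_rfl le_rfl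
      rintro C ⟨a1, a2, a3, a4⟩
      refine ⟨a1, a2, by omega, fun hW => ?_⟩
      exfalso
      obtain ⟨p, hp, -⟩ := hbal W hWn hW
      obtain ⟨new, hnew, -⟩ := h3 p (by simpa using hp)
      simp at hnew
    | some res =>
      rcases h1 with h1 | ⟨A, B, hperm, hb, hres⟩
      · simp at h1
      · rw [Option.some.injEq] at hres
        subst hres
        simp only [List.append_nil] at hperm
        have hlen := hperm.length_eq
        rw [List.length_append] at hlen
        have hr : setRank Cov (A ++ S).toFinset (B ++ S).toFinset ≤ S.length + κ := by
          by_cases hW : 2 ≤ W.length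
          · obtain ⟨p, hp, X, hX, hsep⟩ := hbal W hWn hW
            obtain ⟨new, hnew, hle⟩ := h3 p (by simpa using hp)
            rw [Option.some.injEq] at hnew
            subst hnew
            simp only [List.append_nil] at hle
            refine hle.trans ((hgen.setRank_append_le hsep).trans (by omega))
          · have : A.length = 0 ∧ B.length = 0 := by
              have := hb.1
              have := hb.2
              omega
            have hA : A = [] := List.length_eq_zero_iff.1 this.1
            have := hgen.setRank_append_le (A := A) (B := B) (S := S) (X := ∅)
              (by simp [hA, Separates])
            simp only [Finset.card_empty] at this
            omega
        refine Spec.mono (spec_abSeparator hgen hVn hSn hV (A := A) (B := B) (fun a ha => hWV a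
          (hperm.subset (by simp [ha]))) hr (by omega) (by omega)) ?_ le_rfl le_rfl
        rintro C ⟨a1, a2, a3, a4⟩
        exact ⟨a1, a2, by omega, fun _ => ⟨A, B, hperm, hb, a3⟩⟩
  · gcongr
  · have : 2 ^ W.length * (20 * P ^ 3) ≤ 2 ^ m * (20 * P ^ 3) := by gcongr
    omega

open Classical in
/-- The vertex `v` joins the classes whose representative it is linked to; the flag says whether
there is none. -/
theorem spec_place (hgen : Generic G Cov) {SS : List (Fin n)} (hSS : SS.Nodup) (v : Fin n)
    (cs : List (Fin n × List (Fin n))) (hcs : ∀ uC ∈ cs, uC.1 ∉ SS) {σ : ℕ}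
    (hσ : SS.length + 1 ≤ σ) :
    Spec Cov (place SS SS.length v cs)
      (· = (decide (∀ uC ∈ cs, ¬ Linked G SS.toFinset uC.1 v),
        cs.map fun uC => if Linked G SS.toFinset uC.1 v then (uC.1, v :: uC.2) else uC))
      (cs.length * σ ^ 2) (cs.length * (12 * σ ^ 3 + 1)) := by
  induction cs with
  | nil => exact spec_pure_le (by simp)
  | cons uC cs ih =>
    refine Spec.le (spec_step_bind (spec_bind (spec_covRank (uC.1 :: SS) (v :: SS) (s := σ)
      (by omega) (by simpa using hσ) (by simpa using hσ)) fun q hq => spec_bind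
        (ih fun uC h => hcs uC (by simp [h])) fun res hres => spec_pure ?_)) ?_ ?_
    · have h1 := hgen.setRank_insert_eq_iff (T := SS.toFinset) (u := uC.1) (v := v)
        (by simpa using hcs uC (by simp))
      rw [List.toFinset_card_of_nodup hSS, ← List.toFinset_cons, ← List.toFinset_cons, ← hq] at h1
      subst hres
      by_cases hl : Linked G SS.toFinset uC.1 v
      · rw [if_pos (h1.2 hl)]
        simp [hl]
      · rw [if_neg (fun h => hl (h1.1 h))]
        simp [hl]
    · simp; ring_nf; omega
    · simp; ring_nf; omega

/-- What `components` guarantees: `V` is split into a small set `S₁` and the components of the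
graph without `S₁` and `S` that lie in `V`. -/
def CompOutput (G : SimpleGraph (Fin n)) (κ : ℕ) (V S : List (Fin n))
    (res : List (Fin n) × List (List (Fin n))) : Prop :=
  res.1.length ≤ κ ∧ (res.1 ++ res.2.flatten).Perm V ∧
    ∀ C ∈ res.2, IsComp G (res.1 ++ S).toFinset C.toFinset

open Classical in
/-- The classes found so far have pairwise separated representatives in `V`, so that the bound on
the degree bounds their number by `τ`. This makes the cost linear in `V.length`. -/
theorem spec_componentsOf [DecidableRel G.Adj] (hgen : Generic G Cov) {d : ℕ}
    (hd : G.maxDegree ≤ d) {V S S₁ : List (Fin n)} (hVn : V.Nodup) (hSn : S.Nodup)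
    (hV : IsComp G S.toFinset V.toFinset) (hS₁n : S₁.Nodup) (hS₁V : ∀ s ∈ S₁, s ∈ V) {κ σ τ : ℕ}
    (hκ : S₁.length ≤ κ) (hσ : S.length + κ + 1 ≤ σ) (hτ : d * κ + 1 ≤ τ) :
    Spec Cov (componentsOf V S S₁) (fun res => res.1 = S₁ ∧ CompOutput G κ V S res)
      (V.length * (τ * σ ^ 2)) (20 * (τ * σ ^ 3 * (V.length + 1))) := by
  have hdisj : ∀ s ∈ S₁, s ∉ S := fun s hs => by
    simpa using hV.notMem (by simpa using hS₁V s hs)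
  have hSSn : (S₁ ++ S).Nodup := List.nodup_append'.2 ⟨hS₁n, hSn, fun s hs hs' => hdisj s hs hs'⟩
  set T := (S₁ ++ S).toFinset with hT
  have hTS : T = S₁.toFinset ∪ S.toFinset := List.toFinset_append
  have hlenN : ∀ p, (V.filter p).length ≤ V.length := fun p => List.length_filter_le _ _
  have hN : V.length ≤ V.length := le_rfl
  refine Spec.le (spec_bind (spec_append S₁ S) (q₂ := V.length * (τ * σ ^ 2)) (t₂ := σ +
    (V.length * (κ + 1) + (V.length * (τ * (12 * σ ^ 3 + 1) + 1) + τ)))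
      fun SS hSS => ?_) (by simp) ?_
  swap
  · have e1 : S₁.length ≤ σ := by omega
    have e2 : κ + 1 ≤ σ := by omega
    have hσ3 : σ ≤ σ ^ 3 := Nat.le_self_pow (by norm_num) σ
    have hσ1 : 1 ≤ σ ^ 3 := by omega
    have hτ1 : 1 ≤ τ := by omega
    have e3 : σ ^ 3 ≤ τ * σ ^ 3 := Nat.le_mul_of_pos_left _ hτ1
    have e4 : τ ≤ τ * σ ^ 3 := Nat.le_mul_of_pos_right _ hσ1
    have e5 : V.length * (κ + 1) ≤ V.length * (τ * σ ^ 3) := Nat.mul_le_mul_left _ (by omega)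
    have e6 : V.length * (τ * (12 * σ ^ 3 + 1) + 1) ≤ V.length * (14 * (τ * σ ^ 3)) :=
      Nat.mul_le_mul_left _ (by
        have : τ * (12 * σ ^ 3 + 1) = 12 * (τ * σ ^ 3) + τ := by ring
        omega)
    have e7 : 20 * (τ * σ ^ 3 * (V.length + 1)) =
      20 * (V.length * (τ * σ ^ 3)) + 20 * (τ * σ ^ 3) := by ring
    have e8 : V.length * (14 * (τ * σ ^ 3)) = 14 * (V.length * (τ * σ ^ 3)) := by ring
    rw [e7]
    omega
  refine Spec.le (spec_bind (spec_size SS) (q₂ := V.length * (τ * σ ^ 2)) (t₂ :=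
    V.length * (κ + 1) + (V.length * (τ * (12 * σ ^ 3 + 1) + 1) + τ))
      fun r hr => ?_) (by simp) (by rw [hSS, List.length_append]; omega)
  subst hr hSS
  refine Spec.le (spec_bind (spec_filterEach (fun v => !decide (v ∈ S₁)) 0 κ fun v _ => Spec.le
    (spec_bind (spec_member v S₁) (q₂ := 0) (t₂ := 0) fun b hb => spec_pure (by rw [hb]))
    le_rfl (by omega)) (q₂ := V.length * (τ * σ ^ 2))
    (t₂ := V.length * (τ * (12 * σ ^ 3 + 1) + 1) + τ) fun rest hrest => ?_) (by simp)
    (by omega)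
  have hmem : ∀ v, v ∈ rest ↔ v ∈ V ∧ v ∉ S₁ := by
    intro v; rw [hrest]; simp
  have hrn : rest.Nodup := hrest ▸ hVn.filter _
  have hrl : rest.length ≤ V.length := hrest ▸ List.length_filter_le _ _
  have hbound : ∀ cs : List (Fin n × List (Fin n)), (∀ uC ∈ cs, uC.1 ∈ rest) →
      (cs.Pairwise fun p q => ¬ Linked G T p.1 q.1) → cs.length ≤ τ := by
    intro cs h1 h2
    have := hV.length_le hd (X := S₁.toFinset) (fun s hs => by
      simpa using hS₁V s (by simpa using hs)) (L := cs.map Prod.fst) (fun u hu => by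
        obtain ⟨uC, huC, rfl⟩ := List.mem_map.1 hu
        simpa using (hmem _).1 (h1 uC huC)) (by rw [List.pairwise_map, ← hTS]; exact h2)
    rw [List.length_map, List.toFinset_card_of_nodup hS₁n] at this
    have h3 : d * S₁.length ≤ d * κ := Nat.mul_le_mul_left _ hκ
    omega
  have hrT : ∀ v ∈ rest, v ∉ T := by
    intro v hv
    obtain ⟨h1, h2⟩ := (hmem v).1 hv
    have h3 : v ∉ S := by simpa using hV.notMem (by simpa using h1)
    simp [hT, h2, h3]
  -- the classes list the processed vertices that are linked to their representatives
  refine Spec.le (spec_bind (spec_forEach_uniform (fun done (cs : List (Fin n × List (Fin n))) =>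
    (∀ uC ∈ cs, uC.1 ∈ done ∧ uC.2.Nodup ∧ ∀ w, w ∈ uC.2 ↔ w ∈ done ∧ Linked G T uC.1 w) ∧
    (cs.Pairwise fun p q => ¬ Linked G T p.1 q.1) ∧ ∀ w ∈ done, ∃ uC ∈ cs, w ∈ uC.2)
    (τ * σ ^ 2) (τ * (12 * σ ^ 3 + 1)) (by simp) ?_) (q₂ := 0) (t₂ := τ)
      fun comps hcomps => ?_) (Nat.mul_le_mul_right _ hrl)
        (Nat.add_le_add_right (Nat.mul_le_mul_right _ hrl) _)
  · rintro done v rest' cs hL ⟨h1, h2, h3⟩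
    have hdone : ∀ u ∈ done, u ∈ rest := fun u hu => by simp [hL, hu]
    have hv : v ∈ rest := by simp [hL]
    have hvd : v ∉ done := by
      intro h
      rw [hL] at hrn
      exact (List.nodup_append'.1 hrn).2.2 h (by simp)
    have hlen := hbound cs (fun uC h => hdone _ (h1 uC h).1) h2
    refine Spec.le (spec_bind (spec_place hgen hSSn v cs (fun uC h => by
      simpa [hT] using hrT _ (hdone _ (h1 uC h).1)) (σ := σ)
      (by rw [List.length_append]; omega)) (q₂ := 0) (t₂ := 0) fun res hres => spec_pure ?_)
        (Nat.mul_le_mul_right _ hlen) (Nat.mul_le_mul_right _ hlen)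
    subst hres
    have hstep : ∀ uC ∈ cs.map (fun uC => if Linked G T uC.1 v then (uC.1, v :: uC.2) else uC),
        uC.1 ∈ done ++ [v] ∧ uC.2.Nodup ∧
          ∀ w, w ∈ uC.2 ↔ w ∈ done ++ [v] ∧ Linked G T uC.1 w := by
      intro uC' huC'
      obtain ⟨uC, huC, rfl⟩ := List.mem_map.1 huC'
      obtain ⟨a1, a2, a3⟩ := h1 uC huC
      by_cases hl : Linked G T uC.1 v
      · simp only [hl, if_true]
        refine ⟨by simp [a1], List.nodup_cons.2 ⟨fun h => hvd ((a3 v).1 h).1, a2⟩, fun w => ?_⟩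
        rw [List.mem_cons, a3]
        simp only [List.mem_append, List.mem_singleton]
        constructor
        · rintro (rfl | ⟨b1, b2⟩)
          · exact ⟨Or.inr rfl, hl⟩
          · exact ⟨Or.inl b1, b2⟩
        · rintro ⟨b1 | rfl, b2⟩
          · exact Or.inr ⟨b1, b2⟩
          · exact Or.inl rfl
      · simp only [hl, if_false]
        refine ⟨by simp [a1], a2, fun w => ?_⟩
        rw [a3]
        simp only [List.mem_append, List.mem_singleton]
        constructor
        · rintro ⟨b1, b2⟩
          exact ⟨Or.inl b1, b2⟩
        · rintro ⟨b1 | rfl, b2⟩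
          · exact ⟨b1, b2⟩
          · exact absurd b2 hl
    have hfst : ∀ uC : Fin n × List (Fin n),
        (if Linked G T uC.1 v then (uC.1, v :: uC.2) else uC).1 = uC.1 := by
      intro uC
      split_ifs <;> rfl
    have hpair : (cs.map (fun uC => if Linked G T uC.1 v then (uC.1, v :: uC.2) else
        uC)).Pairwise fun p q => ¬ Linked G T p.1 q.1 := by
      rw [List.pairwise_map]
      simpa only [hfst] using h2
    have hcov : ∀ w ∈ done, ∃ uC ∈ cs.map (fun uC => if Linked G T uC.1 v then
        (uC.1, v :: uC.2) else uC), w ∈ uC.2 := by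
      intro w hw
      obtain ⟨uC, huC, hwC⟩ := h3 w hw
      refine ⟨_, List.mem_map_of_mem huC, ?_⟩
      split_ifs
      · simp [hwC]
      · exact hwC
    by_cases hall : ∀ uC ∈ cs, ¬ Linked G T uC.1 v
    · rw [if_pos (by simpa [hT] using hall)]
      refine ⟨?_, ?_, ?_⟩
      · intro uC huC
        rcases List.mem_cons.1 huC with rfl | huC
        · refine ⟨by simp, by simp, fun w => ?_⟩
          simp only [List.mem_singleton, List.mem_append]
          constructor
          · rintro rfl
            exact ⟨Or.inr rfl, Linked.refl (hrT _ hv)⟩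
          · rintro ⟨hw | hw, hl⟩
            · exfalso
              obtain ⟨uC, huC, hwC⟩ := h3 w hw
              exact hall uC huC ((((h1 uC huC).2.2 w).1 hwC).2.trans hl.symm)
            · exact hw
        · exact hstep uC huC
      · refine List.pairwise_cons.2 ⟨?_, hpair⟩
        intro uC' huC' hl
        obtain ⟨uC, huC, rfl⟩ := List.mem_map.1 huC'
        rw [hfst] at hl
        exact hall uC huC hl.symm
      · intro w hw
        rcases List.mem_append.1 hw with hw | hw
        · obtain ⟨uC, huC, h⟩ := hcov w hw
          exact ⟨uC, List.mem_cons_of_mem _ huC, h⟩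
        · exact ⟨(v, [v]), by simp, hw⟩
    · rw [if_neg (by simpa [hT] using hall)]
      refine ⟨hstep, hpair, ?_⟩
      intro w hw
      rcases List.mem_append.1 hw with hw | hw
      · exact hcov w hw
      · push Not at hall
        obtain ⟨uC, huC, hl⟩ := hall
        refine ⟨_, List.mem_map_of_mem huC, ?_⟩
        rw [List.mem_singleton] at hw
        rw [hw, if_pos hl]
        simp
  · obtain ⟨h1, h2, h3⟩ := hcomps
    have hlen := hbound comps (fun uC h => (h1 uC h).1) h2
    refine Spec.le (spec_bind (spec_mapEach (L := comps) Prod.snd 0 0 fun uC _ => spec_pure rfl)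
      (q₂ := 0) (t₂ := 0) fun Cs hCs => spec_pure ?_) (by simp) (by simpa using hlen)
    subst hCs
    have hflat : ∀ w, w ∈ (comps.map Prod.snd).flatten ↔ w ∈ rest := by
      intro w
      rw [List.mem_flatten]
      constructor
      · rintro ⟨C, hC, hw⟩
        obtain ⟨uC, huC, rfl⟩ := List.mem_map.1 hC
        exact (((h1 uC huC).2.2 w).1 hw).1
      · intro hw
        obtain ⟨uC, huC, h⟩ := h3 w hw
        exact ⟨uC.2, List.mem_map_of_mem huC, h⟩
    refine ⟨rfl, hκ, ?_, ?_⟩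
    · refine (List.perm_ext_iff_of_nodup (List.nodup_append'.2 ⟨hS₁n, ?_, ?_⟩) hVn).2 fun w => ?_
      · rw [List.nodup_flatten]
        refine ⟨fun C hC => ?_, ?_⟩
        · obtain ⟨uC, huC, rfl⟩ := List.mem_map.1 hC
          exact (h1 uC huC).2.1
        · rw [List.pairwise_map]
          refine List.Pairwise.imp_of_mem ?_ h2
          intro p q hp hq hpq w hw1 hw2
          exact hpq ((((h1 p hp).2.2 w).1 hw1).2.trans (((h1 q hq).2.2 w).1 hw2).2.symm)
      · intro w hw hw'
        exact ((hmem w).1 ((hflat w).1 hw')).2 hw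
      · rw [List.mem_append, hflat, hmem]
        by_cases hw : w ∈ S₁
        · simp [hw, hS₁V w hw]
        · simp [hw]
    · intro C hC
      obtain ⟨uC, huC, rfl⟩ := List.mem_map.1 hC
      obtain ⟨a1, a2, a3⟩ := h1 uC huC
      refine ⟨⟨uC.1, ?_⟩, fun v hv w => ?_⟩
      · rw [List.mem_toFinset, a3]
        exact ⟨a1, Linked.refl (hrT _ a1)⟩
      · rw [List.mem_toFinset, a3] at hv ⊢
        constructor
        · rintro ⟨b1, b2⟩
          exact hv.2.symm.trans b2
        · intro hl
          refine ⟨(hmem w).2 ⟨?_, ?_⟩, hv.2.trans hl⟩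
          · have hvV := ((hmem v).1 hv.1).1
            have := (hV.2 v (by simpa using hvV) w).2 (hl.mono (by
              rw [List.toFinset_append]; exact Finset.subset_union_right))
            simpa using this
          · have := hl.right_notMem
            simp only [List.mem_toFinset, List.mem_append, not_or] at this
            exact this.1

/-- One iteration of the loop in `sample`, for the list of vertices `v :: vs`. -/
def sampleStep (v : Fin n) (vs W : List (Fin n)) : Prog n ℝ (List (Fin n)) := do
  let i ← uniform vs.length
  let w := (v :: vs).getD i v
  let b ← member w W
  pure (if b then W else w :: W)

/-- The invariant of that loop, when `j` further draws follow. -/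
theorem spec_sampleStep {m j : ℕ} (v : Fin n) (vs W : List (Fin n)) (h : W.Nodup ∧
    (∀ w ∈ W, w ∈ v :: vs) ∧ W.length + (j + 1) ≤ m) :
    Spec Cov (sampleStep v vs W)
      (fun W => W.Nodup ∧ (∀ w ∈ W, w ∈ v :: vs) ∧ W.length + j ≤ m) 0 (1 + W.length) := by
  obtain ⟨h1, h2, h3⟩ := h
  refine Spec.le (spec_bind (Q := fun _ => True) (q₁ := 0) (t₁ := 1)
    (spec_draw fun i => spec_pure (Cov := Cov) trivial) (q₂ := 0) (t₂ := W.length)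
    fun i _ => ?_) le_rfl le_rfl
  refine Spec.le (spec_bind (spec_member _ W) (q₂ := 0) (t₂ := 0) fun b hb => spec_pure ?_)
    le_rfl le_rfl
  subst hb
  have hw : (v :: vs).getD (i : ℕ) v ∈ v :: vs := by
    rw [List.getD_eq_getElem _ _ (by simpa using i.is_le)]
    exact List.getElem_mem _
  by_cases hm : (v :: vs).getD (i : ℕ) v ∈ W
  · rw [if_pos (by simpa using hm)]
    exact ⟨h1, h2, by omega⟩
  · rw [if_neg (by simpa using hm)]
    refine ⟨List.nodup_cons.2 ⟨hm, h1⟩, fun w h => ?_, by rw [List.length_cons]; omega⟩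
    rcases List.mem_cons.1 h with rfl | h
    exacts [hw, h2 w h]

/-- Sampling from a list yields at most `m` entries of it, without repetition. -/
theorem spec_sample (m : ℕ) (V : List (Fin n)) :
    Spec Cov (sample m V) (fun W => W.Nodup ∧ (∀ w ∈ W, w ∈ V) ∧ W.length ≤ m) 0
      (V.length + m * (m + 3)) := by
  cases V with
  | nil => exact spec_pure_le (by simp)
  | cons v vs =>
    refine Spec.le (spec_bind (spec_size vs) (q₂ := 0) (t₂ := m * (m + 3)) fun N hN => ?_)
      (by simp) (by simp)
    subst hN
    refine Spec.mono (spec_forEach_uniform (f := fun W (_ : ℕ) => sampleStep v vs W)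
      (fun done W => W.Nodup ∧ (∀ w ∈ W, w ∈ v :: vs) ∧ W.length + (m - done.length) ≤ m) 0 (1 + m)
      (by simp) ?_) ?_ (by simp) ?_
    · rintro done a rest W hL ⟨h1, h2, h3⟩
      have hl := congrArg List.length hL
      simp only [List.length_range, List.length_append, List.length_cons] at hl
      refine Spec.mono (spec_sampleStep (m := m) (j := m - (done.length + 1)) v vs W
        ⟨h1, h2, by omega⟩) (fun W' h => ?_) le_rfl (by omega)
      simpa using h
    · rintro W ⟨h1, h2, h3⟩
      exact ⟨h1, h2, by omega⟩
    · rw [List.length_range]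
      exact Nat.mul_le_mul_left _ (by omega)

end Components

/-! ### Blocks of the concentration matrix -/

section Blocks

variable {n : ℕ} {G : SimpleGraph (Fin n)} {Cov : Matrix (Fin n) (Fin n) ℝ}

/-- Rows are determined by their products with a positive definite matrix. -/
theorem PosOn.cancel {R : Set (Fin n)} {D : Fin n → Fin n → ℝ} (h : PosOn R D) {P : Finset (Fin n)}
    (hP : ∀ i ∈ P, i ∈ R) {y y' : Fin n → ℝ}
    (he : ∀ j ∈ P, ∑ b ∈ P, y b * D b j = ∑ b ∈ P, y' b * D b j) : ∀ b ∈ P, y b = y' b := by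
  set x : Fin n → ℝ := fun i => if i ∈ P then y i - y' i else 0 with hx
  by_contra hcon
  push Not at hcon
  obtain ⟨b, hb, hne⟩ := hcon
  have hx0 : x ≠ 0 := by
    intro h0
    have := congrFun h0 b
    simp only [hx, hb, if_true, Pi.zero_apply] at this
    exact hne (sub_eq_zero.1 this)
  have := h x (fun i hi => if_neg fun hiP => hi (hP i hiP)) hx0
  refine this.ne' ?_
  rw [Finset.sum_comm]
  refine Finset.sum_eq_zero fun j _ => ?_
  by_cases hj : j ∈ P
  · rw [← Finset.sum_mul]
    have e : ∑ i, x i * D i j = ∑ b ∈ P, y b * D b j - ∑ b ∈ P, y' b * D b j := by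
      rw [← Finset.sum_sub_distrib, ← Finset.sum_subset (Finset.subset_univ P)]
      · exact Finset.sum_congr rfl fun i hi => by simp only [hx, hi, if_true]; ring
      · intro i _ hi
        simp [hx, hi]
    rw [e, he j hj, sub_self, zero_mul]
  · simp [hx, hj]

/-- The model: `K` is the inverse of the positive definite matrix `Cov`, with zeros at the
non-edges of `G`. -/
structure Concentration (G : SimpleGraph (Fin n)) (Cov : Matrix (Fin n) (Fin n) ℝ)
    (K : Fin n → Fin n → ℝ) : Prop where
  pos : PosOn Set.univ Cov
  inv : InvOff K ∅ Cov
  symm : ∀ i j, K i j = K j i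
  zero : ∀ i j, i ≠ j → ¬ G.Adj i j → K i j = 0

theorem concentration_of_mem_model (h : Cov ∈ Model G) :
    Concentration G Cov (Cov⁻¹ : Matrix (Fin n) (Fin n) ℝ) := by
  obtain ⟨hpos, hzero⟩ := h
  have hunit : IsUnit Cov.det := hpos.det_pos.ne'.isUnit
  have hsymm : ∀ i j, Cov i j = Cov j i := fun i j => by
    have := hpos.isHermitian.apply i j
    simpa using this.symm
  refine ⟨?_, ⟨hsymm, by simp, ?_⟩, ?_, hzero⟩
  · intro x _ hx
    have := hpos.dotProduct_mulVec_pos hx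
    simpa [dotProduct, Matrix.mulVec, Finset.mul_sum, mul_assoc] using this
  · intro i _ j _
    have := congrFun (congrFun (Matrix.nonsing_inv_mul Cov hunit) i) j
    rw [Matrix.mul_apply] at this
    rw [this, Matrix.one_apply]
  · intro i j
    have := hpos.inv.isHermitian.apply i j
    simpa using this.symm

variable {K : Fin n → Fin n → ℝ}

/-- The conditional covariance matrix given `S` inverts the principal submatrix outside `S`. -/
theorem Concentration.invOff (h : Concentration G Cov K) {S : List (Fin n)} (hS : S.Nodup) :
    InvOff K {i | i ∈ S} (elim S S Cov) := by
  have := h.inv.elim (by simpa using h.pos) S hS (by simp)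
  simpa using this

theorem Concentration.posOn (h : Concentration G Cov K) {S : List (Fin n)} (hS : S.Nodup) :
    PosOn {i | i ∉ S} (elim S S Cov) := by
  have := (h.pos.elim h.inv.symm S hS (by simp)).2.1
  refine this.mono ?_
  intro i hi
  exact ⟨trivial, hi⟩

theorem Concentration.pivots (h : Concentration G Cov K) {S P : List (Fin n)} (hS : S.Nodup)
    (hP : P.Nodup) (hPS : ∀ p ∈ P, p ∉ S) : Pivots P P (elim S S Cov) :=
  ((h.posOn hS).elim (h.invOff hS).symm P hP hPS).1

/-- Inside a component `V` of the graph without `S`, the concentration matrix inverts the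
conditional covariance matrix. -/
theorem Concentration.sum_comp (h : Concentration G Cov K) {S : List (Fin n)} (hS : S.Nodup)
    {V : Finset (Fin n)} (hV : IsComp G S.toFinset V) {i j : Fin n} (hi : i ∈ V) (hj : j ∉ S) :
    ∑ u ∈ V, K i u * elim S S Cov u j = if i = j then 1 else 0 := by
  have hiS : i ∉ S := by simpa using hV.notMem hi
  rw [← (h.invOff hS).mul i hiS j hj]
  refine Finset.sum_subset (Finset.subset_univ V) fun u _ hu => ?_
  by_cases huS : u ∈ S
  · rw [(h.invOff hS).zero u huS, mul_zero]
  · rw [h.zero i u (fun e => hu (e ▸ hi)) (hV.not_adj hi hu (by simpa using huS)), zero_mul]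

/-- If `C` is a component of the graph without `S₁` and `S`, the rows of `K` at `C` have their
nonzero entries in `C`, `S₁` and `S`. -/
theorem Concentration.sum_comp_add (h : Concentration G Cov K) {S S₁ : List (Fin n)}
    (hS : S.Nodup) (hS₁ : ∀ s ∈ S₁, s ∉ S) {C : Finset (Fin n)}
    (hC : IsComp G (S₁ ++ S).toFinset C) {i j : Fin n} (hi : i ∈ C) (hj : j ∈ S₁) :
    ∑ b ∈ S₁.toFinset, K i b * elim S S Cov b j = -∑ u ∈ C, K i u * elim S S Cov u j := by
  have hiS := hC.notMem hi
  simp only [List.mem_toFinset, List.mem_append, not_or] at hiS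
  have h0 := (h.invOff hS).mul i hiS.2 j (hS₁ j hj)
  rw [if_neg (by rintro rfl; exact hiS.1 hj)] at h0
  have hdisj : Disjoint S₁.toFinset C := Finset.disjoint_left.2 fun s hs hsC => by
    have := hC.notMem hsC
    simp only [List.mem_toFinset, List.mem_append, not_or] at this hs
    exact this.1 hs
  rw [eq_neg_iff_add_eq_zero, ← Finset.sum_union hdisj, ← h0]
  refine Finset.sum_subset (Finset.subset_univ _) fun u _ hu => ?_
  simp only [Finset.mem_union, List.mem_toFinset, not_or] at hu
  by_cases huS : u ∈ S
  · rw [(h.invOff hS).zero u huS, mul_zero]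
  · rw [h.zero i u (fun e => hu.2 (e ▸ hi)) (hC.not_adj hi hu.2 (by simp [huS, hu.1])), zero_mul]

/-- Right division by the conditional covariance matrix recovers a block of `K` from its product
with that matrix. -/
theorem Concentration.quotient_eq (h : Concentration G Cov K) {S P : List (Fin n)} (hS : S.Nodup)
    (hP : P.Nodup) (hPS : ∀ p ∈ P, p ∉ S) {X : Fin n → Fin n → ℝ} {i : Fin n}
    (hX : ∀ j ∈ P, X i j = ∑ b ∈ P.toFinset, K i b * elim S S Cov b j) :
    ∀ j ∈ P, quotient P (elim S S Cov) X i j = K i j := by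
  intro j hj
  refine (h.posOn hS).cancel (P := P.toFinset) (fun p hp => hPS p (by simpa using hp))
    (y := quotient P (elim S S Cov) X i) (y' := K i) (fun j hj => ?_) j (by simpa using hj)
  rw [List.mem_toFinset] at hj
  rw [quotient_mul X (h.pivots hS hP hPS) i hj, hX j hj]

end Blocks

/-! ### Combining the blocks -/

section Reconstruct

variable {n : ℕ} {G : SimpleGraph (Fin n)} {Cov : Matrix (Fin n) (Fin n) ℝ}
  {K : Fin n → Fin n → ℝ}

/-- The branch of `reconstruct` for small sets. -/
def smallCase (V S : List (Fin n)) (v : ℕ) : Prog n ℝ (Option (Sparse n ℝ)) := do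
  let D ← condCov S V V
  let I ← identity v
  let K ← rightDivide I D
  let T ← entries V V K
  pure (some T)

/-- The contribution of one component `C`, with the block `TC` of the concentration matrix. -/
def absorb (S S₁ : List (Fin n)) (s : ℕ) (D : List (List ℝ)) (Tacc : Sparse n ℝ × List (List ℝ))
    (C : List (Fin n)) (TC : Sparse n ℝ) : Prog n ℝ (Option (Sparse n ℝ × List (List ℝ))) := do
  let M ← condCov S C S₁
  let P ← sparseMul TC C M s
  let NP ← negate P
  let Q ← rightDivide NP D
  let TQ ← entriesSymm C S₁ Q
  let acc ← subTransposeMul Tacc.2 Q M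
  let T₁ ← append TQ Tacc.1
  let T₂ ← append TC T₁
  pure (some (T₂, acc))

/-- The loop over the components, with the recursive call as a parameter. -/
def absorbAll (rec : List (Fin n) → List (Fin n) → Prog n ℝ (Option (Sparse n ℝ)))
    (S S₁ SS : List (Fin n)) (s : ℕ) (D I : List (List ℝ)) (Cs : List (List (Fin n))) :
    Prog n ℝ (Option (Sparse n ℝ × List (List ℝ))) :=
  forEach Cs (some (([] : Sparse n ℝ), I)) (fun st C =>
    match st with
    | none => pure none
    | some Tacc => do
        let KC ← rec C SS
        match KC with
        | none => pure none
        | some TC => absorb S S₁ s D Tacc C TC)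

/-- The last part of `reconstruct`. -/
def finish (S₁ : List (Fin n)) (D : List (List ℝ)) :
    Option (Sparse n ℝ × List (List ℝ)) → Prog n ℝ (Option (Sparse n ℝ))
  | none => pure none
  | some Tacc => do
      let KS ← rightDivide Tacc.2 D
      let TS ← entries S₁ S₁ KS
      let T ← append TS Tacc.1
      pure (some T)

/-- The part of `reconstruct` that follows the call of `components`. -/
def combine (rec : List (Fin n) → List (Fin n) → Prog n ℝ (Option (Sparse n ℝ)))
    (S : List (Fin n)) (res : List (Fin n) × List (List (Fin n))) :
    Prog n ℝ (Option (Sparse n ℝ)) := do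
  let SS ← append res.1 S
  let s ← size res.1
  let D ← condCov S res.1 res.1
  let I ← identity s
  let fin ← absorbAll rec S res.1 SS s D I res.2
  finish res.1 D fin

theorem reconstruct_succ (m depth : ℕ) (V S : List (Fin n)) :
    (reconstruct m (depth + 1) V S : Prog n ℝ _) = (do
      let v ← size V
      step
      if v ≤ m then smallCase V S v
      else components m V S >>= combine (reconstruct m depth) S) := by
  rw [reconstruct]
  refine congrArg (bind _) (funext fun v => congrArg (bind _) (funext fun _ => ?_))
  split_ifs
  · rfl
  · refine congrArg (bind _) (funext fun res => ?_)
    unfold combine absorbAll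
    refine congrArg (bind _) (funext fun SS => congrArg (bind _) (funext fun s =>
      congrArg (bind _) (funext fun D => congrArg (bind _) (funext fun I => ?_))))
    refine congrArg₂ bind (congrArg _ (funext fun st => funext fun C => ?_)) (funext fun st => ?_)
    · cases st with
      | none => rfl
      | some Tacc =>
        refine congrArg (bind _) (funext fun KC => ?_)
        cases KC with
        | none => rfl
        | some TC => rfl
    · cases st with
      | none => rfl
      | some Tacc => rfl

theorem spec_smallCase (hK : Concentration G Cov K) {V S : List (Fin n)} (hVn : V.Nodup)
    (hSn : S.Nodup) (hV : IsComp G S.toFinset V.toFinset) {P : ℕ}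
    (hP : S.length + V.length + 1 ≤ P) :
    Spec Cov (smallCase V S V.length)
      (fun res => ∃ T, res = some T ∧ Holds K (fun i j => i ∈ V ∧ j ∈ V) T)
      (P ^ 2) (80 * P ^ 3) := by
  have hVS : ∀ v ∈ V, v ∉ S := fun v hv => by simpa using hV.notMem (by simpa using hv)
  have hN := length_rowsOf (ρ := Fin n) (κ := Fin n)
  have hV1 : V.length + 1 ≤ P := by omega
  have hP3 : P ≤ P ^ 3 := Nat.le_self_pow (by norm_num) P
  have hP2 : P * P ≤ P ^ 3 := by rw [← pow_two]; exact Nat.pow_le_pow_right (by omega) (by omega)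
  have hN2 : V.length * (2 * V.length + 1) ≤ 2 * P ^ 3 := by
    have : V.length * (2 * V.length + 1) ≤ P * (2 * P) := Nat.mul_le_mul (by omega) (by omega)
    nlinarith
  have hR : 20 * ((V.length + 1) ^ 2 * (V.length + V.length + 1)) ≤ 40 * P ^ 3 := by
    have : (V.length + 1) ^ 2 * (V.length + V.length + 1) ≤ P ^ 2 * (2 * P) :=
      Nat.mul_le_mul (Nat.pow_le_pow_left hV1 2) (by omega)
    have e : P ^ 2 * (2 * P) = 2 * P ^ 3 := by ring
    omega
  have hx : 5 * ((S.length + 1) * (S.length + V.length + 1) * (S.length + V.length + 1)) ≤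
      5 * P ^ 3 := by
    have : (S.length + 1) * (S.length + V.length + 1) * (S.length + V.length + 1) ≤ P * P * P :=
      Nat.mul_le_mul (Nat.mul_le_mul (by omega) hP) hP
    have e : P * P * P = P ^ 3 := by ring
    omega
  refine Spec.le (spec_bind (spec_condCov S V V le_rfl le_rfl) (q₂ := 0) (t₂ := 44 * P ^ 3)
    fun D hD => ?_) ?_ (by omega)
  · subst hD
    refine Spec.le (spec_bind (spec_identity V hVn) (q₂ := 0) (t₂ := 42 * P ^ 3)
      fun I hI => ?_) le_rfl (by omega)
    subst hI
    refine Spec.le (spec_bind (spec_rightDivide hVn _ V _) (q₂ := 0) (t₂ := 2 * P ^ 3)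
      fun Q hQ => ?_) le_rfl (by omega)
    have e : Q = rowsOf K V V := by
      rw [hQ]
      refine rowsOf_congr fun i hi j hj => ?_
      refine hK.quotient_eq hSn hVn hVS (fun j hj => ?_) j hj
      rw [hK.sum_comp hSn hV (by simpa using hi) (hVS j hj)]
    subst e
    exact Spec.le (spec_bind (spec_entries hVn hVn) (q₂ := 0) (t₂ := 0)
      fun T hT => spec_pure ⟨T, rfl, hT⟩) le_rfl (by omega)
  · rw [add_zero, ← pow_two]
    exact Nat.pow_le_pow_left (by omega) 2

/-- The accumulated right-hand side for the last block. -/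
noncomputable def accMatrix (K D : Fin n → Fin n → ℝ) (L : List (Fin n)) : Fin n → Fin n → ℝ :=
  fun i j => (if i = j then 1 else 0) - (L.map fun c => K i c * D c j).sum

/-- Absorbing a component `C` records the block of `K` at `C`, computes the blocks between `C` and
`S₁`, and extends the accumulated sum from `L` to `L ++ C`. -/
theorem spec_absorb [DecidableRel G.Adj] (hK : Concentration G Cov K) {S S₁ C : List (Fin n)}
    (hSn : S.Nodup) (hS₁n : S₁.Nodup) (hCn : C.Nodup) (hS₁ : ∀ s ∈ S₁, s ∉ S)
    (hC : IsComp G (S₁ ++ S).toFinset C.toFinset) {d σ τ : ℕ} (hd : G.maxDegree ≤ d)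
    (hσ : S.length + S₁.length + 1 ≤ σ) (hτ : d + 1 ≤ τ)
    {L : List (Fin n)} {R : Fin n → Fin n → Prop} {T TC : Sparse n ℝ} (hT : Holds K R T)
    (hTC : Holds K (fun i j => i ∈ C ∧ j ∈ C) TC)
    (hR : ∀ i j, R i j → ¬ (i ∈ C ∨ j ∈ C)) :
    Spec Cov (absorb S S₁ S₁.length (rowsOf (elim S S Cov) S₁ S₁)
      (T, rowsOf (accMatrix K (elim S S Cov) L) S₁ S₁) C TC)
      (fun st => ∃ T', st = some (T', rowsOf (accMatrix K (elim S S Cov) (L ++ C)) S₁ S₁) ∧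
        Holds K (fun i j => (i ∈ C ∧ j ∈ C) ∨ ((i ∈ C ∧ j ∈ S₁) ∨ (i ∈ S₁ ∧ j ∈ C)) ∨ R i j) T')
      (2 * σ ^ 2 * C.length) (110 * (τ * σ ^ 3) * C.length) := by
  set D := elim S S Cov with hD
  obtain ⟨s, hs⟩ : ∃ s, S₁.length = s := ⟨_, rfl⟩
  obtain ⟨c, hc⟩ : ∃ c, C.length = c := ⟨_, rfl⟩
  have hCS₁ : ∀ i ∈ C, i ∉ S₁ := fun i hi h => by
    have := hC.notMem (by simpa using hi)
    simp [h] at this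
  have hc1 : 1 ≤ c := by
    obtain ⟨v, hv⟩ := hC.1
    exact hc ▸ List.length_pos_of_mem (by simpa using hv)
  have hs1 : s + 1 ≤ σ := by omega
  have hτ1 : 1 ≤ τ := by omega
  -- all costs are compared with multiples of `u = τ σ³ c`
  obtain ⟨u, hu⟩ : ∃ u, τ * σ ^ 3 * c = u := ⟨_, rfl⟩
  have hτσ : σ ^ 3 ≤ τ * σ ^ 3 := Nat.le_mul_of_pos_left _ hτ1
  have hσ3 : σ ≤ σ ^ 3 := Nat.le_self_pow (by norm_num) σ
  have hσ23 : σ ^ 2 ≤ σ ^ 3 := Nat.pow_le_pow_right (by omega) (by norm_num)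
  have b3 : σ ^ 3 * c ≤ u := hu ▸ Nat.mul_le_mul_right _ hτσ
  have b2 : σ ^ 2 * c ≤ u := (Nat.mul_le_mul_right _ hσ23).trans b3
  have b1 : σ * c ≤ u := (Nat.mul_le_mul_right _ hσ3).trans b3
  have b0 : c ≤ u := (Nat.le_mul_of_pos_left _ (by omega : 0 < σ)).trans b1
  have bσ : σ ≤ u := (Nat.le_mul_of_pos_right _ hc1).trans b1
  have bτσ : τ * σ * c ≤ u := by
    rw [← hu]
    exact Nat.mul_le_mul_right _ (Nat.mul_le_mul_left _ hσ3)
  have bτ : τ * c ≤ u := (Nat.mul_le_mul_right _ (Nat.le_mul_of_pos_right _ (by omega))).trans bτσ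
  have t1 : 5 * ((S.length + 1) * (σ + c + 1) * (σ + 1)) ≤ 30 * u := by
    have h1 : σ + c + 1 ≤ 3 * (σ * c) := by nlinarith
    have : (S.length + 1) * (σ + c + 1) * (σ + 1) ≤ σ * (3 * (σ * c)) * (2 * σ) :=
      Nat.mul_le_mul (Nat.mul_le_mul (by omega) h1) (by omega)
    have e : σ * (3 * (σ * c)) * (2 * σ) = 6 * (σ ^ 3 * c) := by ring
    omega
  have hTCl : TC.length ≤ c * τ :=
    (hTC.length_le (V := C) (fun i j h => h.1) G hd hK.zero).trans
      (hc ▸ Nat.mul_le_mul_left _ hτ)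
  have t2 : 3 * c + 2 * s + TC.length * (3 * s + 1) ≤ 8 * u := by
    have : TC.length * (3 * s + 1) ≤ c * τ * (3 * σ) := Nat.mul_le_mul hTCl (by omega)
    have e : c * τ * (3 * σ) = 3 * (τ * σ * c) := by ring
    omega
  have t3 : c * (3 * s + 1) ≤ 3 * u := by
    have : c * (3 * s + 1) ≤ c * (3 * σ) := Nat.mul_le_mul_left _ (by omega)
    have e : c * (3 * σ) = 3 * (σ * c) := by ring
    omega
  have t4 : 20 * ((s + 1) ^ 2 * (s + c + 1)) ≤ 40 * u := by
    have h1 : s + c + 1 ≤ 2 * (σ * c) := by nlinarith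
    have : (s + 1) ^ 2 * (s + c + 1) ≤ σ ^ 2 * (2 * (σ * c)) :=
      Nat.mul_le_mul (Nat.pow_le_pow_left hs1 2) h1
    have e : σ ^ 2 * (2 * (σ * c)) = 2 * (σ ^ 3 * c) := by ring
    omega
  have t5 : c * (2 * s + 1) ≤ 3 * u := (Nat.mul_le_mul_left _ (by omega)).trans t3
  have t6 : c * (s * (3 * s + 1) + 1) ≤ 4 * u := by
    have : s * (3 * s + 1) + 1 ≤ 4 * σ ^ 2 := by nlinarith
    have := Nat.mul_le_mul_left c this
    have e : c * (4 * σ ^ 2) = 4 * (σ ^ 2 * c) := by ring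
    omega
  have q1 : (σ + c) * σ ≤ 2 * σ ^ 2 * c := by
    have h1 : σ + c ≤ 2 * (σ * c) := by nlinarith
    calc (σ + c) * σ ≤ 2 * (σ * c) * σ := Nat.mul_le_mul_right _ h1
      _ = _ := by ring
  subst hs hc
  refine Spec.le (spec_bind (spec_condCov S C S₁ (x := σ + C.length) (y := σ) (by omega) (by omega))
    (q₂ := 0) (t₂ := 70 * u) fun M hM => ?_) ?_ ?_
  · refine Spec.le (spec_bind (Q := (· = rowsOf (fun i j => ∑ v ∈ C.toFinset, K i v * D v j) C S₁))
      (Spec.mono (q := 0) (t := 8 * u) (Spec.le (hM ▸ spec_sparseMul TC C S₁ D fun e he =>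
        ((hTC.2 e).1 he).1) le_rfl t2) ?_ le_rfl le_rfl) (q₂ := 0) (t₂ := 60 * u)
        fun P hP => ?_) le_rfl (by omega)
    · rintro _ rfl
      refine rowsOf_congr fun i hi j hj => ?_
      classical
      rw [hTC.sum_map (fun a b x => if a = i then x * D b j else 0) (by simp), Finset.sum_eq_single i]
      · simp only [hi, true_and, if_true]
        rw [← Finset.sum_filter]
        refine Finset.sum_congr ?_ fun _ _ => rfl
        ext x; simp
      · intro b _ hb
        simp [hb]
      · simp
    subst hP
    refine Spec.le (spec_bind (spec_negate _ C S₁) (q₂ := 0) (t₂ := 57 * u)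
      fun NP hNP => ?_) le_rfl (by omega)
    subst hNP
    refine Spec.le (spec_bind (spec_rightDivide hS₁n D C _) (q₂ := 0) (t₂ := 15 * u)
      fun Q hQ => ?_) le_rfl (by omega)
    have hQK : Q = rowsOf K C S₁ := by
      rw [hQ]
      refine rowsOf_congr fun i hi j hj => hK.quotient_eq hSn hS₁n hS₁ (fun j hj => ?_) j hj
      exact (hK.sum_comp_add hSn hS₁ hC (by simpa using hi) hj).symm
    subst hQK
    refine Spec.le (spec_bind (spec_entriesSymm hCn hS₁n hCS₁
      fun i _ j _ => ⟨rfl, hK.symm i j⟩) (q₂ := 0) (t₂ := 10 * u)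
      fun TQ hTQ => ?_) le_rfl (by omega)
    refine Spec.le (spec_bind (hM ▸ spec_subTransposeMul _ K D S₁ S₁ C) (q₂ := 0) (t₂ := 5 * u)
      fun acc hacc => ?_) le_rfl (by omega)
    have hTQl : TQ.length ≤ 3 * u := by
      have := hTQ.length_le (V := C ++ S₁) (fun i j h => by
        rcases h with h | h <;> simp [h.1]) G hd hK.zero
      refine this.trans ?_
      have h1 : (C ++ S₁).length * (d + 1) ≤ (2 * (σ * C.length)) * τ :=
        Nat.mul_le_mul (by rw [List.length_append]; nlinarith) hτ
      have e : 2 * (σ * C.length) * τ = 2 * (τ * σ * C.length) := by ring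
      omega
    refine Spec.le (spec_bind (spec_append TQ T) (q₂ := 0) (t₂ := u)
      fun T₁ hT₁ => ?_) le_rfl (by omega)
    refine Spec.le (spec_bind (spec_append TC T₁) (q₂ := 0) (t₂ := 0)
      fun T₂ hT₂ => spec_pure ?_) le_rfl (by rw [mul_comm] at hTCl; omega)
    subst hT₁ hT₂
    refine ⟨_, ?_, hTC.append (hTQ.append hT ?_) ?_⟩
    · rw [hacc]
      refine congrArg some (Prod.ext rfl (rowsOf_congr fun i hi j hj => ?_))
      simp only [accMatrix, List.map_append, List.sum_append, hK.symm _ i]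
      ring
    · rintro i j (⟨h1, h2⟩ | ⟨h1, h2⟩) h3
      · exact hR i j h3 (Or.inl h1)
      · exact hR i j h3 (Or.inr h2)
    · rintro i j ⟨h1, h2⟩ ((⟨h3, h4⟩ | ⟨h3, h4⟩) | h3)
      · exact hCS₁ j h2 h4
      · exact hCS₁ i h1 h3
      · exact hR i j h3 (Or.inl h1)
  · omega
  · have : 110 * (τ * σ ^ 3) * C.length = 110 * u := by rw [← hu]; ring
    omega

end Reconstruct

/-! ### Correctness and cost of the recursion -/

section Recursion

variable {n : ℕ} {G : SimpleGraph (Fin n)} {Cov : Matrix (Fin n) (Fin n) ℝ}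
  {K : Fin n → Fin n → ℝ}

/-- The loop over the components computes all blocks of `K` but the one at `S₁`, unless a recursive
call is cut off. -/
theorem spec_absorbAll [DecidableRel G.Adj] (hK : Concentration G Cov K) {S S₁ : List (Fin n)}
    {Cs : List (List (Fin n))} (hSn : S.Nodup) (hn : (S₁ ++ Cs.flatten).Nodup)
    (hS₁ : ∀ s ∈ S₁, s ∉ S) (hC : ∀ C ∈ Cs, IsComp G (S₁ ++ S).toFinset C.toFinset) {d σ τ : ℕ}
    (hd : G.maxDegree ≤ d) (hσ : S.length + S₁.length + 1 ≤ σ) (hτ : d + 1 ≤ τ)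
    {rec : List (Fin n) → List (Fin n) → Prog n ℝ (Option (Sparse n ℝ))} {q t : ℕ}
    (hrec : ∀ C ∈ Cs, Spec Cov (rec C (S₁ ++ S))
      (fun res => res = none ∨ ∃ T, res = some T ∧ Holds K (fun i j => i ∈ C ∧ j ∈ C) T)
      (q * C.length) (t * C.length)) :
    Spec Cov (absorbAll rec S S₁ (S₁ ++ S) S₁.length (rowsOf (elim S S Cov) S₁ S₁)
      (rowsOf (fun i j => if i = j then 1 else 0) S₁ S₁) Cs)
      (fun st => st = none ∨
        ∃ T, st = some (T, rowsOf (accMatrix K (elim S S Cov) Cs.flatten) S₁ S₁) ∧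
          Holds K (fun i j => (∃ C ∈ Cs, i ∈ C ∧ j ∈ C) ∨ (i ∈ Cs.flatten ∧ j ∈ S₁) ∨
            (i ∈ S₁ ∧ j ∈ Cs.flatten)) T)
      ((q + 2 * σ ^ 2) * Cs.flatten.length)
      ((t + 110 * (τ * σ ^ 3)) * Cs.flatten.length + Cs.length) := by
  obtain ⟨hS₁n, hFn, hdisj⟩ := List.nodup_append'.1 hn
  have hsum : ∀ a : ℕ, (Cs.map fun C => a * C.length).sum = a * Cs.flatten.length := by
    intro a
    rw [List.length_flatten, List.sum_map_mul_left]
  refine Spec.le (spec_forEach (fun done st => st = none ∨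
    ∃ T, st = some (T, rowsOf (accMatrix K (elim S S Cov) done.flatten) S₁ S₁) ∧
      Holds K (fun i j => (∃ C ∈ done, i ∈ C ∧ j ∈ C) ∨ (i ∈ done.flatten ∧ j ∈ S₁) ∨
        (i ∈ S₁ ∧ j ∈ done.flatten)) T)
    (fun C => (q + 2 * σ ^ 2) * C.length) (fun C => (t + 110 * (τ * σ ^ 3)) * C.length) ?_ ?_)
    (hsum _).le (Nat.add_le_add_right (hsum _).le _)
  · refine Or.inr ⟨[], congrArg some (Prod.ext rfl (rowsOf_congr fun i _ j _ => ?_)),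
      (Holds.nil K).congr (by simp)⟩
    simp [accMatrix]
  · rintro done C rest st hL hst
    have hCmem : C ∈ Cs := by simp [hL]
    rcases hst with rfl | ⟨T, rfl, hT⟩
    · exact spec_pure_le (Or.inl rfl)
    have hCn : C.Nodup := (List.nodup_flatten.1 hFn).1 C hCmem
    have hCdone : ∀ i ∈ done.flatten, i ∉ C := by
      intro i hi hiC
      rw [hL, List.flatten_append, List.flatten_cons] at hFn
      exact (List.nodup_append'.1 hFn).2.2 hi (by simp [hiC])
    have hCS₁ : ∀ i ∈ S₁, i ∉ C := fun i hi hiC =>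
      hdisj hi (List.mem_flatten.2 ⟨C, hCmem, hiC⟩)
    refine Spec.le (spec_bind (hrec C hCmem) (q₂ := 2 * σ ^ 2 * C.length)
      (t₂ := 110 * (τ * σ ^ 3) * C.length) fun KC hKC => ?_) (by rw [add_mul]) (by rw [add_mul])
    rcases hKC with rfl | ⟨TC, rfl, hTC⟩
    · exact spec_pure_le (Or.inl rfl)
    refine Spec.mono (spec_absorb hK hSn hS₁n hCn hS₁ (hC C hCmem) hd hσ hτ hT hTC ?_) ?_
      le_rfl le_rfl
    · rintro i j (⟨C', hC', h1, h2⟩ | ⟨h1, h2⟩ | ⟨h1, h2⟩) (h | h)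
      · exact hCdone i (List.mem_flatten.2 ⟨C', hC', h1⟩) h
      · exact hCdone j (List.mem_flatten.2 ⟨C', hC', h2⟩) h
      · exact hCdone i h1 h
      · exact hCS₁ j h2 h
      · exact hCS₁ i h1 h
      · exact hCdone j h2 h
    · rintro st ⟨T', rfl, hT'⟩
      refine Or.inr ⟨T', by simp, hT'.congr fun i j _ => ?_⟩
      have e1 : (∃ C' ∈ done ++ [C], i ∈ C' ∧ j ∈ C') ↔
          (∃ C' ∈ done, i ∈ C' ∧ j ∈ C') ∨ (i ∈ C ∧ j ∈ C) := by
        simp only [List.mem_append, List.mem_singleton, or_and_right, exists_or, exists_eq_left]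
      have e2 : ∀ i, i ∈ (done ++ [C]).flatten ↔ i ∈ done.flatten ∨ i ∈ C := by
        intro i
        rw [List.flatten_append, List.mem_append, List.flatten_singleton]
      rw [e1, e2, e2]
      generalize (∃ C' ∈ done, i ∈ C' ∧ j ∈ C') = E
      generalize (i ∈ done.flatten) = F
      generalize (j ∈ done.flatten) = F'
      clear * -
      grind

/-- The block at `S₁` is the accumulated right-hand side divided by the conditional covariance
matrix. -/
theorem spec_finish [DecidableRel G.Adj] (hK : Concentration G Cov K) {S S₁ V : List (Fin n)}
    {Cs : List (List (Fin n))} (hSn : S.Nodup) (hVn : V.Nodup)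
    (hV : IsComp G S.toFinset V.toFinset) (hperm : (S₁ ++ Cs.flatten).Perm V)
    (hC : ∀ C ∈ Cs, IsComp G (S₁ ++ S).toFinset C.toFinset) {d σ τ : ℕ}
    (hd : G.maxDegree ≤ d) (hσ : S₁.length + 1 ≤ σ) (hτ : d + 1 ≤ τ) {T : Sparse n ℝ}
    (hT : Holds K (fun i j => (∃ C ∈ Cs, i ∈ C ∧ j ∈ C) ∨ (i ∈ Cs.flatten ∧ j ∈ S₁) ∨
            (i ∈ S₁ ∧ j ∈ Cs.flatten)) T) :
    Spec Cov (finish S₁ (rowsOf (elim S S Cov) S₁ S₁)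
        (some (T, rowsOf (accMatrix K (elim S S Cov) Cs.flatten) S₁ S₁)))
      (fun res => ∃ T, res = some T ∧ Holds K (fun i j => i ∈ V ∧ j ∈ V) T)
      0 (50 * (τ * σ ^ 3)) := by
  obtain ⟨hS₁n, hFn, hdisj⟩ := List.nodup_append'.1 (hperm.nodup_iff.2 hVn)
  have hmem : ∀ v, v ∈ V ↔ v ∈ S₁ ∨ v ∈ Cs.flatten := fun v => by
    rw [← hperm.mem_iff, List.mem_append]
  have hVS : ∀ v ∈ V, v ∉ S := fun v hv => by simpa using hV.notMem (by simpa using hv)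
  have hS₁ : ∀ s ∈ S₁, s ∉ S := fun s hs => hVS s ((hmem s).2 (Or.inl hs))
  have hτ1 : 1 ≤ τ := by omega
  have hs3 : σ ^ 3 ≤ τ * σ ^ 3 := Nat.le_mul_of_pos_left _ hτ1
  have hs1 : σ ≤ σ ^ 3 := Nat.le_self_pow (by norm_num) σ
  have hτs : τ * σ ≤ τ * σ ^ 3 := Nat.mul_le_mul_left _ hs1
  have c1 : 20 * ((S₁.length + 1) ^ 2 * (S₁.length + S₁.length + 1)) ≤ 40 * (τ * σ ^ 3) := by
    have : (S₁.length + 1) ^ 2 * (S₁.length + S₁.length + 1) ≤ σ ^ 2 * (2 * σ) :=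
      Nat.mul_le_mul (Nat.pow_le_pow_left hσ 2) (by omega)
    have e : σ ^ 2 * (2 * σ) = 2 * σ ^ 3 := by ring
    omega
  have c2 : S₁.length * (2 * S₁.length + 1) ≤ 2 * (τ * σ ^ 3) := by
    have h1 : S₁.length * (2 * S₁.length + 1) ≤ σ * (2 * σ) :=
      Nat.mul_le_mul (by omega) (by omega)
    have h2 : σ ^ 2 ≤ σ ^ 3 := Nat.pow_le_pow_right (by omega) (by norm_num)
    have e : σ * (2 * σ) = 2 * σ ^ 2 := by ring
    omega
  refine Spec.le (spec_bind (spec_rightDivide hS₁n _ S₁ _) (q₂ := 0) (t₂ := 3 * (τ * σ ^ 3))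
    fun Q hQ => ?_) le_rfl (by omega)
  have e : Q = rowsOf K S₁ S₁ := by
    rw [hQ]
    refine rowsOf_congr fun i hi j hj => ?_
    refine hK.quotient_eq hSn hS₁n hS₁ (fun j hj => ?_) j hj
    have h1 := hK.sum_comp hSn hV (i := i) (j := j) (by simp [hmem, hi]) (hS₁ j hj)
    have h2 : V.toFinset = S₁.toFinset ∪ Cs.flatten.toFinset := by
      ext v
      simp only [List.mem_toFinset, Finset.mem_union, hmem]
    rw [h2, Finset.sum_union (Finset.disjoint_left.2 fun a ha ha' =>
      hdisj (by simpa using ha) (List.mem_toFinset.1 ha')), List.sum_toFinset _ hFn] at h1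
    rw [accMatrix, ← h1]
    ring
  subst e
  refine Spec.le (spec_bind (spec_entries hS₁n hS₁n) (q₂ := 0) (t₂ := τ * σ ^ 3)
    fun TS hTS => ?_) le_rfl (by omega)
  have hTSl : TS.length ≤ τ * σ ^ 3 := by
    have h1 := hTS.length_le (V := S₁) (fun i j h => h.1) G hd hK.zero
    have h2 : S₁.length * (d + 1) ≤ σ * τ := Nat.mul_le_mul (by omega) hτ
    rw [mul_comm σ] at h2
    omega
  refine Spec.le (spec_bind (spec_append TS T) (q₂ := 0) (t₂ := 0) fun T₁ hT₁ => spec_pure ?_)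
    le_rfl (by omega)
  subst hT₁
  refine ⟨_, rfl, (hTS.append hT ?_).congr fun i j hij => ?_⟩
  · rintro i j ⟨h1, h2⟩ (⟨C, hC', h3, h4⟩ | ⟨h3, h4⟩ | ⟨h3, h4⟩)
    · exact hdisj h1 (List.mem_flatten.2 ⟨C, hC', h3⟩)
    · exact hdisj h1 h3
    · exact hdisj h2 h4
  · rw [hmem, hmem]
    constructor
    · rintro (⟨h1, h2⟩ | ⟨C, hC', h3, h4⟩ | ⟨h3, h4⟩ | ⟨h3, h4⟩)
      · exact ⟨Or.inl h1, Or.inl h2⟩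
      · exact ⟨Or.inr (List.mem_flatten.2 ⟨C, hC', h3⟩), Or.inr (List.mem_flatten.2 ⟨C, hC', h4⟩)⟩
      · exact ⟨Or.inr h3, Or.inl h4⟩
      · exact ⟨Or.inl h3, Or.inr h4⟩
    · rintro ⟨h1 | h1, h2 | h2⟩
      · exact Or.inl ⟨h1, h2⟩
      · exact Or.inr (Or.inr (Or.inr ⟨h1, h2⟩))
      · exact Or.inr (Or.inr (Or.inl ⟨h1, h2⟩))
      · -- an entry between different components vanishes
        obtain ⟨C, hC', hiC⟩ := List.mem_flatten.1 h1
        refine Or.inr (Or.inl ⟨C, hC', hiC, ?_⟩)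
        by_contra hjC
        refine hij (hK.zero i j (fun e => hjC (e ▸ hiC)) ?_)
        refine (hC C hC').not_adj (by simpa using hiC) (by simpa using hjC) ?_
        simp only [List.mem_toFinset, List.mem_append, not_or]
        exact ⟨fun h => hdisj h h2, hVS j ((hmem j).2 (Or.inr h2))⟩

/-- If the recursive calls cost at most `q` queries and `t` steps per vertex, the combined call
needs at most `3 σ ^ 2` queries and `200 τ σ ^ 3` steps more per vertex. -/
theorem spec_combine [DecidableRel G.Adj] (hK : Concentration G Cov K) {S V : List (Fin n)}
    {res : List (Fin n) × List (List (Fin n))} {κ : ℕ} (hSn : S.Nodup) (hVn : V.Nodup)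
    (hV : IsComp G S.toFinset V.toFinset) (hres : CompOutput G κ V S res) {d σ τ : ℕ}
    (hd : G.maxDegree ≤ d) (hσ : S.length + κ + 1 ≤ σ) (hτ : d + 1 ≤ τ)
    {rec : List (Fin n) → List (Fin n) → Prog n ℝ (Option (Sparse n ℝ))} {q t : ℕ}
    (hrec : ∀ C ∈ res.2, Spec Cov (rec C (res.1 ++ S))
      (fun r => r = none ∨ ∃ T, r = some T ∧ Holds K (fun i j => i ∈ C ∧ j ∈ C) T)
      (q * C.length) (t * C.length)) :
    Spec Cov (combine rec S res)
      (fun r => r = none ∨ ∃ T, r = some T ∧ Holds K (fun i j => i ∈ V ∧ j ∈ V) T)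
      ((q + 3 * σ ^ 2) * V.length) ((t + 200 * (τ * σ ^ 3)) * V.length) := by
  obtain ⟨S₁, Cs⟩ := res
  obtain ⟨hκ, hperm, hC⟩ := hres
  simp only at hκ hperm hC hrec
  obtain ⟨hS₁n, hFn, hdisj⟩ := List.nodup_append'.1 (hperm.nodup_iff.2 hVn)
  have hmem : ∀ v, v ∈ V ↔ v ∈ S₁ ∨ v ∈ Cs.flatten := fun v => by
    rw [← hperm.mem_iff, List.mem_append]
  have hS₁ : ∀ s ∈ S₁, s ∉ S := fun s hs => by
    simpa using hV.notMem (by simpa using (hmem s).2 (Or.inl hs))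
  have hlen : Cs.flatten.length ≤ V.length := by
    rw [← hperm.length_eq, List.length_append]; omega
  have hCsl : Cs.length ≤ V.length := by
    refine le_trans ?_ hlen
    rw [List.length_flatten, ← List.length_map (f := List.length)]
    refine List.length_le_sum_of_one_le _ fun i hi => ?_
    obtain ⟨C, hC', rfl⟩ := List.mem_map.1 hi
    obtain ⟨v, hv⟩ := (hC C hC').1
    exact List.length_pos_of_mem (by simpa using hv)
  have hV1 : 1 ≤ V.length := by
    obtain ⟨v, hv⟩ := hV.1
    exact List.length_pos_of_mem (by simpa using hv)
  have hτ1 : 1 ≤ τ := by omega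
  have hs3 : σ ^ 3 ≤ τ * σ ^ 3 := Nat.le_mul_of_pos_left _ hτ1
  have hs1 : σ ≤ σ ^ 3 := Nat.le_self_pow (by norm_num) σ
  have hs2 : σ ^ 2 ≤ σ ^ 3 := Nat.pow_le_pow_right (by omega) (by norm_num)
  have c1 : 5 * ((S.length + 1) * (σ + 1) * (σ + 1)) ≤ 20 * (τ * σ ^ 3) := by
    have : (S.length + 1) * (σ + 1) * (σ + 1) ≤ σ * (2 * σ) * (2 * σ) :=
      Nat.mul_le_mul (Nat.mul_le_mul (by omega) (by omega)) (by omega)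
    have e : σ * (2 * σ) * (2 * σ) = 4 * σ ^ 3 := by ring
    omega
  have c2 : S₁.length * (2 * S₁.length + 1) ≤ 2 * (τ * σ ^ 3) := by
    have h1 : S₁.length * (2 * S₁.length + 1) ≤ σ * (2 * σ) :=
      Nat.mul_le_mul (by omega) (by omega)
    have e : σ * (2 * σ) = 2 * σ ^ 2 := by ring
    omega
  obtain ⟨u, hu⟩ : ∃ u, τ * σ ^ 3 = u := ⟨_, rfl⟩
  rw [hu] at c1 c2 hs3
  have hσu : 1 ≤ u := by omega
  refine Spec.le (spec_bind (spec_append S₁ S) (q₂ := σ * σ + (q + 2 * σ ^ 2) * Cs.flatten.length)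
    (t₂ := 74 * u + ((t + 110 * u) * Cs.flatten.length + Cs.length)) fun SS hSS => ?_)
    ?_ ?_
  · subst hSS
    refine Spec.le (spec_bind (spec_size S₁) (q₂ := σ * σ + (q + 2 * σ ^ 2) * Cs.flatten.length)
      (t₂ := 73 * u + ((t + 110 * u) * Cs.flatten.length + Cs.length)) fun s hs => ?_)
      (by omega) (by omega)
    subst hs
    refine Spec.le (spec_bind (spec_condCov S S₁ S₁ (x := σ) (y := σ) (by omega) (by omega))
      (q₂ := (q + 2 * σ ^ 2) * Cs.flatten.length)
      (t₂ := 53 * u + ((t + 110 * u) * Cs.flatten.length + Cs.length)) fun D hD => ?_)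
      le_rfl (by omega)
    subst hD
    refine Spec.le (spec_bind (spec_identity S₁ hS₁n) (q₂ := (q + 2 * σ ^ 2) * Cs.flatten.length)
      (t₂ := 50 * u + ((t + 110 * u) * Cs.flatten.length + Cs.length)) fun I hI => ?_)
      (by omega) (by omega)
    subst hI
    refine Spec.le (spec_bind (spec_absorbAll hK hSn (List.nodup_append'.2 ⟨hS₁n, hFn, hdisj⟩) hS₁
      hC hd (by omega) hτ hrec) (q₂ := 0) (t₂ := 50 * u) fun st hst => ?_) le_rfl
      (by rw [hu]; omega)
    rcases hst with rfl | ⟨T, rfl, hT⟩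
    · exact spec_pure_le (Or.inl rfl)
    · exact Spec.mono (spec_finish (σ := σ) hK hSn hVn hV hperm hC hd (by omega) hτ hT)
        (fun r hr => Or.inr hr) le_rfl (by rw [hu])
  · have h1 : (q + 2 * σ ^ 2) * Cs.flatten.length ≤ (q + 2 * σ ^ 2) * V.length :=
      Nat.mul_le_mul_left _ hlen
    have h2 : σ * σ ≤ σ ^ 2 * V.length := by
      rw [← pow_two]; exact Nat.le_mul_of_pos_right _ hV1
    have e : (q + 3 * σ ^ 2) * V.length = (q + 2 * σ ^ 2) * V.length + σ ^ 2 * V.length := by ring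
    omega
  · rw [hu]
    have h1 : (t + 110 * u) * Cs.flatten.length ≤ (t + 110 * u) * V.length :=
      Nat.mul_le_mul_left _ hlen
    have h2 : u ≤ u * V.length := Nat.le_mul_of_pos_right _ hV1
    have h3 : V.length ≤ u * V.length := Nat.le_mul_of_pos_left _ hσu
    have e : (t + 200 * u) * V.length = (t + 110 * u) * V.length + 90 * (u * V.length) := by ring
    omega

/-- Every execution returns the block of the concentration matrix or is cut off; the cost is
proportional to the depth of the recursion and to the number of vertices. Here `σ` bounds the size
of the conditioning sets and `τ` the number of components. -/
theorem spec_reconstruct [DecidableRel G.Adj] (hK : Concentration G Cov K)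
    (hgen : Generic G Cov) {κ : ℕ} (hbal : HasBalancedSeparators G κ) {d σ τ : ℕ}
    (hd : G.maxDegree ≤ d) (hτ : d * κ + 1 ≤ τ) (hτd : d + 1 ≤ τ) (m depth : ℕ) :
    ∀ V S : List (Fin n), V.Nodup → S.Nodup → IsComp G S.toFinset V.toFinset →
      S.length + depth * κ + 1 ≤ σ →
      Spec Cov (reconstruct m depth V S)
        (fun r => r = none ∨ ∃ T, r = some T ∧ Holds K (fun i j => i ∈ V ∧ j ∈ V) T)
        (depth * (4 * (2 ^ m * (m + σ) ^ 2) + 4 * (τ * σ ^ 2)) * V.length)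
        (depth * (200 * (2 ^ m * (m + σ) ^ 3) + 300 * (τ * σ ^ 3)) * V.length) := by
  induction depth with
  | zero =>
    intro V S _ _ _ _
    exact spec_pure_le (Or.inl rfl)
  | succ depth ih =>
    intro V S hVn hSn hV hσ
    have hV1 : 1 ≤ V.length := by
      obtain ⟨v, hv⟩ := hV.1
      exact List.length_pos_of_mem (by simpa using hv)
    have hσ' : S.length + depth * κ + κ + 1 ≤ σ := by
      rw [Nat.succ_mul] at hσ; omega
    obtain ⟨cq, hcq⟩ : ∃ cq, 4 * (2 ^ m * (m + σ) ^ 2) + 4 * (τ * σ ^ 2) = cq := ⟨_, rfl⟩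
    obtain ⟨ct, hct⟩ : ∃ ct, 200 * (2 ^ m * (m + σ) ^ 3) + 300 * (τ * σ ^ 3) = ct := ⟨_, rfl⟩
    rw [hcq, hct]
    simp only [hcq, hct] at ih
    have h2m : 1 ≤ 2 ^ m := Nat.one_le_two_pow
    have hPP : (m + σ) ^ 3 ≤ 2 ^ m * (m + σ) ^ 3 := Nat.le_mul_of_pos_left _ h2m
    have hPP2 : (m + σ) ^ 2 ≤ 2 ^ m * (m + σ) ^ 2 := Nat.le_mul_of_pos_left _ h2m
    have hP1 : 1 ≤ (m + σ) ^ 3 := Nat.one_le_pow _ _ (by omega)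
    have hτσ : 1 ≤ τ * σ ^ 2 := Nat.mul_pos (by omega) (pow_pos (by omega) 2)
    obtain ⟨N, hN⟩ : ∃ N, V.length = N := ⟨_, rfl⟩
    rw [reconstruct_succ]
    refine Spec.le (spec_bind (spec_size V) (q₂ := (depth + 1) * cq * N)
      (t₂ := (depth * ct + 199 * (2 ^ m * (m + σ) ^ 3) + 300 * (τ * σ ^ 3)) * N) fun v hv => ?_)
      (by simp [hN]) ?_
    swap
    · have h1 : N ≤ 2 ^ m * (m + σ) ^ 3 * N := Nat.le_mul_of_pos_left _ (by omega)
      have e : (depth + 1) * ct * N = (depth * ct + 199 * (2 ^ m * (m + σ) ^ 3) +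
          300 * (τ * σ ^ 3)) * N + 2 ^ m * (m + σ) ^ 3 * N := by
        rw [← hct]; ring
      simp only [hN]
      omega
    subst hv
    refine Spec.le (spec_step_bind (q := (depth + 1) * cq * N)
      (t := (depth * ct + 198 * (2 ^ m * (m + σ) ^ 3) + 300 * (τ * σ ^ 3)) * N) ?_) le_rfl ?_
    swap
    · have h1 : 1 ≤ 2 ^ m * (m + σ) ^ 3 * N := Nat.mul_pos (by omega) (by omega)
      have e : (depth * ct + 199 * (2 ^ m * (m + σ) ^ 3) + 300 * (τ * σ ^ 3)) * N =
          (depth * ct + 198 * (2 ^ m * (m + σ) ^ 3) + 300 * (τ * σ ^ 3)) * N +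
            2 ^ m * (m + σ) ^ 3 * N := by ring
      omega
    split_ifs with hVm
    · refine Spec.mono (spec_smallCase hK hVn hSn hV (P := m + σ) (by omega))
        (fun r hr => Or.inr hr) ?_ ?_
      · calc (m + σ) ^ 2 ≤ 1 * cq * 1 := by omega
          _ ≤ (depth + 1) * cq * N :=
            Nat.mul_le_mul (Nat.mul_le_mul_right _ (by omega)) (by omega)
      · calc 80 * (m + σ) ^ 3 ≤
              (depth * ct + 198 * (2 ^ m * (m + σ) ^ 3) + 300 * (τ * σ ^ 3)) * 1 := by omega
          _ ≤ _ := Nat.mul_le_mul_left _ (by omega)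
    · rw [components_eq, Prog.assoc]
      have hmP : m * (m + 3) ≤ 4 * (m + σ) ^ 3 := by
        have h1 : m * (m + 3) ≤ (m + σ) * (4 * (m + σ)) := Nat.mul_le_mul (by omega) (by omega)
        have h2 : (m + σ) ^ 2 ≤ (m + σ) ^ 3 := Nat.pow_le_pow_right (by omega) (by norm_num)
        have e : (m + σ) * (4 * (m + σ)) = 4 * (m + σ) ^ 2 := by ring
        omega
      refine Spec.le (spec_bind (spec_sample m V) (q₂ := (depth + 1) * cq * N)
        (t₂ := (depth * ct + 193 * (2 ^ m * (m + σ) ^ 3) + 300 * (τ * σ ^ 3)) * N)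
        fun W hW => ?_) (by simp) ?_
      swap
      · have h1 : (m + σ) ^ 3 ≤ 2 ^ m * (m + σ) ^ 3 * N :=
          hPP.trans (Nat.le_mul_of_pos_right _ (by omega))
        have h2 : N ≤ 2 ^ m * (m + σ) ^ 3 * N := Nat.le_mul_of_pos_left _ (by omega)
        have e : (depth * ct + 198 * (2 ^ m * (m + σ) ^ 3) + 300 * (τ * σ ^ 3)) * N =
          (depth * ct + 193 * (2 ^ m * (m + σ) ^ 3) + 300 * (τ * σ ^ 3)) * N +
            5 * (2 ^ m * (m + σ) ^ 3 * N) := by ring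
        simp only [hN]
        omega
      rw [Prog.assoc]
      obtain ⟨hWn, hWV, hWm⟩ := hW
      refine Spec.le (spec_bind (spec_separatorOf hgen hbal hVn hSn hV hWn hWV hWm (P := m + σ)
        (by omega)) (q₂ := (depth * cq + 4 * (τ * σ ^ 2)) * N)
        (t₂ := (depth * ct + 300 * (τ * σ ^ 3)) * N) fun S₁ hS₁ => ?_) ?_ ?_
      · obtain ⟨hS₁n, hS₁V, hS₁κ, -⟩ := hS₁
        have hσ2 : σ ^ 2 ≤ τ * σ ^ 2 := Nat.le_mul_of_pos_left _ (by omega)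
        refine Spec.le (spec_bind (spec_componentsOf hgen hd hVn hSn hV hS₁n hS₁V hS₁κ (σ := σ)
          (by omega) hτ) (q₂ := (depth * cq + 3 * σ ^ 2) * V.length)
          (t₂ := (depth * ct + 200 * (τ * σ ^ 3)) * V.length) fun res hres => ?_) ?_ ?_
        · obtain ⟨rfl, hres⟩ := hres
          refine spec_combine hK hSn hVn hV hres hd (by omega) hτd fun C hC => ?_
          obtain ⟨h1, h2, h3⟩ := hres
          have hn := h2.nodup_iff.2 hVn
          obtain ⟨hn1, hn2, -⟩ := List.nodup_append'.1 hn
          refine Spec.le (ih C (res.1 ++ S) ((List.nodup_flatten.1 hn2).1 C hC)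
            (List.nodup_append'.2 ⟨hn1, hSn, fun s hs hs' => ?_⟩) (h3 C hC) ?_) le_rfl le_rfl
          · exact hV.notMem (v := s) (by simpa using hS₁V s hs) (by simpa using hs')
          · rw [List.length_append]; omega
        · rw [hN]
          have h1 : σ ^ 2 * N ≤ τ * σ ^ 2 * N := Nat.mul_le_mul_right _ hσ2
          calc N * (τ * σ ^ 2) + (depth * cq + 3 * σ ^ 2) * N
              = depth * cq * N + τ * σ ^ 2 * N + 3 * (σ ^ 2 * N) := by ring
            _ ≤ depth * cq * N + τ * σ ^ 2 * N + 3 * (τ * σ ^ 2 * N) := by omega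
            _ = _ := by ring
        · rw [hN]
          have h1 : τ * σ ^ 3 ≤ τ * σ ^ 3 * N := Nat.le_mul_of_pos_right _ (by omega)
          calc 20 * (τ * σ ^ 3 * (N + 1)) + (depth * ct + 200 * (τ * σ ^ 3)) * N
              = depth * ct * N + 220 * (τ * σ ^ 3 * N) + 20 * (τ * σ ^ 3) := by ring
            _ ≤ depth * ct * N + 300 * (τ * σ ^ 3 * N) := by omega
            _ = _ := by ring
      · rw [hN, ← hcq]
        have h1 : 2 ^ m * (m + σ) ^ 2 ≤ 2 ^ m * (m + σ) ^ 2 * N :=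
          Nat.le_mul_of_pos_right _ (by omega)
        have h2 : (m + σ) ^ 2 * N ≤ 2 ^ m * (m + σ) ^ 2 * N := Nat.mul_le_mul_right _ hPP2
        have h3 : (m + σ) ^ 2 ≤ (m + σ) ^ 2 * N := Nat.le_mul_of_pos_right _ (by omega)
        calc _ = 2 ^ m * (m + σ) ^ 2 + (2 * ((m + σ) ^ 2 * N) + (m + σ) ^ 2) + (depth *
              (4 * (2 ^ m * (m + σ) ^ 2) + 4 * (τ * σ ^ 2)) + 4 * (τ * σ ^ 2)) * N := by ring
          _ ≤ 4 * (2 ^ m * (m + σ) ^ 2 * N) + (depth *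
              (4 * (2 ^ m * (m + σ) ^ 2) + 4 * (τ * σ ^ 2)) + 4 * (τ * σ ^ 2)) * N := by omega
          _ = _ := by ring
      · rw [hN]
        have h1 : 2 ^ m * (m + σ) ^ 3 ≤ 2 ^ m * (m + σ) ^ 3 * N :=
          Nat.le_mul_of_pos_right _ (by omega)
        have h2 : (m + σ) ^ 3 * N ≤ 2 ^ m * (m + σ) ^ 3 * N := Nat.mul_le_mul_right _ hPP
        have h3 : (m + σ) ^ 3 ≤ (m + σ) ^ 3 * N := Nat.le_mul_of_pos_right _ (by omega)
        calc _ = 20 * (2 ^ m * (m + σ) ^ 3) + (40 * ((m + σ) ^ 3 * N) + 40 * (m + σ) ^ 3) +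
              (depth * ct + 300 * (τ * σ ^ 3)) * N := by ring
          _ ≤ 193 * (2 ^ m * (m + σ) ^ 3 * N) + (depth * ct + 300 * (τ * σ ^ 3)) * N := by omega
          _ = _ := by ring

end Recursion

/-! ### Balanced separators from tree decompositions -/

section Treewidth

variable {V : Type*} {G : SimpleGraph V}

/-- Weights that are at most half of their total can be split into two parts of at most two thirds
of the total. -/
theorem exists_balanced_subset {β : Type*} [DecidableEq β] (Q : Finset β) (w : β → ℕ)
    (hw : ∀ b ∈ Q, 2 * w b ≤ ∑ b ∈ Q, w b) :
    ∃ Q' ⊆ Q, 3 * ∑ b ∈ Q', w b ≤ 2 * ∑ b ∈ Q, w b ∧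
      3 * ∑ b ∈ Q \ Q', w b ≤ 2 * ∑ b ∈ Q, w b := by
  set N := ∑ b ∈ Q, w b with hN
  have hcompl : ∀ Q' ⊆ Q, ∑ b ∈ Q', w b + ∑ b ∈ Q \ Q', w b = N := fun Q' h => by
    rw [add_comm, Finset.sum_sdiff h]
  by_cases hbig : ∃ b ∈ Q, N ≤ 3 * w b
  · obtain ⟨b, hb, h⟩ := hbig
    have h1 := hcompl {b} (by simpa using hb)
    have h2 := hw b hb
    rw [Finset.sum_singleton] at h1
    exact ⟨{b}, by simpa using hb, by rw [Finset.sum_singleton]; omega, by omega⟩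
  · push Not at hbig
    -- a maximal part of at most two thirds has at least one third
    obtain ⟨Q', hQ', hmax⟩ := Finset.exists_max_image
      (Q.powerset.filter fun Q' => 3 * ∑ b ∈ Q', w b ≤ 2 * N) (fun Q' => ∑ b ∈ Q', w b)
      ⟨∅, by simp⟩
    rw [Finset.mem_filter, Finset.mem_powerset] at hQ'
    refine ⟨Q', hQ'.1, hQ'.2, ?_⟩
    have h1 := hcompl Q' hQ'.1
    by_contra hcon
    have hpos : ∑ b ∈ Q \ Q', w b ≠ 0 := by omega
    obtain ⟨b, hb, hb0⟩ := Finset.exists_ne_zero_of_sum_ne_zero hpos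
    rw [Finset.mem_sdiff] at hb
    have h2 := hbig b hb.1
    have h3 := hmax (insert b Q') (by
      rw [Finset.mem_filter, Finset.mem_powerset, Finset.sum_insert hb.2]
      exact ⟨Finset.insert_subset hb.1 hQ'.1, by omega⟩)
    rw [Finset.sum_insert hb.2] at h3
    omega

/-- In a tree, the two sides of an edge are disjoint. -/
theorem not_linked_of_adj {ι : Type*} {T : SimpleGraph ι} (hT : T.IsTree) {i j b : ι}
    (hij : T.Adj i j) (h : Linked T {j} i b) : ¬ Linked T {i} b j := by
  rintro ⟨q, hq⟩
  obtain ⟨p, hp⟩ := h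
  have hb := SimpleGraph.isBridge_iff_forall_walk_mem_edges.1
    (SimpleGraph.isAcyclic_iff_forall_adj_isBridge.1 hT.2 hij) (p.append q)
  rw [SimpleGraph.Walk.edges_append, List.mem_append] at hb
  rcases hb with hb | hb
  · exact hp j (p.snd_mem_support_of_mem_edges hb) (by simp)
  · exact hq i (q.fst_mem_support_of_mem_edges hb) (by simp)

variable {ι : Type}

/-- Vertices that are linked outside of the bag of `i` have all their bags on the same side
of `i`. -/
theorem TreeDecomposition.linked (D : TreeDecomposition G ι) {i : ι} {u v : V}
    (h : Linked G (D.bag i) u v) : ∀ a b, u ∈ D.bag a → v ∈ D.bag b → Linked D.tree {i} a b := by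
  obtain ⟨p, hp⟩ := h
  have hsame : ∀ u, u ∉ D.bag i → ∀ a b, u ∈ D.bag a → u ∈ D.bag b → Linked D.tree {i} a b := by
    intro u hu a b ha hb
    obtain ⟨p, hp⟩ := (D.isTree.1 a b).exists_isPath
    refine ⟨p, fun x hx hxi => hu ?_⟩
    rw [Finset.mem_singleton] at hxi
    exact hxi ▸ D.mem_of_mem_path u a b ha hb p hp x hx
  induction p with
  | nil => exact hsame _ (hp _ (by simp))
  | @cons u w v hadj p ih =>
    intro a b ha hb
    obtain ⟨c, hu, hw⟩ := D.edge_mem u w hadj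
    exact (hsame u (hp u (by simp)) a c ha hu).trans
      (ih (fun x hx => hp x (by simp [hx])) c b hw hb)

open Classical in
/-- Some bag splits a vertex set `W` into parts of at most half its size: otherwise, every node has
a neighbour in the direction of the larger half, and two adjacent nodes would point to each
other. -/
theorem TreeDecomposition.exists_balanced [Fintype ι] [Fintype V] (D : TreeDecomposition G ι)
    (W : Finset V) : ∃ i, ∀ v, 2 * (W.filter fun u => Linked G (D.bag i) v u).card ≤ W.card := by
  have key : ∀ N : ℕ, ∀ i a, (Finset.univ.filter fun c => Linked D.tree {i} a c).card ≤ N →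
      W.card < 2 * (W.filter fun u => u ∉ D.bag i ∧
        ∃ c, u ∈ D.bag c ∧ Linked D.tree {i} a c).card →
      ∃ j, ∀ a, 2 * (W.filter fun u => u ∉ D.bag j ∧
        ∃ c, u ∈ D.bag c ∧ Linked D.tree {j} a c).card ≤ W.card := by
    intro N
    induction N with
    | zero =>
      intro i a hN hW
      exfalso
      have h0 : (W.filter fun u => u ∉ D.bag i ∧ ∃ c, u ∈ D.bag c ∧ Linked D.tree {i} a c) = ∅ := by
        refine Finset.filter_eq_empty_iff.2 fun u _ h => ?_
        obtain ⟨-, c, -, hc⟩ := h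
        have : c ∈ Finset.univ.filter fun c => Linked D.tree {i} a c := by simpa using hc
        rw [Finset.card_eq_zero.1 (Nat.le_zero.1 hN)] at this
        simp at this
      rw [h0] at hW
      simp at hW
    | succ N ih =>
      intro i a hN hW
      by_contra hcon
      push Not at hcon
      have hne : (W.filter fun u => u ∉ D.bag i ∧
          ∃ c, u ∈ D.bag c ∧ Linked D.tree {i} a c).card ≠ 0 := by omega
      obtain ⟨u₀, hu₀⟩ := Finset.card_ne_zero.1 hne
      obtain ⟨-, -, c₀, -, hc₀⟩ := Finset.mem_filter.1 hu₀
      -- the neighbour `j` of `i` in the direction of `a`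
      obtain ⟨w, -⟩ := (D.isTree.1 a i).exists_isPath
      obtain ⟨j, i', hj, hji, hi'⟩ := Linked.exists_adj (T := ∅) (X := {i}) (s := i)
        ⟨w, by simp⟩ (by simp) (by simpa using hc₀.left_notMem)
      rw [Finset.mem_singleton] at hi'
      subst hi'
      rw [Finset.union_empty] at hj
      obtain ⟨a', ha'⟩ := hcon j
      -- the larger sides of `i` and of `j` share a vertex `v`
      obtain ⟨v, hv⟩ : ((W.filter fun u => u ∉ D.bag i' ∧
          ∃ c, u ∈ D.bag c ∧ Linked D.tree {i'} a c) ∩ (W.filter fun u => u ∉ D.bag j ∧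
          ∃ c, u ∈ D.bag c ∧ Linked D.tree {j} a' c)).Nonempty := by
        rw [← Finset.card_ne_zero]
        intro h0
        have h1 := Finset.card_union_add_card_inter (W.filter fun u => u ∉ D.bag i' ∧
          ∃ c, u ∈ D.bag c ∧ Linked D.tree {i'} a c) (W.filter fun u => u ∉ D.bag j ∧
          ∃ c, u ∈ D.bag c ∧ Linked D.tree {j} a' c)
        have h2 := Finset.card_le_card (Finset.union_subset (Finset.filter_subset (fun u =>
          u ∉ D.bag i' ∧ ∃ c, u ∈ D.bag c ∧ Linked D.tree {i'} a c) W)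
          (Finset.filter_subset (fun u => u ∉ D.bag j ∧
          ∃ c, u ∈ D.bag c ∧ Linked D.tree {j} a' c) W))
        omega
      simp only [Finset.mem_inter, Finset.mem_filter] at hv
      obtain ⟨⟨-, hvi, b, hb, hab⟩, -, hvj, b', hb', hab'⟩ := hv
      have hbb : Linked D.tree {j} b' b := D.linked (Linked.refl hvj) _ _ hb' hb
      have hbj : Linked D.tree {i'} b j := hab.symm.trans hj
      by_cases hi : Linked D.tree {j} a' i'
      · exact not_linked_of_adj D.isTree hji.symm (hi.symm.trans (hab'.trans hbb)) hbj
      · have hlt : (Finset.univ.filter fun c => Linked D.tree {j} a' c).card <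
            (Finset.univ.filter fun c => Linked D.tree {i'} a c).card := by
          refine Finset.card_lt_card (Finset.ssubset_iff_subset_ne.2 ⟨fun c hc => ?_, fun h => ?_⟩)
          · rw [Finset.mem_filter] at hc ⊢
            refine ⟨Finset.mem_univ c, hab.trans (Linked.mono (T := {j} ∪ {i'}) ?_
              Finset.subset_union_right)⟩
            refine Linked.union ((hab'.trans hbb).symm.trans hc.2) fun x hx hl => hi ?_
            rw [Finset.mem_singleton] at hx
            exact hx ▸ (hab'.trans hbb).trans hl
          · have : j ∈ Finset.univ.filter fun c => Linked D.tree {i'} a c := by simpa using hj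
            rw [← h, Finset.mem_filter] at this
            exact this.2.right_notMem (by simp)
        obtain ⟨j', hj'⟩ := ih j a' (by omega) ha'
        obtain ⟨a'', ha''⟩ := hcon j'
        exact absurd (hj' a'') (by omega)
  obtain ⟨i, hi⟩ : ∃ j, ∀ a, 2 * (W.filter fun u => u ∉ D.bag j ∧
      ∃ c, u ∈ D.bag c ∧ Linked D.tree {j} a c).card ≤ W.card := by
    obtain ⟨i₀⟩ := D.isTree.1.nonempty
    by_cases h : ∀ a, 2 * (W.filter fun u => u ∉ D.bag i₀ ∧
      ∃ c, u ∈ D.bag c ∧ Linked D.tree {i₀} a c).card ≤ W.card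
    · exact ⟨i₀, h⟩
    · push Not at h
      obtain ⟨a, ha⟩ := h
      exact key _ i₀ a le_rfl ha
  refine ⟨i, fun v => ?_⟩
  obtain ⟨a, ha⟩ := D.vertex_mem v
  refine le_trans (Nat.mul_le_mul_left 2 (Finset.card_le_card fun u hu => ?_)) (hi a)
  rw [Finset.mem_filter] at hu ⊢
  obtain ⟨c, hc⟩ := D.vertex_mem u
  exact ⟨hu.1, hu.2.right_notMem, c, hc, D.linked hu.2 a c ha hc⟩

/-- The decomposition with a single bag shows that the treewidth is attained. -/
theorem exists_treeDecomposition [Fintype V] (G : SimpleGraph V) :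
    ∃ (t : ℕ) (D : TreeDecomposition G (Fin t)), ∀ i, (D.bag i).card ≤ treewidth G + 1 := by
  refine Nat.sInf_mem (s := {w | ∃ (t : ℕ) (D : TreeDecomposition G (Fin t)),
    ∀ i, (D.bag i).card ≤ w + 1}) ⟨Fintype.card V, 1,
      { tree := ⊥
        isTree := ⟨.of_subsingleton, fun v c hc => ?_⟩
        bag := fun _ => Finset.univ
        vertex_mem := by simp
        edge_mem := by simp
        mem_of_mem_path := by simp }, fun i => (Finset.card_univ (α := V)).le.trans (Nat.le_succ _)⟩
  have := hc.three_le_length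
  cases c with
  | nil => simp at this
  | cons h p => exact absurd h (by simp)

open Classical in
/-- The parts of `W` that the balanced bag leaves, together with the single vertices of the bag, are
grouped into two balanced sides. -/
theorem hasBalancedSeparators_of_treewidth_le {n k : ℕ} {G : SimpleGraph (Fin n)}
    (h : treewidth G ≤ k) : HasBalancedSeparators G (k + 1) := by
  intro W hW hW2
  obtain ⟨t, D, hD⟩ := exists_treeDecomposition G
  obtain ⟨i, hi⟩ := D.exists_balanced W.toFinset
  set X := D.bag i with hX
  -- vertices get the same label if they are linked outside of the bag
  set f : Fin n → Finset (Fin n) := fun v => insert v (Finset.univ.filter (Linked G X v)) with hf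
  have hfl : ∀ u v, Linked G X u v → f u = f v := by
    intro u v huv
    ext x
    simp only [hf, Finset.mem_insert, Finset.mem_filter, Finset.mem_univ, true_and]
    constructor
    · rintro (rfl | hx)
      · exact Or.inr huv.symm
      · exact Or.inr (huv.symm.trans hx)
    · rintro (rfl | hx)
      · exact Or.inr huv
      · exact Or.inr (huv.trans hx)
  have hcard : W.toFinset.card = W.length := List.toFinset_card_of_nodup hW
  have hsum : ∑ b ∈ W.toFinset.image f, (W.toFinset.filter fun u => f u = b).card = W.length := by
    rw [← hcard]
    exact (Finset.card_eq_sum_card_image f W.toFinset).symm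
  obtain ⟨Q, hQ, h1, h2⟩ := exists_balanced_subset (W.toFinset.image f)
    (fun b => (W.toFinset.filter fun u => f u = b).card) (fun b hb => by
      rw [hsum]
      obtain ⟨v, -, rfl⟩ := Finset.mem_image.1 hb
      by_cases hv : v ∈ X
      · have : (W.toFinset.filter fun u => f u = f v) ⊆ {v} := by
          intro u hu
          have hu : f u = f v := (Finset.mem_filter.1 hu).2
          have h3 : u ∈ f v := hu ▸ Finset.mem_insert_self _ _
          rw [hf, Finset.mem_insert, Finset.mem_filter] at h3
          rcases h3 with h3 | h3
          · simp [h3]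
          · exact absurd hv h3.2.left_notMem
        have := Finset.card_le_card this
        rw [Finset.card_singleton] at this
        omega
      · refine le_trans (Nat.mul_le_mul_left 2 (Finset.card_le_card fun u hu => ?_))
          ((hi v).trans hcard.le)
        rw [Finset.mem_filter] at hu ⊢
        refine ⟨hu.1, ?_⟩
        have h3 : u ∈ f v := hu.2 ▸ Finset.mem_insert_self _ _
        rw [hf, Finset.mem_insert, Finset.mem_filter] at h3
        rcases h3 with rfl | h3
        · exact Linked.refl hv
        · exact h3.2)
  rw [hsum] at h1 h2
  have hlen : ∀ Q' ⊆ W.toFinset.image f, ∀ p : Fin n → Bool, (∀ v ∈ W, p v = true ↔ f v ∈ Q') →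
      (W.filter p).length = ∑ b ∈ Q', (W.toFinset.filter fun u => f u = b).card := by
    intro Q' hQ' p hp
    rw [← List.toFinset_card_of_nodup (hW.filter p), Finset.card_eq_sum_card_fiberwise (f := f)
      (t := Q') fun v hv => ?_]
    · refine Finset.sum_congr rfl fun b hb => congrArg _ ?_
      ext v
      simp only [Finset.mem_filter, List.mem_toFinset, List.mem_filter]
      constructor
      · rintro ⟨⟨h1, -⟩, h2⟩
        exact ⟨h1, h2⟩
      · rintro ⟨h1, h2⟩
        exact ⟨⟨h1, (hp v h1).2 (h2 ▸ hb)⟩, h2⟩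
    · rw [Finset.mem_coe, List.mem_toFinset, List.mem_filter] at hv
      exact (hp v hv.1).1 hv.2
  have e1 := hlen Q hQ (fun v => decide (f v ∈ Q)) (by simp)
  have e2 := hlen (W.toFinset.image f \ Q) Finset.sdiff_subset (fun v => !decide (f v ∈ Q))
    (fun v hv => by
      simp only [Bool.not_eq_true', decide_eq_false_iff_not, Finset.mem_sdiff, Finset.mem_image,
        List.mem_toFinset]
      exact ⟨fun h => ⟨⟨v, hv, rfl⟩, h⟩, fun h => h.2⟩)
  have e3 : (W.filter fun v => decide (f v ∈ Q)).length +
      (W.filter fun v => !decide (f v ∈ Q)).length = W.length :=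
    List.length_eq_length_filter_add _ |>.symm
  refine ⟨fun v => decide (f v ∈ Q), ⟨?_, ?_⟩, X, (hD i).trans (by omega), ?_⟩
  · rw [e3, e1]; exact h1
  · rw [e3, e2]; exact h2
  · rw [separates_iff]
    intro a ha b hb hab
    simp only [List.mem_toFinset, List.mem_filter, decide_eq_true_eq, Bool.not_eq_true',
      decide_eq_false_iff_not] at ha hb
    exact hb.2 (hfl a b hab ▸ ha.2)

end Treewidth

/-! ### Cutting a connected graph into pieces -/

section Pieces

variable {V : Type*} {G : SimpleGraph V}

/-- A tree in `G` with vertex set `H` and root `r`, given by the parent of each vertex. The parent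
of the root is the root itself, and `rank` decreases towards the root. -/
structure ParentTree (G : SimpleGraph V) (H : Finset V) (r : V) (par : V → V) (rank : V → ℕ) :
    Prop where
  root_mem : r ∈ H
  par_root : par r = r
  par_mem : ∀ v ∈ H, par v ∈ H
  adj : ∀ v ∈ H, v ≠ r → G.Adj v (par v)
  rank_lt : ∀ v ∈ H, v ≠ r → rank (par v) < rank v

open Classical in
/-- A component is spanned by a tree of shortest walks. -/
theorem IsComp.exists_parentTree {T H : Finset V} (hH : IsComp G T H) :
    ∃ r par rank, ParentTree G H r par rank := by
  obtain ⟨r, hr⟩ := hH.1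
  have hex : ∀ v ∈ H, ∃ l, ∃ p : G.Walk v r, p.length = l ∧ ∀ x ∈ p.support, x ∉ T := fun v hv => by
    obtain ⟨p, hp⟩ := hH.linked hv hr
    exact ⟨_, p, rfl, hp⟩
  -- the parent is the second vertex of a shortest walk to the root
  set rank : V → ℕ := fun v => if hv : v ∈ H then Nat.find (hex v hv) else 0 with hrank
  have hpar : ∀ v, ∃ w, v ∈ H → v ≠ r → w ∈ H ∧ G.Adj v w ∧ rank w < rank v := by
    intro v
    by_cases hv : v ∈ H
    · obtain ⟨p, hp, hT⟩ := Nat.find_spec (hex v hv)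
      cases p with
      | nil => exact ⟨r, fun _ h => absurd rfl h⟩
      | @cons _ w _ hadj p =>
        have hwT : w ∉ T := hT w (by simp)
        have hw : w ∈ H := (hH.2 v hv w).2 (Linked.of_adj hadj (hH.notMem hv) hwT)
        refine ⟨w, fun _ _ => ⟨hw, hadj, ?_⟩⟩
        have h1 : rank w ≤ p.length := by
          simp only [hrank, dif_pos hw]
          exact Nat.find_min' _ ⟨p, rfl, fun x hx => hT x (by simp [hx])⟩
        have h2 : rank v = p.length + 1 := by
          simp only [hrank, dif_pos hv]
          rw [← hp, SimpleGraph.Walk.length_cons]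
        omega
    · exact ⟨v, fun h => absurd h hv⟩
  choose par hpar using hpar
  refine ⟨r, fun v => if v = r then r else par v, rank, hr, by simp, ?_, ?_, ?_⟩
  · intro v hv
    by_cases h : v = r
    · simpa [h] using hr
    · simpa [h] using (hpar v hv h).1
  · intro v hv h
    simpa [h] using (hpar v hv h).2.1
  · intro v hv h
    simpa [h] using (hpar v hv h).2.2

variable {H : Finset V} {r : V} {par : V → V} {rank : V → ℕ}

theorem ParentTree.rank_iterate_le (h : ParentTree G H r par rank) {v : V} (hv : v ∈ H) (i : ℕ) :
    par^[i] v ∈ H ∧ rank (par^[i] v) ≤ rank v := by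
  induction i with
  | zero => exact ⟨hv, le_rfl⟩
  | succ i ih =>
    rw [Function.iterate_succ_apply']
    refine ⟨h.par_mem _ ih.1, le_trans ?_ ih.2⟩
    by_cases hr : par^[i] v = r
    · rw [hr, h.par_root]
    · exact (h.rank_lt _ ih.1 hr).le

open Classical in
/-- A tree with more than `θ` vertices has a vertex `x` and a set of between `θ` and `2θ` vertices
that is a union of subtrees hanging from `x`. -/
theorem ParentTree.exists_bin (h : ParentTree G H r par rank) {θ : ℕ} (hθ : 1 ≤ θ)
    (hH : θ + 1 ≤ H.card) : ∃ B ⊆ H, ∃ x ∈ H, θ ≤ B.card ∧ B.card ≤ 2 * θ ∧ r ∉ B ∧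
      (∀ v ∈ H, par v ∈ B → v ∈ B) ∧ ∀ v ∈ B, par v = x ∨ par v ∈ B := by
  -- a smallest set with all these properties but the upper bound
  obtain ⟨P, hP⟩ : ∃ P : Finset V → Prop, ∀ B, P B ↔ B ⊆ H ∧ θ ≤ B.card ∧ r ∉ B ∧
    (∀ v ∈ H, par v ∈ B → v ∈ B) ∧ ∃ x ∈ H, x ∉ B ∧ ∀ v ∈ B, par v = x ∨ par v ∈ B :=
    ⟨_, fun B => Iff.rfl⟩
  have hex : P (H.erase r) := by
    rw [hP, Finset.card_erase_of_mem h.root_mem]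
    refine ⟨Finset.erase_subset _ _, by omega, by simp, fun v hv hp => ?_, r, h.root_mem,
      by simp, fun v hv => ?_⟩
    · rw [Finset.mem_erase] at hp ⊢
      refine ⟨?_, hv⟩
      rintro rfl
      exact hp.1 h.par_root
    · by_cases hp : par v = r
      · exact Or.inl hp
      · exact Or.inr (Finset.mem_erase.2 ⟨hp, h.par_mem v (Finset.mem_of_mem_erase hv)⟩)
  obtain ⟨B, hB, hmin⟩ := Finset.exists_min_image (H.powerset.filter P) Finset.card
    ⟨H.erase r, Finset.mem_filter.2 ⟨Finset.mem_powerset.2 (Finset.erase_subset _ _), hex⟩⟩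
  replace hmin : ∀ B', P B' → B.card ≤ B'.card := fun B' h' =>
    hmin B' (Finset.mem_filter.2 ⟨Finset.mem_powerset.2 ((hP B').1 h').1, h'⟩)
  obtain ⟨hBH, hBθ, hrB, hBd, x, hx, hxB, hBx⟩ := (hP B).1 (Finset.mem_filter.1 hB).2
  refine ⟨B, hBH, x, hx, hBθ, ?_, hrB, hBd, hBx⟩
  obtain ⟨y, hy, hymin⟩ := Finset.exists_min_image B rank (Finset.card_pos.1 (by omega))
  have hyr : y ≠ r := fun e => hrB (e ▸ hy)
  have hyx : par y = x := by
    rcases hBx y hy with hp | hp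
    · exact hp
    · exact absurd (hymin _ hp) (not_le.2 (h.rank_lt y (hBH hy) hyr))
  -- the subtree of the child `y` of `x`
  set Y := H.filter fun v => ∃ i, par^[i] v = y with hY
  have hYpar : ∀ v ∈ H, par v ∈ Y → v ∈ Y := by
    intro v hv hp
    obtain ⟨-, i, hi⟩ := Finset.mem_filter.1 hp
    exact Finset.mem_filter.2 ⟨hv, i + 1, hi⟩
  have hYup : ∀ v ∈ Y, v = y ∨ par v ∈ Y := by
    intro v hv
    obtain ⟨hvH, i, hi⟩ := Finset.mem_filter.1 hv
    cases i with
    | zero => exact Or.inl hi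
    | succ i => exact Or.inr (Finset.mem_filter.2 ⟨h.par_mem v hvH, i, hi⟩)
  have hyY : y ∈ Y := Finset.mem_filter.2 ⟨hBH hy, 0, rfl⟩
  have hYB : Y ⊆ B := by
    intro v hv
    obtain ⟨hvH, i, hi⟩ := Finset.mem_filter.1 hv
    clear hv
    induction i generalizing v with
    | zero => exact (show v = y from hi) ▸ hy
    | succ i ih => exact hBd v hvH (ih (h.par_mem v hvH) hi)
  have hparY : par y ∉ Y := by
    intro hp
    obtain ⟨hpH, i, hi⟩ := Finset.mem_filter.1 hp
    have h1 := (h.rank_iterate_le hpH i).2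
    rw [hi] at h1
    exact absurd (h.rank_lt y (hBH hy) hyr) (not_lt.2 h1)
  have hYθ : Y.card ≤ θ := by
    by_contra hcon
    have h1 := hmin (Y.erase y) (by
      rw [hP, Finset.card_erase_of_mem hyY]
      refine ⟨(Finset.erase_subset _ _).trans (Finset.filter_subset _ _), by omega,
        fun hr => hrB (hYB (Finset.mem_of_mem_erase hr)), fun v hv hp => ?_, y, hBH hy, by simp,
        fun v hv => ?_⟩
      · refine Finset.mem_erase.2 ⟨?_, hYpar v hv (Finset.mem_of_mem_erase hp)⟩
        rintro rfl
        exact hparY (Finset.mem_of_mem_erase hp)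
      · rw [Finset.mem_erase] at hv
        rcases hYup v hv.2 with hv' | hv'
        · exact absurd hv' hv.1
        · by_cases hp : par v = y
          · exact Or.inl hp
          · exact Or.inr (Finset.mem_erase.2 ⟨hp, hv'⟩))
    rw [Finset.card_erase_of_mem hyY] at h1
    have h2 := Finset.card_le_card hYB
    omega
  by_contra hcon
  have hcard := Finset.card_sdiff_add_card_eq_card hYB
  have h1 := hmin (B \ Y) (by
    rw [hP]
    refine ⟨Finset.sdiff_subset.trans hBH, by omega, fun hr => hrB (Finset.mem_sdiff.1 hr).1,
      fun v hv hp => ?_, x, hx, fun hx' => hxB (Finset.mem_sdiff.1 hx').1, fun v hv => ?_⟩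
    · rw [Finset.mem_sdiff] at hp ⊢
      refine ⟨hBd v hv hp.1, fun hvY => ?_⟩
      rcases hYup v hvY with rfl | hp'
      · exact hxB (hyx ▸ hp.1)
      · exact hp.2 hp'
    · rw [Finset.mem_sdiff] at hv
      rcases hBx v hv.1 with hp | hp
      · exact Or.inl hp
      · exact Or.inr (Finset.mem_sdiff.2 ⟨hp, fun hp' => hv.2 (hYpar v (hBH hv.1) hp')⟩))
  have h2 := Finset.card_pos.2 ⟨y, hyY⟩
  omega

open Classical in
/-- A tree splits into few bins of at most `2θ` vertices, each of which hangs from the center of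
the bin. -/
theorem ParentTree.exists_pieces {θ : ℕ} (hθ : 1 ≤ θ) (N : ℕ) : ∀ H : Finset V, H.card ≤ N →
    ParentTree G H r par rank → ∃ (X : Finset V) (Q : ℕ) (c : V → V) (bin : V → ℕ),
      X.card * θ ≤ H.card + θ ∧ Q * θ ≤ H.card + θ ∧ (∀ v ∈ H, c v ∈ X ∧ c v ∈ H ∧ bin v < Q) ∧
      (∀ b, (H.filter fun v => bin v = b).card ≤ 2 * θ) ∧
      ∀ v ∈ H, v = c v ∨ par v = c v ∨ (v ≠ r ∧ c (par v) = c v ∧ bin (par v) = bin v) := by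
  induction N with
  | zero =>
    intro H hN h
    rw [Finset.card_eq_zero.1 (Nat.le_zero.1 hN)] at h
    exact absurd h.root_mem (by simp)
  | succ N ih =>
    intro H hN h
    by_cases hH : θ + 1 ≤ H.card
    · obtain ⟨B, hBH, x, hx, hB1, hB2, hrB, hBd, hBx⟩ := h.exists_bin hθ hH
      have hcard := Finset.card_sdiff_add_card_eq_card hBH
      have hmem : ∀ v ∈ H, v ∉ B → v ∈ H \ B := fun v h1 h2 => Finset.mem_sdiff.2 ⟨h1, h2⟩
      obtain ⟨X, Q, c, bin, h1, h2, h3, h4, h5⟩ := ih (H \ B) (by omega)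
        { root_mem := hmem r h.root_mem hrB
          par_root := h.par_root
          par_mem := fun v hv => by
            rw [Finset.mem_sdiff] at hv
            exact hmem _ (h.par_mem v hv.1) fun hp => hv.2 (hBd v hv.1 hp)
          adj := fun v hv => h.adj v (Finset.mem_sdiff.1 hv).1
          rank_lt := fun v hv => h.rank_lt v (Finset.mem_sdiff.1 hv).1 }
      refine ⟨insert x X, Q + 1, fun v => if v ∈ B then x else c v,
        fun v => if v ∈ B then Q else bin v, ?_, ?_, ?_, ?_, ?_⟩
      · have := Nat.mul_le_mul_right θ (Finset.card_insert_le x X)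
        rw [add_mul] at this
        omega
      · rw [add_mul]; omega
      · intro v hv
        by_cases hvB : v ∈ B
        · simp [hvB, hx]
        · obtain ⟨a1, a2, a3⟩ := h3 v (hmem v hv hvB)
          simp only [hvB, if_false, Finset.mem_insert]
          exact ⟨Or.inr a1, (Finset.mem_sdiff.1 a2).1, by omega⟩
      · intro b
        by_cases hb : b = Q
        · subst hb
          refine le_trans (Finset.card_le_card fun v hv => ?_) hB2
          rw [Finset.mem_filter] at hv
          by_contra hvB
          have := (h3 v (hmem v hv.1 hvB)).2.2
          simp only [hvB, if_false] at hv
          omega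
        · refine le_trans (Finset.card_le_card fun v hv => ?_) (h4 b)
          rw [Finset.mem_filter] at hv ⊢
          by_cases hvB : v ∈ B
          · simp only [hvB, if_true] at hv
            exact absurd hv.2.symm hb
          · simp only [hvB, if_false] at hv
            exact ⟨hmem v hv.1 hvB, hv.2⟩
      · intro v hv
        by_cases hvB : v ∈ B
        · simp only [hvB, if_true]
          rcases hBx v hvB with hp | hp
          · exact Or.inr (Or.inl hp)
          · exact Or.inr (Or.inr ⟨fun e => hrB (e ▸ hvB), by simp [hp]⟩)
        · have hp : par v ∉ B := fun hp => hvB (hBd v hv hp)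
          simpa only [hvB, hp, if_false] using h5 v (hmem v hv hvB)
    · refine ⟨{r}, 1, fun _ => r, fun _ => 0, by simp, by omega, fun v hv => ?_, fun b => ?_,
        fun v hv => ?_⟩
      · exact ⟨by simp, h.root_mem, by simp⟩
      · exact (Finset.card_filter_le _ _).trans (by omega)
      · by_cases hr : v = r
        · exact Or.inl hr
        · exact Or.inr (Or.inr ⟨hr, rfl, rfl⟩)

/-- A vertex is linked to the center of its bin as long as neither the bin nor the centers are
hit. -/
theorem ParentTree.linked_center (h : ParentTree G H r par rank) {U X : Finset V} {c : V → V}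
    {bin : V → ℕ} (hcX : ∀ v ∈ H, c v ∈ X)
    (hpar : ∀ v ∈ H, v = c v ∨ par v = c v ∨ (v ≠ r ∧ c (par v) = c v ∧ bin (par v) = bin v))
    (hX : ∀ x ∈ X, x ∉ U) {v : V} (hv : v ∈ H) (hbin : ∀ u ∈ H, bin u = bin v → u ∉ U) :
    Linked G U v (c v) := by
  have key : ∀ N, ∀ v ∈ H, rank v < N → (∀ u ∈ H, bin u = bin v → u ∉ U) →
      Linked G U v (c v) := by
    intro N
    induction N with
    | zero => exact fun v _ h => absurd h (Nat.not_lt_zero _)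
    | succ N ih =>
      intro v hv hN hbin
      have hvU := hbin v hv rfl
      by_cases hvc : v = c v
      · rw [← hvc]; exact Linked.refl hvU
      rcases hpar v hv with e | e | ⟨hvr, e, e'⟩
      · exact absurd e hvc
      · have hvr : v ≠ r := by
          rintro rfl
          exact hvc (h.par_root.symm.trans e)
        exact Linked.of_adj (e ▸ h.adj v hv hvr) hvU (hX _ (hcX v hv))
      · have hp := h.par_mem v hv
        refine (Linked.of_adj (h.adj v hv hvr) hvU (hbin _ hp e')).trans (e ▸ ih (par v) hp ?_ ?_)
        · have := h.rank_lt v hv hvr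
          omega
        · exact fun u hu hb => hbin u hu (hb.trans e')
  exact key _ v hv (Nat.lt_succ_self _) hbin

end Pieces

/-! ### Covering the complements of large components -/

section Family

variable {V : Type*} [DecidableEq V] {G : SimpleGraph V}

open Classical in
/-- The complements of the large components that remain after the removal of `s` vertices are
covered, up to a small error, by the sets of a family whose size does not depend on the graph: if
none of the removed vertices is a center, a set of the family is determined by the centers outside
of the component and by the bins that are hit; otherwise the argument is repeated without a center
that is hit. -/
theorem exists_family {N θ p : ℕ} (hθ : 1 ≤ θ) (hp : N + θ ≤ p * θ) (s : ℕ) :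
    ∀ T H : Finset V, IsComp G T H → H.card ≤ N → ∃ 𝓕 : Finset (Finset V),
      𝓕.card ≤ (p + 1) ^ s * 4 ^ p ∧ ∀ S C : Finset V, S.card ≤ s → IsComp G (T ∪ S) C → C ⊆ H →
        N < 2 * C.card → ∃ F ∈ 𝓕, H \ C ⊆ F ∧ F.card ≤ (H \ C).card + 2 * θ * s := by
  induction s with
  | zero =>
    intro T H hH hN
    refine ⟨{∅}, by simpa using Nat.one_le_pow _ _ (by norm_num), fun S C hS hC hCH _ => ?_⟩
    rw [Finset.card_eq_zero.1 (Nat.le_zero.1 hS), Finset.union_empty] at hC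
    have hHC : H ⊆ C := by
      obtain ⟨v, hv⟩ := hC.1
      exact fun w hw => (hC.2 v hv w).2 (hH.linked (hCH hv) hw)
    exact ⟨∅, by simp, by simp [Finset.sdiff_eq_empty_iff_subset.2 hHC], by simp⟩
  | succ s ih =>
    intro T H hH hN
    obtain ⟨r, par, rank, htree⟩ := hH.exists_parentTree
    obtain ⟨X₀, Q, c, bin, hX₀, hQ, hc, hfib, hpar⟩ := ParentTree.exists_pieces hθ _ H le_rfl htree
    obtain ⟨X, hXdef⟩ : ∃ X, X = X₀.filter (· ∈ H) := ⟨_, rfl⟩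
    have hXp : X.card ≤ p := by
      have h1 : X.card ≤ X₀.card := hXdef ▸ Finset.card_filter_le _ _
      have h2 : X₀.card * θ ≤ p * θ := by omega
      exact h1.trans (Nat.le_of_mul_le_mul_right h2 hθ)
    have hQp : Q ≤ p := by
      have h2 : Q * θ ≤ p * θ := by omega
      exact Nat.le_of_mul_le_mul_right h2 hθ
    have hcX : ∀ v ∈ H, c v ∈ X := fun v hv => by
      rw [hXdef, Finset.mem_filter]
      exact ⟨(hc v hv).1, (hc v hv).2.1⟩
    -- the family for the case that the center `x` is removed
    have hx : ∀ x, ∃ 𝓕 : Finset (Finset V), 𝓕.card ≤ (p + 1) ^ s * 4 ^ p ∧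
        ∀ S C : Finset V, S.card ≤ s → IsComp G (insert x T ∪ S) C → C ⊆ H → N < 2 * C.card →
          ∃ F ∈ 𝓕, H \ C ⊆ F ∧ F.card ≤ (H \ C).card + 2 * θ * s := by
      intro x
      by_cases hex : ∃ H', IsComp G (insert x T) H' ∧ H' ⊆ H ∧ N < 2 * H'.card
      · obtain ⟨H', hH', hH'H, hN'⟩ := hex
        obtain ⟨𝓕, h1, h2⟩ := ih (insert x T) H' hH' ((Finset.card_le_card hH'H).trans hN)
        refine ⟨𝓕.image fun F => F ∪ (H \ H'), Finset.card_image_le.trans h1,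
          fun S C hS hC hCH hNC => ?_⟩
        have hCH' : C ⊆ H' := by
          obtain ⟨v, hv⟩ : (C ∩ H').Nonempty := by
            rw [← Finset.card_ne_zero]
            intro h0
            have h3 := Finset.card_union_add_card_inter C H'
            have h4 := Finset.card_le_card (Finset.union_subset hCH hH'H)
            omega
          rw [Finset.mem_inter] at hv
          exact fun w hw => (hH'.2 v hv.2 w).2 ((hC.linked hv.1 hw).mono Finset.subset_union_left)
        obtain ⟨F, hF, hF1, hF2⟩ := h2 S C hS hC hCH' hNC
        refine ⟨_, Finset.mem_image_of_mem _ hF, ?_, ?_⟩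
        · intro v hv
          rw [Finset.mem_sdiff] at hv
          by_cases hvH' : v ∈ H'
          · exact Finset.mem_union_left _ (hF1 (Finset.mem_sdiff.2 ⟨hvH', hv.2⟩))
          · exact Finset.mem_union_right _ (Finset.mem_sdiff.2 ⟨hv.1, hvH'⟩)
        · have h3 := Finset.card_union_le F (H \ H')
          have h4 := Finset.card_sdiff_add_card_eq_card hH'H
          have h5 := Finset.card_sdiff_add_card_eq_card hCH
          have h6 := Finset.card_sdiff_add_card_eq_card hCH'
          omega
      · refine ⟨∅, by simp, fun S C hS hC hCH hNC => ?_⟩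
        exfalso
        obtain ⟨v, hv⟩ := hC.1
        have hvT : v ∉ insert x T := fun h => hC.notMem hv (Finset.mem_union_left _ h)
        refine hex ⟨H.filter (Linked G (insert x T) v), ⟨⟨v, ?_⟩, fun a ha b => ?_⟩,
          Finset.filter_subset _ _, hNC.trans_le (Nat.mul_le_mul_left 2
            (Finset.card_le_card fun w hw => ?_))⟩
        · exact Finset.mem_filter.2 ⟨hCH hv, Linked.refl hvT⟩
        · obtain ⟨haH, hva⟩ := Finset.mem_filter.1 ha
          rw [Finset.mem_filter]
          constructor
          · exact fun h => hva.symm.trans h.2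
          · exact fun h => ⟨(hH.2 a haH b).2 (h.mono (Finset.subset_insert _ _)), hva.trans h⟩
        · exact Finset.mem_filter.2 ⟨hCH hw, (hC.linked hv hw).mono Finset.subset_union_left⟩
    choose 𝓖 h𝓖card h𝓖 using hx
    refine ⟨((X.powerset ×ˢ (Finset.range Q).powerset).image fun YZ =>
      H.filter fun v => c v ∉ YZ.1 ∨ bin v ∈ YZ.2) ∪ X.biUnion 𝓖, ?_, ?_⟩
    · have h1 : ((X.powerset ×ˢ (Finset.range Q).powerset).image fun YZ =>
          H.filter fun v => c v ∉ YZ.1 ∨ bin v ∈ YZ.2).card ≤ 4 ^ p := by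
        refine Finset.card_image_le.trans ?_
        rw [Finset.card_product, Finset.card_powerset, Finset.card_powerset, Finset.card_range]
        calc 2 ^ X.card * 2 ^ Q ≤ 2 ^ p * 2 ^ p :=
              Nat.mul_le_mul (Nat.pow_le_pow_right (by norm_num) hXp)
                (Nat.pow_le_pow_right (by norm_num) hQp)
          _ = 4 ^ p := by rw [← mul_pow]; norm_num
      have h2 : (X.biUnion 𝓖).card ≤ p * ((p + 1) ^ s * 4 ^ p) :=
        (Finset.card_biUnion_le_card_mul _ _ _ fun x _ => h𝓖card x).trans
          (Nat.mul_le_mul_right _ hXp)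
      have h3 : 4 ^ p ≤ (p + 1) ^ s * 4 ^ p :=
        Nat.le_mul_of_pos_left _ (pow_pos (Nat.succ_pos p) s)
      refine (Finset.card_union_le _ _).trans ?_
      calc _ ≤ (p + 1) ^ s * 4 ^ p + p * ((p + 1) ^ s * 4 ^ p) := Nat.add_le_add (h1.trans h3) h2
        _ = _ := by ring
    · intro S C hS hC hCH hNC
      by_cases hSX : ∃ x ∈ X, x ∈ S
      · obtain ⟨x, hxX, hxS⟩ := hSX
        have hU : insert x T ∪ S.erase x = T ∪ S := by
          rw [Finset.insert_union, ← Finset.union_insert, Finset.insert_erase hxS]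
        obtain ⟨F, hF, hF1, hF2⟩ := h𝓖 x (S.erase x) C
          (by rw [Finset.card_erase_of_mem hxS]; omega) (hU ▸ hC) hCH hNC
        refine ⟨F, Finset.mem_union_right _ (Finset.mem_biUnion.2 ⟨x, hxX, hF⟩), hF1,
          hF2.trans (Nat.add_le_add_left (Nat.mul_le_mul_left _ (Nat.le_succ s)) _)⟩
      · push Not at hSX
        have hlink : ∀ v ∈ H, bin v ∉ (S ∩ H).image bin → Linked G (T ∪ S) v (c v) := by
          intro v hv hb
          refine htree.linked_center hcX hpar (fun x hx hxU => ?_) hv fun u hu hbu huU => ?_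
          · rcases Finset.mem_union.1 hxU with h | h
            · exact hH.notMem (Finset.mem_filter.1 (hXdef ▸ hx)).2 h
            · exact hSX x hx h
          · rcases Finset.mem_union.1 huU with h | h
            · exact hH.notMem hu h
            · exact hb (Finset.mem_image.2 ⟨u, Finset.mem_inter.2 ⟨h, hu⟩, hbu⟩)
        refine ⟨_, Finset.mem_union_left _ (Finset.mem_image_of_mem _
          (a := (X ∩ C, (S ∩ H).image bin)) ?_), ?_, ?_⟩
        · refine Finset.mem_product.2 ⟨Finset.mem_powerset.2 Finset.inter_subset_left,
            Finset.mem_powerset.2 fun b hb => ?_⟩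
          obtain ⟨u, hu, rfl⟩ := Finset.mem_image.1 hb
          exact Finset.mem_range.2 (hc u (Finset.mem_inter.1 hu).2).2.2
        · intro v hv
          rw [Finset.mem_sdiff] at hv
          refine Finset.mem_filter.2 ⟨hv.1, ?_⟩
          by_contra hcon
          push Not at hcon
          have hcC := (Finset.mem_inter.1 hcon.1).2
          exact hv.2 ((hC.2 _ hcC v).2 (hlink v hv.1 hcon.2).symm)
        · have hsub : (H.filter fun v => c v ∉ X ∩ C ∨ bin v ∈ (S ∩ H).image bin) ⊆
              (H \ C) ∪ ((S ∩ H).image bin).biUnion fun b => H.filter fun v => bin v = b := by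
            intro v hv
            obtain ⟨hvH, hv⟩ := Finset.mem_filter.1 hv
            by_cases hb : bin v ∈ (S ∩ H).image bin
            · exact Finset.mem_union_right _ (Finset.mem_biUnion.2
                ⟨bin v, hb, Finset.mem_filter.2 ⟨hvH, rfl⟩⟩)
            · refine Finset.mem_union_left _ (Finset.mem_sdiff.2 ⟨hvH, fun hvC => ?_⟩)
              rcases hv with hv | hv
              · exact hv (Finset.mem_inter.2 ⟨hcX v hvH, (hC.2 v hvC _).2 (hlink v hvH hb)⟩)
              · exact hb hv
          refine (Finset.card_le_card hsub).trans ((Finset.card_union_le _ _).trans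
            (Nat.add_le_add_left ?_ _))
          refine (Finset.card_biUnion_le_card_mul _ _ (2 * θ) fun b _ => hfib b).trans ?_
          rw [mul_comm]
          exact Nat.mul_le_mul_left _ (Finset.card_image_le.trans
            ((Finset.card_le_card Finset.inter_subset_left).trans hS))

end Family

section Sample

variable {n : ℕ} {G : SimpleGraph (Fin n)}

/-- A sample `W` of the component `V` that meets no set of a certain family of small sets too often
is representative: separators of balanced bipartitions of `W` leave no large component. -/
theorem exists_small_sets {V S : List (Fin n)} {κ : ℕ} (hVn : V.Nodup)
    (hV : IsComp G S.toFinset V.toFinset) (hκ : 1 ≤ κ) (hN : 160000 * κ ≤ V.length) :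
    ∃ 𝓕 : Finset (Finset (Fin n)), 𝓕.card ≤ (402 * κ + 1) ^ κ * 4 ^ (402 * κ) ∧
      (∀ F ∈ 𝓕, 100 * F.card ≤ V.length) ∧
      ∀ W A B S₁ C : List (Fin n), W.Nodup → (∀ w ∈ W, w ∈ V) →
        (∀ F ∈ 𝓕, 3 * (W.filter (· ∈ F)).length < W.length) →
        (A ++ B).Perm W → Balanced A B → S₁.length ≤ κ → C.Nodup →
        Separates G (S₁.toFinset ∪ S.toFinset) A.toFinset B.toFinset →
        IsComp G (S₁ ++ S).toFinset C.toFinset → (∀ c ∈ C, c ∈ V) →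
        200 * C.length ≤ 199 * V.length := by
  obtain ⟨N, hNdef⟩ : ∃ N, V.length = N := ⟨_, rfl⟩
  -- bins of this size contribute at most `N / 200` to the error in `exists_family`
  obtain ⟨θ, hθ⟩ : ∃ θ, N / (400 * κ) = θ := ⟨_, rfl⟩
  have hθ1 : 400 * κ * θ ≤ N := hθ ▸ Nat.mul_div_le N (400 * κ)
  have hθ2 : N < 400 * κ * (θ + 1) := by
    rw [← hθ]
    exact Nat.lt_mul_div_succ N (by omega)
  have hθ400 : 400 ≤ θ := by
    rw [← hθ, Nat.le_div_iff_mul_le (by omega)]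
    omega
  have hcard : V.toFinset.card = N := hNdef ▸ List.toFinset_card_of_nodup hVn
  obtain ⟨𝓕, h1, h2⟩ := exists_family (G := G) (N := N) (θ := θ) (p := 402 * κ) (by omega)
    (by nlinarith) κ S.toFinset V.toFinset hV hcard.le
  refine ⟨𝓕.filter fun F => 100 * F.card ≤ N, (Finset.card_filter_le _ _).trans h1,
    fun F hF => hNdef ▸ (Finset.mem_filter.1 hF).2, ?_⟩
  intro W A B S₁ C hWn hWV hW hAB hbal hS₁ hCn hsep hC hCV
  by_contra hcon
  have hCcard : C.toFinset.card = C.length := List.toFinset_card_of_nodup hCn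
  have hCV' : C.toFinset ⊆ V.toFinset := fun v hv => by simpa using hCV v (by simpa using hv)
  obtain ⟨F, hF, hF1, hF2⟩ := h2 S₁.toFinset C.toFinset ((List.toFinset_card_le _).trans hS₁)
    (by rwa [List.toFinset_append, Finset.union_comm] at hC) hCV' (by omega)
  have hsd := Finset.card_sdiff_add_card_eq_card hCV'
  have hFN : 100 * F.card ≤ N := by
    have : 2 * θ * κ * 200 ≤ N := by
      calc 2 * θ * κ * 200 = 400 * κ * θ := by ring
        _ ≤ N := hθ1
    omega
  have hWF := hW F (Finset.mem_filter.2 ⟨hF, hFN⟩)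
  have hABn := hAB.nodup_iff.2 hWn
  have hlen := hAB.length_eq
  rw [List.length_append] at hlen
  -- a side that misses `C` is contained in the small set
  have key : ∀ D : List (Fin n), D.Nodup → (∀ v ∈ D, v ∈ W) → (∀ v ∈ D, v ∉ C) →
      3 * D.length < W.length := by
    intro D hDn hDW hDC
    refine lt_of_le_of_lt (Nat.mul_le_mul_left 3 ?_) hWF
    refine (List.subperm_of_subset hDn fun v hv => ?_).length_le
    rw [List.mem_filter]
    refine ⟨hDW v hv, decide_eq_true (hF1 (Finset.mem_sdiff.2 ⟨?_, ?_⟩))⟩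
    · simpa using hWV v (hDW v hv)
    · simpa using hDC v hv
  obtain ⟨hb1, hb2⟩ := hbal
  obtain ⟨hAn, hBn, -⟩ := List.nodup_append'.1 hABn
  by_cases hA : ∀ v ∈ A, v ∉ C
  · have := key A hAn (fun v hv => hAB.mem_iff.1 (List.mem_append_left _ hv)) hA
    omega
  by_cases hB : ∀ v ∈ B, v ∉ C
  · have := key B hBn (fun v hv => hAB.mem_iff.1 (List.mem_append_right _ hv)) hB
    omega
  push Not at hA hB
  obtain ⟨a, ha, haC⟩ := hA
  obtain ⟨b, hb, hbC⟩ := hB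
  rw [List.toFinset_append] at hC
  exact separates_iff.1 hsep a (by simpa using ha) b (by simpa using hb)
    (hC.linked (by simpa using haC) (by simpa using hbC))

end Sample

/-! ### The random sample -/

section Expectation

variable {n : ℕ} {α β : Type} {Cov : Matrix (Fin n) (Fin n) ℝ}

/-- The expectation of a function of the returned value. -/
noncomputable def valueEv (Cov : Matrix (Fin n) (Fin n) ℝ) (p : Prog n ℝ α) (φ : α → ℝ) : ℝ :=
  ev Cov p fun o => φ o.value

theorem valueEv_pure (a : α) (φ : α → ℝ) : valueEv Cov (pure a) φ = φ a := rfl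

theorem valueEv_bind (p : Prog n ℝ α) (f : α → Prog n ℝ β) (φ : β → ℝ) :
    valueEv Cov (p >>= f) φ = valueEv Cov p fun a => valueEv Cov (f a) φ := ev_bind p f _

theorem valueEv_const (p : Prog n ℝ α) (c : ℝ) : valueEv Cov p (fun _ => c) = c := ev_const p c

theorem valueEv_le (p : Prog n ℝ α) {φ ψ : α → ℝ} (h : ∀ a, φ a ≤ ψ a) :
    valueEv Cov p φ ≤ valueEv Cov p ψ := ev_le_ev p _ _ fun o => h o.value

theorem valueEv_mono {p : Prog n ℝ α} {Q : α → Prop} {q t : ℕ} (h : Spec Cov p Q q t)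
    {φ ψ : α → ℝ} (hφ : ∀ a, Q a → φ a ≤ ψ a) : valueEv Cov p φ ≤ valueEv Cov p ψ :=
  ev_mono h fun _ ho _ _ => hφ _ ho

theorem valueEv_bind_le {p : Prog n ℝ α} {f : α → Prog n ℝ β} {φ : β → ℝ} {c : ℝ}
    (h : ∀ a, valueEv Cov (f a) φ ≤ c) : valueEv Cov (p >>= f) φ ≤ c := by
  rw [valueEv_bind]
  exact (valueEv_le p h).trans (valueEv_const p c).le

theorem valueEv_bind_le_of_spec {p : Prog n ℝ α} {f : α → Prog n ℝ β} {φ : β → ℝ} {c : ℝ}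
    {Q : α → Prop} {q t : ℕ} (hp : Spec Cov p Q q t) (h : ∀ a, Q a → valueEv Cov (f a) φ ≤ c) :
    valueEv Cov (p >>= f) φ ≤ c := by
  rw [valueEv_bind]
  exact (valueEv_mono hp h).trans (valueEv_const p c).le

theorem valueEv_step (f : Unit → Prog n ℝ β) (φ : β → ℝ) :
    valueEv Cov (step >>= f) φ = valueEv Cov (f ()) φ := by
  rw [valueEv_bind]; rfl

/-- A potential `φ`, indexed by the number of remaining iterations, that does not increase in
expectation. -/
theorem valueEv_forEach {f : β → α → Prog n ℝ β} (I : ℕ → β → Prop) (φ : ℕ → β → ℝ)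
    (hI : ∀ a b j, I (j + 1) b → ∃ q t, Spec Cov (f b a) (I j) q t)
    (hφ : ∀ a b j, I (j + 1) b → valueEv Cov (f b a) (φ j) ≤ φ (j + 1) b) (L : List α) (b : β)
    (hb : I L.length b) : valueEv Cov (forEach L b f) (φ 0) ≤ φ L.length b := by
  induction L generalizing b with
  | nil => exact (valueEv_pure b _).le
  | cons a L ih =>
    rw [forEach, valueEv_step, valueEv_bind]
    obtain ⟨q, t, hs⟩ := hI a b _ hb
    exact (valueEv_mono hs fun b' hb' => ih b' hb').trans (hφ a b _ hb)

end Expectation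

section Sampling

variable {n : ℕ} {Cov : Matrix (Fin n) (Fin n) ℝ}

/-- The expectation over one draw. -/
theorem valueEv_sampleStep (v : Fin n) (vs W : List (Fin n)) (φ : List (Fin n) → ℝ) :
    valueEv Cov (sampleStep v vs W) φ ≤
      ((v :: vs).map fun w => φ (if w ∈ W then W else w :: W)).sum / (v :: vs).length := by
  rw [sampleStep, valueEv_bind]
  have h : ∀ i : Fin (vs.length + 1), valueEv Cov (member ((v :: vs).getD (i : ℕ) v) W >>=
      fun b => pure (if b then W else (v :: vs).getD (i : ℕ) v :: W)) φ ≤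
        φ (if (v :: vs)[(i : ℕ)] ∈ W then W else (v :: vs)[(i : ℕ)] :: W) := by
    intro i
    refine valueEv_bind_le_of_spec (spec_member _ W) fun b hb => ?_
    subst hb
    rw [valueEv_pure, List.getD_eq_getElem _ _ (by simpa using i.is_le)]
    simp
  refine (valueEv_le _ h).trans (le_of_eq ?_)
  rw [← Fin.sum_univ_fun_getElem]
  simp only [valueEv, uniform, ev, List.length_cons, Nat.cast_add, Nat.cast_one]
  rfl

/-- If the expectation of the potential does not increase in a step, then the final expectation is
at most the initial potential; the potential `φ j` is evaluated when `j` draws remain. -/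
theorem valueEv_sample_le {m : ℕ} {V : List (Fin n)} (hV : V ≠ []) (φ : ℕ → List (Fin n) → ℝ)
    (hφ : ∀ W : List (Fin n), ∀ j, W.Nodup → (∀ w ∈ W, w ∈ V) → W.length + (j + 1) ≤ m →
      (V.map fun w => φ j (if w ∈ W then W else w :: W)).sum ≤ V.length * φ (j + 1) W) :
    valueEv Cov (sample m V) (φ 0) ≤ φ m [] := by
  cases V with
  | nil => exact absurd rfl hV
  | cons v vs =>
    refine valueEv_bind_le_of_spec (spec_size vs) fun N hN => ?_
    subst hN
    have := valueEv_forEach (Cov := Cov) (f := fun W (_ : ℕ) => sampleStep v vs W)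
      (fun j W => W.Nodup ∧ (∀ w ∈ W, w ∈ v :: vs) ∧ W.length + j ≤ m) φ
      (fun a W j h => ⟨_, _, spec_sampleStep v vs W h⟩) (fun a W j h => ?_) (List.range m) []
      (by simp)
    · rwa [List.length_range] at this
    · refine (valueEv_sampleStep v vs W _).trans ?_
      rw [div_le_iff₀ (by rw [List.length_cons]; positivity), mul_comm]
      exact hφ W j h.1 h.2.1 h.2.2

/-- The expected number of repetitions among `m` draws from more than `m` vertices is at most
`m / 2`. -/
theorem valueEv_sample_repetitions {m : ℕ} {V : List (Fin n)} (hVn : V.Nodup)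
    (hm : m < V.length) :
    valueEv Cov (sample m V) (fun W => (m : ℝ) - W.length) ≤ m / 2 := by
  have hN : (0 : ℝ) < V.length := by exact_mod_cast (by omega : 0 < V.length)
  -- With `j` draws left, `m - |W| - j` repetitions have occurred, and the draw that leaves `i` more
  -- is a repetition with probability at most `(m - 1 - i) / |V|`; the potential sums this over `i <
  -- j`.
  have h := valueEv_sample_le (Cov := Cov) (m := m) (V := V) (by rintro rfl; simp at hm)
    (fun j W => (m : ℝ) - W.length - j + (j * (m - 1) - j * (j - 1) / 2) / V.length) ?_
  · simp only [Nat.cast_zero, zero_mul, sub_zero, zero_div, add_zero, List.length_nil,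
      sub_self, zero_add] at h
    refine h.trans ?_
    rw [div_le_iff₀ hN]
    have hmN : (m : ℝ) ≤ V.length := by exact_mod_cast hm.le
    nlinarith [Nat.cast_nonneg (α := ℝ) m]
  · intro W j hW hWV hj
    have hcount : (V.map fun w => if w ∈ W then (1 : ℝ) else 0).sum = W.length := by
      rw [← List.sum_toFinset _ hVn, Finset.sum_ite, Finset.sum_const_zero, add_zero,
        Finset.sum_const, nsmul_eq_mul, mul_one, ← List.toFinset_card_of_nodup hW]
      congr 2
      ext w
      simp only [Finset.mem_filter, List.mem_toFinset]
      exact ⟨fun h => h.2, fun h => ⟨hWV w h, h⟩⟩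
    have he : ∀ w, ((m : ℝ) - (if w ∈ W then W else w :: W).length - j +
        (j * (m - 1) - j * (j - 1) / 2) / V.length) =
          ((m : ℝ) - W.length - j - 1 + (j * (m - 1) - j * (j - 1) / 2) / V.length) +
            if w ∈ W then 1 else 0 := by
      intro w
      split_ifs
      · ring
      · rw [List.length_cons]; push_cast; ring
    simp only [he]
    rw [List.sum_map_add, hcount, List.map_const', List.sum_replicate, nsmul_eq_mul]
    have hj' : (W.length : ℝ) + (j + 1) ≤ m := by exact_mod_cast hj
    push_cast
    field_simp
    nlinarith

/-- The exponential moment of the number of sampled vertices in a small set. -/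
theorem valueEv_sample_small {m : ℕ} {V : List (Fin n)} (hVn : V.Nodup) (hV : V ≠ [])
    {F : Finset (Fin n)} (hF : 100 * F.card ≤ V.length) :
    valueEv Cov (sample m V) (fun W => 2 ^ (W.filter (· ∈ F)).length) ≤ (101 / 100 : ℝ) ^ m := by
  -- each draw lands in `F`, and at most doubles the value, with probability at most `1 / 100`
  have h := valueEv_sample_le (Cov := Cov) (m := m) hV
    (fun j W => (101 / 100 : ℝ) ^ j * 2 ^ (W.filter (· ∈ F)).length) ?_
  · simpa using h
  · intro W j hW hWV hj
    have he : ∀ w, (101 / 100 : ℝ) ^ j * 2 ^ ((if w ∈ W then W else w :: W).filter (· ∈ F)).length ≤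
        ((101 / 100 : ℝ) ^ j * 2 ^ (W.filter (· ∈ F)).length) * (1 + if w ∈ F then 1 else 0) := by
      intro w
      have hpos : (0 : ℝ) ≤ (101 / 100 : ℝ) ^ j * 2 ^ (W.filter (· ∈ F)).length := by positivity
      by_cases hw : w ∈ W
      · rw [if_pos hw]
        exact le_mul_of_one_le_right hpos (by split_ifs <;> norm_num)
      · rw [if_neg hw]
        by_cases hwF : w ∈ F
        · rw [List.filter_cons_of_pos (by simpa using hwF), List.length_cons, if_pos hwF, pow_succ]
          linarith
        · rw [List.filter_cons_of_neg (by simpa using hwF), if_neg hwF]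
          linarith
    refine (List.sum_le_sum fun w _ => he w).trans ?_
    rw [List.sum_map_mul_left, List.sum_map_add, List.map_const', List.sum_replicate, nsmul_eq_mul,
      mul_one]
    have hcount : (V.map fun w => if w ∈ F then (1 : ℝ) else 0).sum ≤ F.card := by
      rw [← List.sum_toFinset _ hVn, Finset.sum_ite, Finset.sum_const_zero, add_zero,
        Finset.sum_const, nsmul_eq_mul, mul_one]
      exact_mod_cast Finset.card_le_card fun w hw => (Finset.mem_filter.1 hw).2
    have hF' : 100 * (F.card : ℝ) ≤ V.length := by exact_mod_cast hF
    have hpos : (0 : ℝ) ≤ (101 / 100 : ℝ) ^ j * 2 ^ (W.filter (· ∈ F)).length := by positivity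
    calc _ ≤ ((101 / 100 : ℝ) ^ j * 2 ^ (W.filter (· ∈ F)).length) * (V.length * (101 / 100)) :=
          mul_le_mul_of_nonneg_left (by linarith) hpos
      _ = _ := by ring

open Classical in
/-- A sample is large and meets none of the small sets too often, with probability at least
`7 / 20`. -/
theorem valueEv_sample_bad {m : ℕ} {V : List (Fin n)} (hVn : V.Nodup) (hm : m < V.length)
    (hm1 : 1 ≤ m) {𝓕 : Finset (Finset (Fin n))} (h𝓕 : ∀ F ∈ 𝓕, 100 * F.card ≤ V.length)
    (hnum : (𝓕.card : ℝ) * (101 / 100) ^ m ≤ 1 / 20 * 2 ^ ((m : ℝ) / 18)) :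
    valueEv Cov (sample m V) (fun W => if m ≤ 6 * W.length ∧
      ∀ F ∈ 𝓕, 3 * (W.filter (· ∈ F)).length < W.length then 0 else 1) ≤ 13 / 20 := by
  have hV : V ≠ [] := by rintro rfl; simp at hm
  have hm0 : (0 : ℝ) < m := by exact_mod_cast hm1
  have hpow : (0 : ℝ) < 2 ^ ((m : ℝ) / 18) := by positivity
  -- Markov's inequality: a sample with fewer than `m / 6` vertices has more than `5 * m / 6`
  -- repetitions, and a set that contains a third of a larger sample contains at least `m / 18`
  -- vertices of it
  have key : valueEv Cov (sample m V) (fun W => if m ≤ 6 * W.length ∧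
      ∀ F ∈ 𝓕, 3 * (W.filter (· ∈ F)).length < W.length then 0 else 1) ≤
      valueEv Cov (sample m V) fun W => 6 / (5 * m) * ((m : ℝ) - W.length) +
        ∑ F ∈ 𝓕, (2 ^ ((m : ℝ) / 18))⁻¹ * 2 ^ (W.filter (· ∈ F)).length := by
    refine valueEv_mono (spec_sample m V) fun W hW => ?_
    have hWm : (W.length : ℝ) ≤ m := by exact_mod_cast hW.2.2
    have h1 : (0 : ℝ) ≤ 6 / (5 * m) * ((m : ℝ) - W.length) :=
      mul_nonneg (by positivity) (by linarith)
    have h2 : ∀ F ∈ 𝓕, (0 : ℝ) ≤ (2 ^ ((m : ℝ) / 18))⁻¹ * 2 ^ (W.filter (· ∈ F)).length :=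
      fun F _ => by positivity
    split_ifs with h
    · exact add_nonneg h1 (Finset.sum_nonneg h2)
    · by_cases hW6 : m ≤ 6 * W.length
      · have : ∃ F ∈ 𝓕, W.length ≤ 3 * (W.filter (· ∈ F)).length := by
          by_contra hcon
          push Not at hcon
          exact h ⟨hW6, hcon⟩
        obtain ⟨F, hF, hFW⟩ := this
        refine le_add_of_nonneg_of_le h1 (le_trans ?_ (Finset.single_le_sum h2 hF))
        rw [inv_mul_eq_div, one_le_div hpow, ← Real.rpow_natCast]
        refine Real.rpow_le_rpow_of_exponent_le (by norm_num) ?_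
        rw [div_le_iff₀ (by norm_num)]
        exact_mod_cast (by omega : m ≤ (W.filter (· ∈ F)).length * 18)
      · refine le_add_of_le_of_nonneg ?_ (Finset.sum_nonneg h2)
        have : 6 * (W.length : ℝ) < m := by exact_mod_cast (by omega : 6 * W.length < m)
        rw [div_mul_eq_mul_div, one_le_div (by positivity)]
        linarith
  refine key.trans ?_
  have e : (valueEv Cov (sample m V) fun W => 6 / (5 * m) * ((m : ℝ) - W.length) +
        ∑ F ∈ 𝓕, (2 ^ ((m : ℝ) / 18))⁻¹ * 2 ^ (W.filter (· ∈ F)).length) =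
      6 / (5 * m) * valueEv Cov (sample m V) (fun W => (m : ℝ) - W.length) +
        ∑ F ∈ 𝓕, (2 ^ ((m : ℝ) / 18))⁻¹ *
          valueEv Cov (sample m V) (fun W => 2 ^ (W.filter (· ∈ F)).length) := by
    simp only [valueEv, ev_add, ev_sum, ev_mul]
  rw [e]
  have a1 : 6 / (5 * m) * valueEv Cov (sample m V) (fun W => (m : ℝ) - W.length) ≤ 3 / 5 := by
    refine (mul_le_mul_of_nonneg_left (valueEv_sample_repetitions hVn hm)
      (by positivity)).trans (le_of_eq ?_)
    field_simp
    norm_num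
  have a2 : ∑ F ∈ 𝓕, (2 ^ ((m : ℝ) / 18))⁻¹ *
      valueEv Cov (sample m V) (fun W => 2 ^ (W.filter (· ∈ F)).length) ≤ 1 / 20 := by
    refine (Finset.sum_le_sum fun F hF => mul_le_mul_of_nonneg_left
      (valueEv_sample_small hVn hV (h𝓕 F hF)) (by positivity)).trans ?_
    rw [Finset.sum_const, nsmul_eq_mul, mul_left_comm, inv_mul_le_iff₀ hpow]
    linarith
  linarith

end Sampling

/-! ### The sample size -/

/-- The sample size bound in terms of `k`: as `r / δ ^ 2` is at least `11 * 24 ^ 2 * k = 6336 * k`,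
the factor is `10 * 6336` and the argument of the logarithm is `8 * 6336 * k`. -/
theorem SampleBound.le {m k : ℕ} {r δ τ : ℝ} (h : SampleBound m r δ τ) (hk : 1 ≤ k)
    (hr : 11 * (k : ℝ) ≤ r) (hδ : 0 < δ) (hδ' : δ ≤ 1 / 24) :
    63360 * (k * Real.log (50688 * k)) ≤ m := by
  have hk1 : (1 : ℝ) ≤ k := by exact_mod_cast hk
  have hδ2 : (576 : ℝ) ≤ 1 / δ ^ 2 := by
    rw [le_div_iff₀ (by positivity)]
    nlinarith
  have h1 : 6336 * (k : ℝ) ≤ r / δ ^ 2 := by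
    have : 11 * (k : ℝ) * 576 ≤ r * (1 / δ ^ 2) :=
      mul_le_mul hr hδ2 (by norm_num) (by linarith)
    calc 6336 * (k : ℝ) = 11 * k * 576 := by ring
      _ ≤ r * (1 / δ ^ 2) := this
      _ = r / δ ^ 2 := by ring
  have h2 : Real.log (50688 * k) ≤ Real.log (8 * r / δ ^ 2) :=
    Real.log_le_log (by positivity) (by rw [mul_div_assoc]; linarith)
  have h3 : 0 ≤ Real.log (50688 * k) := Real.log_nonneg (by linarith)
  calc 63360 * (k * Real.log (50688 * k)) = 10 * (6336 * k) * Real.log (50688 * k) := by ring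
    _ ≤ 10 * (r / δ ^ 2) * Real.log (8 * r / δ ^ 2) :=
      mul_le_mul (by linarith) h2 h3 (by linarith)
    _ = 10 * r / δ ^ 2 * Real.log (8 * r / δ ^ 2) := by ring
    _ ≤ m := (le_max_left _ _).trans h

theorem ten_le_log {k : ℕ} (hk : 1 ≤ k) : 10 ≤ Real.log (50688 * k) := by
  have hk1 : (1 : ℝ) ≤ k := by exact_mod_cast hk
  rw [Real.le_log_iff_exp_le (by positivity)]
  have h1 : Real.exp 10 = Real.exp 1 ^ 10 := by rw [← Real.exp_nat_mul]; norm_num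
  have h2 : Real.exp 1 ^ 10 ≤ (2.7183 : ℝ) ^ 10 :=
    pow_le_pow_left₀ (Real.exp_pos 1).le (Real.exp_one_lt_d9.le.trans (by norm_num)) 10
  have h3 : (2.7183 : ℝ) ^ 10 ≤ 50688 := by norm_num
  linarith

/-- The sample size beats the size of the family in the union bound. -/
theorem card_mul_pow_le {m k c : ℕ} (hk : 1 ≤ k)
    (hm : 63360 * (k * Real.log (50688 * k)) ≤ m)
    (hc : c ≤ (402 * (k + 1) + 1) ^ (k + 1) * 4 ^ (402 * (k + 1))) :
    (c : ℝ) * (101 / 100) ^ m ≤ 1 / 20 * 2 ^ ((m : ℝ) / 18) := by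
  set l := Real.log (50688 * k) with hl
  have hk1 : (1 : ℝ) ≤ k := by exact_mod_cast hk
  have hl10 : 10 ≤ l := ten_le_log hk
  have hexp : Real.exp l = 50688 * k := Real.exp_log (by positivity)
  have h4 : (4 : ℝ) ≤ Real.exp l := by rw [hexp]; linarith
  have hc' : (c : ℝ) ≤ Real.exp (806 * (k * l)) := by
    have h1 : (c : ℝ) ≤ (402 * (k + 1) + 1) ^ (k + 1) * 4 ^ (402 * (k + 1)) := by exact_mod_cast hc
    clear hc
    have h2 : (402 * ((k : ℝ) + 1) + 1) ^ (k + 1) ≤ Real.exp l ^ (2 * k) :=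
      (pow_le_pow_left₀ (by positivity) (by rw [hexp]; linarith) _).trans
        (pow_le_pow_right₀ (by linarith) (by omega))
    have h3 : (4 : ℝ) ^ (402 * (k + 1)) ≤ Real.exp l ^ (804 * k) :=
      (pow_le_pow_left₀ (by norm_num) h4 _).trans (pow_le_pow_right₀ (by linarith) (by omega))
    calc (c : ℝ) ≤ Real.exp l ^ (2 * k) * Real.exp l ^ (804 * k) :=
          h1.trans (mul_le_mul h2 h3 (by positivity) (by positivity))
      _ = Real.exp (806 * (k * l)) := by
          rw [← pow_add, ← Real.exp_nat_mul]
          congr 1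
          push_cast
          ring
  clear hc
  have h101 : (101 / 100 : ℝ) ^ m ≤ Real.exp (m / 100) := by
    have : (101 / 100 : ℝ) ≤ Real.exp (1 / 100) := by
      have := Real.add_one_le_exp (1 / 100 : ℝ)
      linarith
    calc (101 / 100 : ℝ) ^ m ≤ Real.exp (1 / 100) ^ m := pow_le_pow_left₀ (by norm_num) this m
      _ = Real.exp (m / 100) := by rw [← Real.exp_nat_mul]; congr 1; ring
  have h2m : Real.exp (69 / 100 * ((m : ℝ) / 18)) ≤ 2 ^ ((m : ℝ) / 18) := by
    rw [Real.rpow_def_of_pos (by norm_num)]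
    refine Real.exp_le_exp.2 (mul_le_mul_of_nonneg_right ?_ (by positivity))
    have := Real.log_two_gt_d9
    linarith
  have h20 : Real.exp (-4) ≤ 1 / 20 := by
    rw [Real.exp_neg, ← one_div]
    refine one_div_le_one_div_of_le (by norm_num) ?_
    have h1 : Real.exp 4 = Real.exp 1 ^ 4 := by rw [← Real.exp_nat_mul]; norm_num
    have h2 : (2.7 : ℝ) ^ 4 ≤ Real.exp 1 ^ 4 :=
      pow_le_pow_left₀ (by norm_num) (le_trans (by norm_num) Real.exp_one_gt_d9.le) 4
    have h3 : (20 : ℝ) ≤ (2.7 : ℝ) ^ 4 := by norm_num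
    linarith
  have hkl : 10 ≤ (k : ℝ) * l := by nlinarith
  -- by `hm`, `m` is at least `63360 * k * l`, and `69 / 1800 - 1 / 100 > 1 / 36`
  calc (c : ℝ) * (101 / 100) ^ m ≤ Real.exp (806 * (k * l)) * Real.exp (m / 100) :=
        mul_le_mul hc' h101 (by positivity) (by positivity)
    _ = Real.exp (806 * (k * l) + m / 100) := (Real.exp_add _ _).symm
    _ ≤ Real.exp (-4 + 69 / 100 * ((m : ℝ) / 18)) := Real.exp_le_exp.2 (by linarith)
    _ = Real.exp (-4) * Real.exp (69 / 100 * ((m : ℝ) / 18)) := Real.exp_add _ _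
    _ ≤ _ := mul_le_mul h20 h2m (by positivity) (by norm_num)

/-! ### The depth of the recursion -/

section Failure

variable {n : ℕ} {α β : Type} {Cov : Matrix (Fin n) (Fin n) ℝ}

/-- The probability that a program returns `none`. -/
noncomputable def failProb (Cov : Matrix (Fin n) (Fin n) ℝ) (p : Prog n ℝ (Option α)) : ℝ :=
  valueEv Cov p fun a => if a.isNone then 1 else 0

theorem failProb_le_one (p : Prog n ℝ (Option α)) : failProb Cov p ≤ 1 :=
  (valueEv_le p fun a => by split_ifs <;> norm_num).trans (valueEv_const p 1).le

/-- A union bound over the iterations of a loop whose state may be `none`. -/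
theorem failProb_forEach {f : Option β → α → Prog n ℝ (Option β)} (φ : α → ℝ) (L : List α)
    (hφ : ∀ a ∈ L, 0 ≤ φ a) (hf : ∀ a ∈ L, ∀ b, failProb Cov (f (some b) a) ≤ φ a)
    (st : Option β) :
    failProb Cov (forEach L st f) ≤ (if st.isNone then 1 else 0) + (L.map φ).sum := by
  induction L generalizing st with
  | nil => simp [forEach, failProb, valueEv_pure]
  | cons a L ih =>
    rw [forEach, failProb, valueEv_step, valueEv_bind]
    refine (valueEv_le _ fun b => ih (fun a h => hφ a (by simp [h]))
      (fun a h => hf a (by simp [h])) b).trans ?_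
    have e : (valueEv Cov (f st a) fun b => (if b.isNone then 1 else 0) + (L.map φ).sum) =
        failProb Cov (f st a) + (L.map φ).sum := by
      simp only [valueEv, failProb, ev_add, ev_const]
    rw [e, List.map_cons, List.sum_cons, ← add_assoc]
    refine add_le_add_left ?_ _
    cases st with
    | none =>
      have := failProb_le_one (Cov := Cov) (f none a)
      have := hφ a (by simp)
      simp only [Option.isNone_none, if_true]
      linarith
    | some b => simpa using hf a (by simp) b

theorem failProb_absorb (S S₁ : List (Fin n)) (s : ℕ) (D : List (List ℝ))
    (Tacc : Sparse n ℝ × List (List ℝ)) (C : List (Fin n)) (TC : Sparse n ℝ) :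
    failProb Cov (absorb S S₁ s D Tacc C TC) ≤ 0 :=
  valueEv_bind_le fun _ => valueEv_bind_le fun _ => valueEv_bind_le fun _ =>
    valueEv_bind_le fun _ => valueEv_bind_le fun _ => valueEv_bind_le fun _ =>
      valueEv_bind_le fun _ => valueEv_bind_le fun _ => by simp [valueEv_pure]

/-- A combined call fails only if a recursive call does. -/
theorem failProb_combine (rec : List (Fin n) → List (Fin n) → Prog n ℝ (Option (Sparse n ℝ)))
    (S : List (Fin n)) (res : List (Fin n) × List (List (Fin n))) {φ : List (Fin n) → ℝ}
    (hφ : ∀ C ∈ res.2, 0 ≤ φ C) (hrec : ∀ C ∈ res.2, failProb Cov (rec C (res.1 ++ S)) ≤ φ C) :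
    failProb Cov (combine rec S res) ≤ (res.2.map φ).sum := by
  refine valueEv_bind_le_of_spec (spec_append res.1 S) fun SS hSS => ?_
  subst hSS
  refine valueEv_bind_le fun s => valueEv_bind_le fun D => valueEv_bind_le fun I => ?_
  rw [valueEv_bind]
  have h := failProb_forEach (Cov := Cov) (f := fun st C =>
    match st with
    | none => pure none
    | some Tacc => do
        let KC ← rec C (res.1 ++ S)
        match KC with
        | none => pure none
        | some TC => absorb S res.1 s D Tacc C TC) φ res.2 hφ (fun C hC Tacc => ?_)
      (some (([] : Sparse n ℝ), I))
  · simp only [Option.isNone_some, Bool.false_eq_true, if_false, zero_add] at h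
    refine le_trans (valueEv_le _ fun st => ?_) h
    cases st with
    | none => exact le_rfl
    | some Tacc =>
      exact valueEv_bind_le fun _ => valueEv_bind_le fun _ => valueEv_bind_le fun _ => by
        simp [valueEv_pure]
  · refine le_trans ?_ (hrec C hC)
    simp only [failProb, valueEv_bind]
    refine valueEv_le _ fun KC => ?_
    cases KC with
    | none => exact le_rfl
    | some TC => exact failProb_absorb ..

/-- Since a good sample splits off components of at most `199 / 200` of the size, the expected
total of the squared sizes decreases geometrically with the depth of the recursion. -/
theorem failProb_reconstruct {G : SimpleGraph (Fin n)} [DecidableRel G.Adj]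
    {K : Fin n → Fin n → ℝ} (hK : Concentration G Cov K) (hgen : Generic G Cov) {k m : ℕ}
    (hk : 1 ≤ k) (hbal : HasBalancedSeparators G (k + 1))
    (hm : 63360 * (k * Real.log (50688 * k)) ≤ m) (depth : ℕ) :
    ∀ V S : List (Fin n), V.Nodup → S.Nodup → IsComp G S.toFinset V.toFinset →
      failProb Cov (reconstruct m depth V S) ≤ (999 / 1000) ^ depth * (V.length : ℝ) ^ 2 := by
  -- this makes the bins in `exists_small_sets` large enough
  have hm' : 160000 * (k + 1) ≤ m := by
    have h1 := ten_le_log hk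
    have hk1 : (1 : ℝ) ≤ k := by exact_mod_cast hk
    have : (160000 * (k + 1) : ℝ) ≤ m := by nlinarith
    exact_mod_cast this
  induction depth with
  | zero =>
    intro V S _ _ hV
    have hV1 : (1 : ℝ) ≤ V.length := by
      obtain ⟨v, hv⟩ := hV.1
      exact_mod_cast List.length_pos_of_mem (show v ∈ V by simpa using hv)
    refine (failProb_le_one _).trans ?_
    nlinarith
  | succ depth ih =>
    intro V S hVn hSn hV
    have hnn : ∀ x : ℝ, 0 ≤ (999 / 1000 : ℝ) ^ depth * x ^ 2 := fun x => by positivity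
    rw [reconstruct_succ]
    refine valueEv_bind_le_of_spec (spec_size V) fun v hv => ?_
    subst hv
    rw [valueEv_step]
    split_ifs with hVm
    · refine le_trans ((valueEv_mono (spec_smallCase hK hVn hSn hV le_rfl) fun r hr => ?_).trans
        (valueEv_const _ 0).le) (by positivity)
      obtain ⟨T, rfl, -⟩ := hr
      simp
    · push Not at hVm
      rw [components_eq, Prog.assoc, valueEv_bind]
      obtain ⟨𝓕, h𝓕card, h𝓕, hgood⟩ := exists_small_sets hVn hV (κ := k + 1) (by omega)
        (hm'.trans hVm.le)
      have hbad := valueEv_sample_bad (Cov := Cov) hVn hVm (by omega) h𝓕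
        (card_mul_pow_le hk hm h𝓕card)
      clear h𝓕card
      classical
      refine le_trans (valueEv_mono (spec_sample m V) (ψ := fun W =>
        (999 / 1000) ^ depth * (V.length : ℝ) ^ 2 * (199 / 200) +
          (999 / 1000) ^ depth * (V.length : ℝ) ^ 2 * (1 / 200) *
            if m ≤ 6 * W.length ∧ ∀ F ∈ 𝓕, 3 * (W.filter (· ∈ F)).length < W.length then 0 else 1)
        fun W hW => ?_) ?_
      · obtain ⟨hWn, hWV, hWm⟩ := hW
        rw [Prog.assoc]
        refine valueEv_bind_le_of_spec (spec_separatorOf hgen hbal hVn hSn hV hWn hWV hWm le_rfl)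
          fun S₁ hS₁ => ?_
        obtain ⟨hS₁n, hS₁V, hS₁κ, hsplit⟩ := hS₁
        refine valueEv_bind_le_of_spec (spec_componentsOf hgen le_rfl hVn hSn hV hS₁n hS₁V hS₁κ
          le_rfl le_rfl) fun res hres => ?_
        obtain ⟨rfl, -, hperm, hC⟩ := hres
        obtain ⟨hn1, hn2, hn3⟩ := List.nodup_append'.1 (hperm.nodup_iff.2 hVn)
        have hCV : ∀ C ∈ res.2, ∀ c ∈ C, c ∈ V := fun C hC c hc =>
          hperm.mem_iff.1 (List.mem_append_right _ (List.mem_flatten.2 ⟨C, hC, hc⟩))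
        have hCn : ∀ C ∈ res.2, C.Nodup := (List.nodup_flatten.1 hn2).1
        have hlen : ((res.2.map fun C => (C.length : ℝ))).sum ≤ V.length := by
          have h1 : (res.2.map List.length).sum ≤ V.length := by
            rw [← List.length_flatten, ← hperm.length_eq, List.length_append]
            omega
          have h2 : ((res.2.map fun C => (C.length : ℝ))).sum =
              (((res.2.map List.length).sum : ℕ) : ℝ) := by
            rw [Nat.cast_list_sum, List.map_map]
            rfl
          rw [h2]
          exact_mod_cast h1
        have hsum : ∀ c : ℝ, 0 ≤ c → (∀ C ∈ res.2, (C.length : ℝ) ≤ c * V.length) →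
            failProb Cov (combine (reconstruct m depth) S res) ≤
              (999 / 1000) ^ depth * (V.length : ℝ) ^ 2 * c := by
          intro c hc hCc
          refine (failProb_combine _ S res (φ := fun C => (999 / 1000) ^ depth *
            (c * V.length) * C.length) (fun C _ => by positivity) fun C hC' => ?_).trans ?_
          · refine (ih C (res.1 ++ S) (hCn C hC') (List.nodup_append'.2 ⟨hn1, hSn,
              fun s hs hs' => ?_⟩) (hC C hC')).trans ?_
            · exact hV.notMem (v := s) (by simpa using hS₁V s hs) (by simpa using hs')
            · rw [pow_two, mul_assoc]
              exact mul_le_mul_of_nonneg_left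
                (mul_le_mul_of_nonneg_right (hCc C hC') (by positivity)) (by positivity)
          · rw [List.sum_map_mul_left]
            calc _ ≤ (999 / 1000) ^ depth * (c * V.length) * (V.length : ℝ) :=
                  mul_le_mul_of_nonneg_left hlen (by positivity)
              _ = _ := by ring
        -- a good sample shrinks the components by a factor, a bad one at least does not enlarge
        -- them
        split_ifs with hWgood
        · rw [mul_zero, add_zero]
          refine hsum _ (by norm_num) fun C hC' => ?_
          obtain ⟨A, B, hAB, hbalAB, hsep⟩ := hsplit (by omega)
          have := hgood W A B res.1 C hWn hWV hWgood.2 hAB hbalAB hS₁κ (hCn C hC') hsep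
            (hC C hC') (hCV C hC')
          have : (200 : ℝ) * C.length ≤ 199 * V.length := by exact_mod_cast this
          linarith
        · refine (hsum 1 (by norm_num) fun C hC' => ?_).trans (le_of_eq (by ring))
          rw [one_mul]
          exact_mod_cast (List.subperm_of_subset (hCn C hC') (hCV C hC')).length_le
      · have e : ∀ (a b : ℝ) (φ : List (Fin n) → ℝ),
            valueEv Cov (sample m V) (fun W => a + b * φ W) =
              a + b * valueEv Cov (sample m V) φ := by
          intro a b φ
          simp only [valueEv, ev_add, ev_mul, ev_const]
        rw [e]
        -- a bad sample has probability at most `13 / 20`, and `199 / 200 + 13 / 4000 < 999 / 1000`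
        have := mul_le_mul_of_nonneg_left hbad (show 0 ≤ (999 / 1000 : ℝ) ^ depth *
          (V.length : ℝ) ^ 2 * (1 / 200) by positivity)
        have h0 := hnn V.length
        rw [pow_succ (999 / 1000 : ℝ) depth]
        refine (add_le_add_right this _).trans ?_
        linarith

end Failure

section Depth

variable {n : ℕ} {α β γ : Type} {Cov : Matrix (Fin n) (Fin n) ℝ}

/-- Every outcome of `p` other than `none` is at least as likely for `p'`. -/
def LessDefined (Cov : Matrix (Fin n) (Fin n) ℝ) (p p' : Prog n ℝ (Option α)) : Prop :=
  ∀ Φ : Outcome (Option α) → ℝ, (∀ o, 0 ≤ Φ o) → (∀ o, o.value = none → Φ o = 0) →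
    ev Cov p Φ ≤ ev Cov p' Φ

theorem LessDefined.refl (p : Prog n ℝ (Option α)) : LessDefined Cov p p := fun _ _ _ => le_rfl

theorem LessDefined.trans {p p' p'' : Prog n ℝ (Option α)} (h : LessDefined Cov p p')
    (h' : LessDefined Cov p' p'') : LessDefined Cov p p'' := fun Φ h0 h1 =>
  (h Φ h0 h1).trans (h' Φ h0 h1)

theorem ev_nonneg (p : Prog n ℝ α) {Φ : Outcome α → ℝ} (h : ∀ o, 0 ≤ Φ o) : 0 ≤ ev Cov p Φ :=
  (ev_const p 0).ge.trans (ev_le_ev p _ _ h)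

theorem LessDefined.pure_none (p : Prog n ℝ (Option α)) :
    LessDefined Cov (pure none) p := fun _ h0 h1 => (h1 _ rfl).le.trans (ev_nonneg p h0)

theorem LessDefined.bind_right (p : Prog n ℝ α) {f f' : α → Prog n ℝ (Option β)}
    (h : ∀ a, LessDefined Cov (f a) (f' a)) : LessDefined Cov (p >>= f) (p >>= f') := by
  intro Φ h0 h1
  rw [ev_bind, ev_bind]
  exact ev_le_ev p _ _ fun o => h o.value _ (fun _ => h0 _) fun o' ho' => h1 _ ho'

theorem LessDefined.bind_left {p p' : Prog n ℝ (Option α)} {f : Option α → Prog n ℝ (Option β)}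
    (h : LessDefined Cov p p') (hf : LessDefined Cov (f none) (pure none)) :
    LessDefined Cov (p >>= f) (p' >>= f) := by
  intro Φ h0 h1
  rw [ev_bind, ev_bind]
  refine h _ (fun o => ev_nonneg _ fun _ => h0 _) fun o ho => le_antisymm ?_ ?_
  · rw [ho]
    exact (hf (fun o' => Φ (o'.charge o.queries o.time)) (fun _ => h0 _)
      fun o' ho' => h1 _ ho').trans (h1 _ rfl).le
  · exact ev_nonneg _ fun _ => h0 _

theorem LessDefined.forEach_none (L : List α) {f : Option β → α → Prog n ℝ (Option β)}
    (hf : ∀ a, f none a = pure none) : LessDefined Cov (forEach L none f) (pure none) := by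
  induction L with
  | nil => exact LessDefined.refl _
  | cons a L ih =>
    intro Φ h0 h1
    rw [forEach, hf]
    refine (ih (fun o => Φ (o.charge 0 1)) (fun o => h0 _) fun o ho => h1 _ ho).trans ?_
    exact (h1 _ rfl).le.trans (h1 _ rfl).ge

theorem LessDefined.forEach (L : List α) {f f' : Option β → α → Prog n ℝ (Option β)}
    (hf : ∀ a, f none a = pure none) (h : ∀ a ∈ L, ∀ st, LessDefined Cov (f st a) (f' st a))
    (st : Option β) : LessDefined Cov (forEach L st f) (forEach L st f') := by
  induction L generalizing st with
  | nil => exact LessDefined.refl _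
  | cons a L ih =>
    exact .bind_right _ fun _ => (LessDefined.bind_left (h a (by simp) st)
      (forEach_none L hf)).trans (.bind_right _ fun c => ih (fun a ha => h a (by simp [ha])) c)

/-- A larger bound on the depth does not affect the executions that stay below the smaller one. -/
theorem lessDefined_reconstruct (m depth : ℕ) : ∀ V S : List (Fin n),
    LessDefined Cov (reconstruct m depth V S) (reconstruct m (depth + 1) V S) := by
  induction depth with
  | zero => exact fun V S => LessDefined.pure_none _
  | succ depth ih =>
    intro V S
    rw [reconstruct_succ, reconstruct_succ]
    refine .bind_right _ fun v => .bind_right _ fun _ => ?_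
    split_ifs
    · exact LessDefined.refl _
    · refine .bind_right _ fun res => .bind_right _ fun SS => .bind_right _ fun s =>
        .bind_right _ fun D => .bind_right _ fun I => ?_
      refine LessDefined.bind_left (.forEach _ (fun _ => rfl) (fun C _ st => ?_) _)
        (LessDefined.refl _)
      cases st with
      | none => exact LessDefined.refl _
      | some Tacc => exact LessDefined.bind_left (ih C SS) (LessDefined.refl _)

theorem lessDefined_reconstruct_of_le (m : ℕ) {depth depth' : ℕ} (h : depth ≤ depth')
    (V S : List (Fin n)) :
    LessDefined Cov (reconstruct m depth V S) (reconstruct m depth' V S) := by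
  induction depth', h using Nat.le_induction with
  | base => exact LessDefined.refl _
  | succ depth' _ ih => exact ih.trans (lessDefined_reconstruct m depth' V S)

end Depth

/-! ### The bounds on the cost -/

section Cost

/-- The cost bounds of `spec_reconstruct` for recursions of logarithmic depth, in closed form. -/
theorem cost_le_bounds {L C : ℝ} (hL : 0 < L)
    (hC : C = 4 * L + 10 ^ 20 * ((2 : ℝ) ^ (4 * L) + 7)) {n k d m l σ τ : ℕ}
    (hn : 2 ≤ n) (hk : 1 ≤ k) (hd : 1 ≤ d) (hm : (m : ℝ) ≤ L * (1 + k * Real.log k))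
    (hl : l = ⌈10000 * Real.log n⌉₊) (hσ : σ = l * (k + 1) + 1) (hτ : τ = d * (k + 1) + 1) :
    ((l * (4 * (2 ^ m * (m + σ) ^ 2) + 4 * (τ * σ ^ 2)) * n : ℕ) : ℝ) ≤ queryBound C n k d ∧
      ((l * (200 * (2 ^ m * (m + σ) ^ 3) + 300 * (τ * σ ^ 3)) * n : ℕ) : ℝ) ≤
        timeBound C n k d := by
  have hn2 : (2 : ℝ) ≤ n := by exact_mod_cast hn
  have hk1 : (1 : ℝ) ≤ k := by exact_mod_cast hk
  have hd1 : (1 : ℝ) ≤ d := by exact_mod_cast hd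
  obtain ⟨x, hx⟩ : ∃ x, Real.log n = x := ⟨_, rfl⟩
  obtain ⟨M, hM⟩ : ∃ M, (2 : ℝ) ^ (4 * L) = M := ⟨_, rfl⟩
  obtain ⟨y, hy⟩ : ∃ y, (k : ℝ) * Real.log k = y := ⟨_, rfl⟩
  have hx69 : 69 / 100 ≤ x := by
    have h1 := Real.log_two_gt_d9
    have h2 := Real.log_le_log (by norm_num) hn2
    rw [hx] at h2
    linarith
  have hM0 : 0 < M := hM ▸ Real.rpow_pos_of_pos (by norm_num) _
  have hy0 : 0 ≤ y := hy ▸ mul_nonneg (by linarith) (Real.log_nonneg hk1)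
  rw [hM] at hC
  rw [hy] at hm
  rw [hx] at hl
  have hxk : 69 / 100 ≤ x * k := by nlinarith
  have hlx : (l : ℝ) ≤ 10002 * x := by
    have := Nat.ceil_lt_add_one (show 0 ≤ 10000 * x by linarith)
    rw [← hl] at this
    linarith
  have hσx : (σ : ℝ) ≤ 20006 * (x * k) := by
    rw [hσ]
    push_cast
    have : (l : ℝ) * (k + 1) ≤ 10002 * x * (2 * k) :=
      mul_le_mul hlx (by linarith) (by linarith) (by linarith)
    nlinarith
  have hτx : (τ : ℝ) ≤ 3 * (d * k) := by
    rw [hτ]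
    push_cast
    nlinarith
  have hσ1 : (1 : ℝ) ≤ σ := by
    rw [hσ]
    exact_mod_cast Nat.le_add_left 1 _
  -- `E ^ 4 = 2 ^ (4 * m)` also absorbs the powers of `m`
  obtain ⟨E, hE⟩ : ∃ E, (2 : ℝ) ^ m = E := ⟨_, rfl⟩
  have hE1 : 1 ≤ E := hE ▸ one_le_pow₀ (by norm_num)
  have hP : (m : ℝ) + σ ≤ E * σ := by
    have h1 : (m : ℝ) + 1 ≤ E := by
      rw [← hE]
      exact_mod_cast Nat.lt_two_pow_self (n := m)
    nlinarith [Nat.cast_nonneg (α := ℝ) m]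
  obtain ⟨Y, hY⟩ : ∃ Y, (2 : ℝ) ^ (C * y) = Y := ⟨_, rfl⟩
  have hY0 : 0 < Y := hY ▸ Real.rpow_pos_of_pos (by norm_num) _
  have hEMY : E ^ 4 ≤ M * Y := by
    rw [← hE, ← pow_mul, ← Real.rpow_natCast, ← hM, ← hY, ← Real.rpow_add (by norm_num)]
    refine Real.rpow_le_rpow_of_exponent_le (by norm_num) ?_
    push_cast
    have : 4 * L ≤ C := by rw [hC]; linarith
    nlinarith [mul_le_mul_of_nonneg_right this hy0]
  have hE34 : E ^ 3 ≤ E ^ 4 := pow_le_pow_right₀ hE1 (by norm_num)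
  have hdk : 0 < (d : ℝ) * k := by positivity
  have hmain : E ^ 4 + 5 * (d * k) ≤ (M + 8) * (Y + d * k * x) := by
    have h1 : 5 * ((d : ℝ) * k) ≤ 8 * (d * k * x) := by nlinarith
    have h2 : 0 ≤ M * (d * k * x) := by positivity
    nlinarith
  have hσ2 : (σ : ℝ) ^ 2 ≤ 20006 ^ 2 * (x ^ 2 * k ^ 2) :=
    (pow_le_pow_left₀ (by linarith) hσx 2).trans (le_of_eq (by ring))
  have hσ3 : (σ : ℝ) ^ 3 ≤ 20006 ^ 3 * (x ^ 3 * k ^ 3) :=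
    (pow_le_pow_left₀ (by linarith) hσx 3).trans (le_of_eq (by ring))
  have hx0 : 0 < x := by linarith
  have hn0 : (0 : ℝ) ≤ n := by linarith
  have hZ : 0 ≤ Y + d * k * x := by positivity
  constructor
  · rw [queryBound, hx, hy, hY]
    push_cast
    rw [hE]
    have h1 : 4 * (E * ((m : ℝ) + σ) ^ 2) + 4 * (τ * (σ : ℝ) ^ 2) ≤
        4 * (20006 ^ 2 * (x ^ 2 * k ^ 2)) * ((M + 8) * (Y + d * k * x)) := by
      have a1 : ((m : ℝ) + σ) ^ 2 ≤ (E * σ) ^ 2 := pow_le_pow_left₀ (by positivity) hP 2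
      have a2 : E * ((m : ℝ) + σ) ^ 2 ≤ E * (E * σ) ^ 2 :=
        mul_le_mul_of_nonneg_left a1 (by linarith)
      have a3 : (τ : ℝ) * (σ : ℝ) ^ 2 ≤ 3 * (d * k) * (σ : ℝ) ^ 2 :=
        mul_le_mul_of_nonneg_right hτx (by positivity)
      calc _ ≤ 4 * (E * (E * σ) ^ 2) + 4 * (3 * (d * k) * (σ : ℝ) ^ 2) := by linarith
        _ = 4 * (σ : ℝ) ^ 2 * (E ^ 3 + 3 * (d * k)) := by ring
        _ ≤ 4 * (20006 ^ 2 * (x ^ 2 * k ^ 2)) * ((M + 8) * (Y + d * k * x)) :=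
          mul_le_mul (by linarith) (by linarith) (by positivity) (by positivity)
    calc (l : ℝ) * (4 * (E * ((m : ℝ) + σ) ^ 2) + 4 * (τ * (σ : ℝ) ^ 2)) * n
        ≤ 10002 * x * (4 * (20006 ^ 2 * (x ^ 2 * k ^ 2)) * ((M + 8) * (Y + d * k * x))) * n :=
          mul_le_mul_of_nonneg_right (mul_le_mul hlx h1 (by positivity) (by positivity)) hn0
      _ = (10002 * 4 * 20006 ^ 2 * (M + 8)) * ((Y + d * k * x) * k ^ 2 * n * x ^ 3) := by ring
      _ ≤ C * ((Y + d * k * x) * k ^ 2 * n * x ^ 3) :=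
          mul_le_mul_of_nonneg_right (by rw [hC]; linarith) (by positivity)
  · rw [timeBound, hx, hy, hY]
    push_cast
    rw [hE]
    have h1 : 200 * (E * ((m : ℝ) + σ) ^ 3) + 300 * (τ * (σ : ℝ) ^ 3) ≤
        200 * (20006 ^ 3 * (x ^ 3 * k ^ 3)) * ((M + 8) * (Y + d * k * x)) := by
      have a1 : ((m : ℝ) + σ) ^ 3 ≤ (E * σ) ^ 3 := pow_le_pow_left₀ (by positivity) hP 3
      have a2 : E * ((m : ℝ) + σ) ^ 3 ≤ E * (E * σ) ^ 3 :=
        mul_le_mul_of_nonneg_left a1 (by linarith)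
      have a3 : (τ : ℝ) * (σ : ℝ) ^ 3 ≤ 3 * (d * k) * (σ : ℝ) ^ 3 :=
        mul_le_mul_of_nonneg_right hτx (by positivity)
      have a4 : 0 ≤ (d : ℝ) * k * (σ : ℝ) ^ 3 := by positivity
      calc _ ≤ 200 * (E * (E * σ) ^ 3) + 300 * (3 * (d * k) * (σ : ℝ) ^ 3) := by linarith
        _ = 200 * (σ : ℝ) ^ 3 * (E ^ 4 + 5 * (d * k)) - 100 * (d * k * (σ : ℝ) ^ 3) := by ring
        _ ≤ 200 * (σ : ℝ) ^ 3 * (E ^ 4 + 5 * (d * k)) := by linarith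
        _ ≤ 200 * (20006 ^ 3 * (x ^ 3 * k ^ 3)) * ((M + 8) * (Y + d * k * x)) :=
          mul_le_mul (by linarith) (by linarith) (by positivity) (by positivity)
    calc (l : ℝ) * (200 * (E * ((m : ℝ) + σ) ^ 3) + 300 * (τ * (σ : ℝ) ^ 3)) * n
        ≤ 10002 * x * (200 * (20006 ^ 3 * (x ^ 3 * k ^ 3)) * ((M + 8) * (Y + d * k * x))) * n :=
          mul_le_mul_of_nonneg_right (mul_le_mul hlx h1 (by positivity) (by positivity)) hn0
      _ = (10002 * 200 * 20006 ^ 3 * (M + 8)) * ((Y + d * k * x) * k ^ 3 * n * x ^ 4) := by ring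
      _ ≤ C * ((Y + d * k * x) * k ^ 3 * n * x ^ 4) :=
          mul_le_mul_of_nonneg_right (by rw [hC]; linarith) (by positivity)

/-- At logarithmic depth the bound on the probability of failure drops below `1 / n ^ 8`. -/
theorem pow_mul_sq_le {n l : ℕ} (hn : 2 ≤ n) (hl : l = ⌈10000 * Real.log n⌉₊) :
    (999 / 1000 : ℝ) ^ l * (n : ℝ) ^ 2 ≤ 1 / (n : ℝ) ^ 8 := by
  have hn0 : (0 : ℝ) < n := by exact_mod_cast (by omega : 0 < n)
  have h1 : (999 / 1000 : ℝ) ≤ Real.exp (-(1 / 1000)) := by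
    have := Real.add_one_le_exp (-(1 / 1000) : ℝ)
    linarith
  have h2 : (999 / 1000 : ℝ) ^ l ≤ Real.exp (-(10 * Real.log n)) := by
    refine (pow_le_pow_left₀ (by norm_num) h1 l).trans ?_
    rw [← Real.exp_nat_mul]
    refine Real.exp_le_exp.2 ?_
    have := Nat.le_ceil (10000 * Real.log n)
    rw [← hl] at this
    linarith
  have h3 : Real.exp (-(10 * Real.log n)) = 1 / (n : ℝ) ^ 10 := by
    rw [Real.exp_neg, mul_comm, Real.exp_mul, Real.exp_log hn0, one_div]
    norm_cast
  rw [h3] at h2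
  calc (999 / 1000 : ℝ) ^ l * (n : ℝ) ^ 2 ≤ 1 / (n : ℝ) ^ 10 * (n : ℝ) ^ 2 :=
        mul_le_mul_of_nonneg_right h2 (by positivity)
    _ = 1 / (n : ℝ) ^ 8 := by field_simp

end Cost

/-! ### Connected graphs -/

section Recovery

variable {n : ℕ} {G : SimpleGraph (Fin n)}

theorem isComp_univ (hG : G.Connected) :
    IsComp G ([] : List (Fin n)).toFinset (List.finRange n).toFinset := by
  obtain ⟨v⟩ := hG.nonempty
  refine ⟨⟨v, by simp⟩, fun v _ w => ?_⟩
  simp only [List.mem_toFinset, List.mem_finRange, true_iff]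
  obtain ⟨p⟩ := hG v w
  exact ⟨p, by simp⟩

theorem exists_adj_of_connected (hG : G.Connected) (hn : 2 ≤ n) : ∃ u v, G.Adj u v := by
  have : Nontrivial (Fin n) := Fin.nontrivial_iff_two_le.2 hn
  obtain ⟨v⟩ := hG.nonempty
  obtain ⟨w, hw⟩ := hG.preconnected.exists_adj_of_nontrivial v
  exact ⟨v, w, hw⟩

/-- An edge lies in a bag with at least two vertices. -/
theorem one_le_treewidth {u v : Fin n} (h : G.Adj u v) : 1 ≤ treewidth G := by
  obtain ⟨t, D, hD⟩ := exists_treeDecomposition G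
  obtain ⟨i, hu, hv⟩ := D.edge_mem u v h
  have h1 := Finset.one_lt_card.2 ⟨u, hu, v, hv, h.ne⟩
  have h2 := hD i
  omega

end Recovery

end CovarianceRecovery

/-! ### Recovery of the concentration matrix -/

open CovarianceRecovery in
theorem theorem4 :
    ∀ L : ℝ, 0 < L → ∃ C : ℝ, 0 < C ∧
      ∀ (n k d m : ℕ) (r δ τ : ℝ) (G : SimpleGraph (Fin n)) [DecidableRel G.Adj]
        (Cov : Matrix (Fin n) (Fin n) ℝ),
        G.Connected →
        CovarianceRecovery.treewidth G ≤ k →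
        G.maxDegree ≤ d →
        Cov ∈ CovarianceRecovery.Model G →
        CovarianceRecovery.Generic G Cov →
        11 * (k : ℝ) ≤ r → 0 < δ → δ ≤ 1 / 24 → 0 < τ → τ ≤ 1 / 3 →
        CovarianceRecovery.SampleBound m r δ τ →
        (m : ℝ) ≤ L * (1 + k * Real.log k) →
        (∀ depth, ∀ o ∈ (CovarianceRecovery.runReconstruct Cov m depth).support,
          ∀ T, o.value = some T → CovarianceRecovery.toMatrix T = Cov⁻¹) ∧
        ∃ depth₀, ∀ depth ≥ depth₀,
          ENNReal.ofReal (1 - 1 / (n : ℝ) ^ 8) ≤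
            (CovarianceRecovery.runReconstruct Cov m depth).toOuterMeasure
              {o | (∃ T, o.value = some T ∧ CovarianceRecovery.toMatrix T = Cov⁻¹) ∧
                (o.queries : ℝ) ≤ CovarianceRecovery.queryBound C n k d ∧
                (o.time : ℝ) ≤ CovarianceRecovery.timeBound C n k d} := by
  intro L hL
  -- `4 * L` bounds the exponent of `2 ^ (4 * m)`, the other term absorbs all numerical factors
  obtain ⟨C, hC⟩ : ∃ C : ℝ, C = 4 * L + 10 ^ 20 * ((2 : ℝ) ^ (4 * L) + 7) := ⟨_, rfl⟩
  have hC0 : 0 < C := by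
    rw [hC]
    have := Real.rpow_pos_of_pos (show (0 : ℝ) < 2 by norm_num) (4 * L)
    positivity
  refine ⟨C, hC0, ?_⟩
  intro n k d m r δ τ G _ Cov hG hk hd hCov hgen hr hδ hδ' _ _ hsb hm
  have hK := concentration_of_mem_model hCov
  have hbal := hasBalancedSeparators_of_treewidth_le hk
  have hcomp := isComp_univ hG
  have hspec : ∀ depth, Spec Cov (reconstruct m depth (List.finRange n) [])
      (fun res => res = none ∨ ∃ T, res = some T ∧ toMatrix T = Cov⁻¹)
      (depth * (4 * (2 ^ m * (m + (depth * (k + 1) + 1)) ^ 2) +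
        4 * ((d * (k + 1) + 1) * (depth * (k + 1) + 1) ^ 2)) * n)
      (depth * (200 * (2 ^ m * (m + (depth * (k + 1) + 1)) ^ 3) +
        300 * ((d * (k + 1) + 1) * (depth * (k + 1) + 1) ^ 3)) * n) := by
    intro depth
    refine Spec.mono (spec_reconstruct hK hgen hbal hd le_rfl (by nlinarith) m depth
      (List.finRange n) [] (List.nodup_finRange n) List.nodup_nil hcomp
      (σ := depth * (k + 1) + 1) (by simp)) ?_ (by rw [List.length_finRange])
      (by rw [List.length_finRange])
    rintro res (h | ⟨T, hT, hT'⟩)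
    · exact Or.inl h
    · exact Or.inr ⟨T, hT, (hT'.congr (by simp)).toMatrix⟩
  constructor
  · intro depth o ho T hT
    rcases (hspec depth o ho).1 with h | ⟨T', hT', h⟩
    · rw [h] at hT
      exact absurd hT (by simp)
    · rw [hT'] at hT
      exact Option.some.inj hT ▸ h
  obtain ⟨l, hl⟩ : ∃ l, l = ⌈10000 * Real.log n⌉₊ := ⟨_, rfl⟩
  refine ⟨l, fun depth hdepth => ?_⟩
  rcases lt_or_ge n 2 with hn | hn
  · -- a single vertex: the probability bound is trivial
    obtain ⟨v⟩ := hG.nonempty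
    have hn1 : n = 1 := by
      have := v.pos
      omega
    have h0 : 1 - 1 / (n : ℝ) ^ 8 = 0 := by rw [hn1]; norm_num
    rw [h0, ENNReal.ofReal_zero]
    exact zero_le
  obtain ⟨u, v, huv⟩ := exists_adj_of_connected hG hn
  have hk1 : 1 ≤ k := (one_le_treewidth huv).trans hk
  have hd1 : 1 ≤ d :=
    ((G.degree_pos_iff_exists_adj u).2 ⟨v, huv⟩).trans_le ((G.degree_le_maxDegree u).trans hd)
  obtain ⟨hq, ht⟩ := cost_le_bounds hL hC hn hk1 hd1 hm hl rfl rfl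
  have hfail := failProb_reconstruct hK hgen hk1 hbal (hsb.le hk1 hr hδ hδ') l
    (List.finRange n) [] (List.nodup_finRange n) List.nodup_nil hcomp
  rw [List.length_finRange] at hfail
  rw [runReconstruct, toOuterMeasure_run]
  refine ENNReal.ofReal_le_ofReal ?_
  set E : Set (Outcome (Option (Sparse n ℝ))) :=
    {o | (∃ T, o.value = some T ∧ toMatrix T = Cov⁻¹) ∧
      (o.queries : ℝ) ≤ queryBound C n k d ∧ (o.time : ℝ) ≤ timeBound C n k d} with hE
  -- it suffices to bound the executions of depth at most `l`
  refine le_trans ?_ (lessDefined_reconstruct_of_le m hdepth (List.finRange n) []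
    (E.indicator 1) (fun o => Set.indicator_nonneg (fun _ _ => zero_le_one) o) fun o ho => ?_)
  swap
  · refine Set.indicator_of_notMem (fun hoE => ?_) _
    obtain ⟨⟨T, hT, -⟩, -⟩ := hoE
    rw [ho] at hT
    exact absurd hT (by simp)
  have hsum : (1 : ℝ) ≤ ev Cov (reconstruct m l (List.finRange n) []) (E.indicator 1) +
      failProb Cov (reconstruct m l (List.finRange n) []) := by
    rw [failProb, valueEv, ← ev_add]
    refine (ev_const (Cov := Cov) (reconstruct m l (List.finRange n) []) 1).ge.trans
      (ev_mono (hspec l) fun o ho hoq hot => ?_)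
    rcases ho with ho | ⟨T, hT, hT'⟩
    · simp only [ho, Option.isNone_none, if_true]
      exact le_add_of_nonneg_left (Set.indicator_nonneg (fun _ _ => zero_le_one) o)
    · have hoE : o ∈ E := ⟨⟨T, hT, hT'⟩, le_trans (by exact_mod_cast hoq) hq,
        le_trans (by exact_mod_cast hot) ht⟩
      rw [Set.indicator_of_mem hoE]
      simp [hT]
  have := hfail.trans (pow_mul_sq_le hn hl)
  linarith
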